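/- Let $k$ be a finite field and let $\mathcal A$ be an essentially small hereditary abelian $k$-category (that is, $\mathrm{Ext}^p_{\mathcal A}=0$ for $p\ge 2$) with finite-dimensional homomorphism and extension spaces. Let $\mathcal C=\mathcal C_{\mathbb Z/2}(\mathcal A)$ be the abelian category of $\mathbb Z/2$-graded complexes $M^0\rightleftarrows M^1$ over $\mathcal A$. For $A,B\in\mathcal A$ let $C_A=(0\rightleftarrows A)$ be $A$ in degree $1$ and $C_B^*=(B\rightleftarrows 0)$ be $B$ in degree $0$. Let $\mathcal H(\mathcal C)$ be the $\mathbb Q$-vector space on the isomorphism classes $[M]$ of objects of $\mathcal C$, with the bilinear product $$[L]\diamond[M]=\sum_{[X]}\frac{|\mathrm{Ext}^1_{\mathcal C}(L,M)_X|}{|\mathrm{Hom}_{\mathcal C}(L,M)|}\,[X],$$ where $\mathrm{Ext}^1_{\mathcal C}(L,M)_X$ is the set of classes of extensions of $L$ by $M$ with middle term isomorphic to $X$. Let $I$ be the two-sided ideal generated by all $[L]-[K\oplus M]$ for which there is a short exact sequence $0\to K\to L\to M\to 0$ in $\mathcal C$ with $K$ acyclic, let $S\subset\mathcal H(\mathcal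 C)/I$ be the set of all $q[K]$ with $q\in\mathbb Q^\times$ and $K$ acyclic, and let $\mathcal{MH}_{\mathbb Z/2}(\mathcal A)$ be the universal $S$-inverting ring of $\mathcal H(\mathcal C)/I$. Let $K_0(\mathcal C_{ac})$ be the Grothendieck group of the exact category of acyclic complexes in $\mathcal C$. Then the following hold. 1. $\mathcal H(\mathcal C)$ is associative with unit $[0]$, and $\mathcal{MH}_{\mathbb Z/2}(\mathcal A)$ is the right localization $(\mathcal H(\mathcal C)/I)[S^{-1}]$: writing $i$ for the canonical map, $i(s)$ is a unit for every $s\in S$, every element has the form $i(a)i(s)^{-1}$ with $s\in S$, and $i(a)=i(b)$ if and only if $at=bt$ for some $t\in S$. 2. There is a bilinear form $\langle\cdot,\cdot\rangle:K_0(\mathcal C_{ac})\times K_0(\mathcal C_{ac})\to\mathbb Q^\times$ with $\langle[K],[L]\rangle=|\mathrm{Hom}_{\mathcal C}(K,L)|/|\mathrm{Ext}^1_{\mathcal C}(K,L)|$ for all acyclic $K,L$. Let the quantum torus $\mathbb T_{\mathbb Z/2,ac}(\mathcal A)$ be the $\mathbb Q$-vector space with basis $(e_\alpha)_{\alpha\in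 K_0(\mathcal C_{ac})}$ and product $e_\alpha e_\beta=\langle\alpha,\beta\rangle^{-1}e_{\alpha+\beta}$. There is a ring homomorphism $\mathbb T_{\mathbb Z/2,ac}(\mathcal A)\to\mathcal{MH}_{\mathbb Z/2}(\mathcal A)$ with $e_{[K]}\mapsto[K]$ for all acyclic $K$. Through it, $\mathcal{MH}_{\mathbb Z/2}(\mathcal A)$ is a free left module and a free right module over $\mathbb T_{\mathbb Z/2,ac}(\mathcal A)$, and in both cases the classes $[C_A\oplus C_B^*]$, indexed by $([A],[B])\in\mathrm{Iso}(\mathcal A)\times\mathrm{Iso}(\mathcal A)$, form a basis. 3. Mapping $([A],[B])$ to the isomorphism class of $C_A\oplus C_B^*$ is a bijection from $\mathrm{Iso}(\mathcal A)\times\mathrm{Iso}(\mathcal A)$ to the set of isomorphism classes of objects of the $\mathbb Z/2$-graded derived category, the localization of $\mathcal C$ at the quasi-isomorphisms. -/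

import Mathlib

open CategoryTheory CategoryTheory.Limits
open scoped ZeroObject

universe u v w

namespace ModifiedHall

noncomputable section

/-! ### Isomorphism classes and `Ext` -/

/-- The isomorphism classes of objects of a category. -/
def IsoClass (C : Type u) [Category.{v} C] : Type u := Quotient (isIsomorphicSetoid C)

/-- The isomorphism class of an object. -/
def IsoClass.mk {C : Type u} [Category.{v} C] (X : C) : IsoClass C :=
  Quotient.mk (isIsomorphicSetoid C) X

/-- A representative of an isomorphism class. -/
def IsoClass.rep {C : Type u} [Category.{v} C] (x : IsoClass C) : C :=
  @Quotient.out C (isIsomorphicSetoid C) x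

/-- The map on isomorphism classes induced by a functor. -/
def IsoClass.map {C : Type*} [Category* C] {D : Type*} [Category* D] (F : C ⥤ D) :
    IsoClass C → IsoClass D :=
  Quotient.lift (fun X => IsoClass.mk (F.obj X))
    (fun _ _ h => Quotient.sound (s := isIsomorphicSetoid D) (h.elim fun e => ⟨F.mapIso e⟩))

/-- The extension group `Ext^n(X, Y)` of an abelian category, in the universe in which it exists
without any smallness assumption. -/
abbrev ExtGroup {C : Type u} [Category.{v} C] [Abelian C] (X Y : C) (n : ℕ) : Type (max u v) :=
  haveI := HasExt.standard.{v, u} C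
  Abelian.Ext.{max u v} X Y n

/-- The set `Ext^1(L, M)_X` of the classes of the extensions `0 ⟶ M ⟶ X' ⟶ L ⟶ 0` with `X' ≅ X`. -/
def extWithMiddle {C : Type u} [Category.{v} C] [Abelian C] (L M X : C) : Set (ExtGroup L M 1) :=
  haveI := HasExt.standard.{v, u} C
  {e | ∃ (f : M ⟶ X) (g : X ⟶ L) (h : f ≫ g = 0) (hS : (ShortComplex.mk f g h).ShortExact),
    hS.extClass = e}

/-! ### The Ringel-Hall algebra of an abelian category -/

/-- The structure constant `|Ext^1(L, M)_X| / |Hom(L, M)|`. -/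
def hallCoeff {C : Type u} [Category.{v} C] [Abelian C] (L M X : C) : ℚ :=
  (Nat.card (extWithMiddle L M X) : ℚ) / (Nat.card (L ⟶ M) : ℚ)

/-- The underlying space of the Ringel-Hall algebra: the `ℚ`-vector space on the isomorphism
classes of objects. -/
def HallAlgebra (C : Type u) [Category.{v} C] : Type u := IsoClass C →₀ ℚ

instance (C : Type u) [Category.{v} C] : AddCommGroup (HallAlgebra C) :=
  inferInstanceAs (AddCommGroup (IsoClass C →₀ ℚ))

instance (C : Type u) [Category.{v} C] : Module ℚ (HallAlgebra C) :=
  inferInstanceAs (Module ℚ (IsoClass C →₀ ℚ))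

/-- The basis element `[X]` of the Ringel-Hall algebra. -/
def HallAlgebra.cls {C : Type u} [Category.{v} C] (X : C) : HallAlgebra C :=
  (Finsupp.single (IsoClass.mk X) 1 : IsoClass C →₀ ℚ)

/-- The Hall product of two isomorphism classes,
`∑_[X] |Ext^1(L, M)_X| / |Hom(L, M)| [X]` (finitely many terms when `Ext^1(L, M)` is finite). -/
def hallProduct {C : Type u} [Category.{v} C] [Abelian C] (l m : IsoClass C) : HallAlgebra C :=
  ∑ᶠ x : IsoClass C, hallCoeff l.rep m.rep x.rep • HallAlgebra.cls x.rep

/-- The Hall product, extended bilinearly. -/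
def hallMul (C : Type u) [Category.{v} C] [Abelian C] :
    HallAlgebra C →ₗ[ℚ] HallAlgebra C →ₗ[ℚ] HallAlgebra C :=
  Finsupp.linearCombination ℚ (fun l : IsoClass C =>
    (Finsupp.linearCombination ℚ (fun m : IsoClass C => hallProduct l m) :
      (IsoClass C →₀ ℚ) →ₗ[ℚ] HallAlgebra C))

instance (C : Type u) [Category.{v} C] [Abelian C] : NonUnitalNonAssocRing (HallAlgebra C) :=
  { (inferInstance : AddCommGroup (HallAlgebra C)) with
    mul := fun a b => hallMul C a b
    left_distrib := fun a b c => map_add (hallMul C a) b c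
    right_distrib := fun a b c => by
      change hallMul C (a + b) c = hallMul C a c + hallMul C b c
      rw [map_add, LinearMap.add_apply]
    zero_mul := fun a => by
      change hallMul C 0 a = 0
      rw [map_zero, LinearMap.zero_apply]
    mul_zero := fun a => map_zero (hallMul C a) }

/-! ### Right localization -/

/-- `i : Q → R` is a right localization of `Q` (with identity `e`) with respect to `S`. As `i s` is a
unit for `s ∈ S`, the condition `r * i s = i a` says `r = i a * (i s)⁻¹`, and `i a = i b` says
`i a * (i s)⁻¹ = i b * (i s)⁻¹`. -/
structure IsRightLocalization {Q : Type*} [NonUnitalNonAssocRing Q] (e : Q) (S : Set Q)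
    {R : Type*} [Ring R] (i : Q →ₙ+* R) : Prop where
  map_one : i e = 1
  isUnit : ∀ s ∈ S, IsUnit (i s)
  surj : ∀ r : R, ∃ a : Q, ∃ s ∈ S, r * i s = i a
  eq_iff : ∀ a b : Q, i a = i b ↔ ∃ t ∈ S, a * t = b * t

/-- The relations of the universal ring inverting `S`: the addition, multiplication and identity `e`
of `Q` are kept, and each `s ∈ S` gets a two-sided inverse. -/
inductive InvertRel {Q : Type*} [NonUnitalNonAssocRing Q] (e : Q) (S : Set Q) :
    FreeAlgebra ℤ (Q ⊕ S) → FreeAlgebra ℤ (Q ⊕ S) → Prop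
  | add (a b : Q) : InvertRel e S (FreeAlgebra.ι ℤ (Sum.inl (a + b)))
      (FreeAlgebra.ι ℤ (Sum.inl a) + FreeAlgebra.ι ℤ (Sum.inl b))
  | mul (a b : Q) : InvertRel e S (FreeAlgebra.ι ℤ (Sum.inl (a * b)))
      (FreeAlgebra.ι ℤ (Sum.inl a) * FreeAlgebra.ι ℤ (Sum.inl b))
  | one : InvertRel e S (FreeAlgebra.ι ℤ (Sum.inl e)) 1
  | mul_inv (s : S) : InvertRel e S
      (FreeAlgebra.ι ℤ (Sum.inl (s : Q)) * FreeAlgebra.ι ℤ (Sum.inr s)) 1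
  | inv_mul (s : S) : InvertRel e S
      (FreeAlgebra.ι ℤ (Sum.inr s) * FreeAlgebra.ι ℤ (Sum.inl (s : Q))) 1

/-- The universal `S`-inverting ring of `Q`. -/
def InvertingRing {Q : Type*} [NonUnitalNonAssocRing Q] (e : Q) (S : Set Q) : Type _ :=
  RingQuot (InvertRel e S)

instance {Q : Type*} [NonUnitalNonAssocRing Q] (e : Q) (S : Set Q) : Ring (InvertingRing e S) :=
  inferInstanceAs (Ring (RingQuot (InvertRel e S)))

/-- The canonical map from `Q` to its universal `S`-inverting ring. -/
def InvertingRing.of {Q : Type*} [NonUnitalNonAssocRing Q] (e : Q) (S : Set Q) :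
    Q →ₙ+* InvertingRing e S where
  toFun a := RingQuot.mkAlgHom ℤ (InvertRel e S) (FreeAlgebra.ι ℤ (Sum.inl a))
  map_mul' a b := by
    rw [RingQuot.mkAlgHom_rel ℤ (InvertRel.mul a b)]
    exact map_mul _ _ _
  map_add' a b := by
    rw [RingQuot.mkAlgHom_rel ℤ (InvertRel.add a b)]
    exact map_add _ _ _
  map_zero' := by
    have h := RingQuot.mkAlgHom_rel ℤ (InvertRel.add (e := e) (S := S) 0 0)
    rw [add_zero, map_add] at h
    exact left_eq_add.mp h

/-! ### `ℤ/2`-graded complexes -/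

/-- The category of `ℤ/2`-graded complexes `M⁰ ⇄ M¹`. -/
abbrev Z2Complex (A : Type u) [Category.{v} A] [Abelian A] : Type (max u v) :=
  HomologicalComplex A (ComplexShape.up (ZMod 2))

/-- The derived category of `ℤ/2`-graded complexes: quasi-isomorphisms are inverted. -/
abbrev Z2Derived (A : Type u) [Category.{v} A] [Abelian A] : Type (max u v) :=
  (HomologicalComplex.quasiIso A (ComplexShape.up (ZMod 2))).Localization

/-- The localization functor to the derived category. -/
abbrev toZ2Derived (A : Type u) [Category.{v} A] [Abelian A] : Z2Complex A ⥤ Z2Derived A :=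
  (HomologicalComplex.quasiIso A (ComplexShape.up (ZMod 2))).Q

/-- The complex `C_X = (0 ⇄ X)`, with `X` in degree `1`. -/
abbrev stalkOne {A : Type u} [Category.{v} A] [Abelian A] (X : A) : Z2Complex A :=
  (HomologicalComplex.single A (ComplexShape.up (ZMod 2)) 1).obj X

/-- The complex `C_X^* = (X ⇄ 0)`, with `X` in degree `0`. -/
abbrev stalkZero {A : Type u} [Category.{v} A] [Abelian A] (X : A) : Z2Complex A :=
  (HomologicalComplex.single A (ComplexShape.up (ZMod 2)) 0).obj X

/-- The isomorphism class `[C_A ⊕ C_B^*]`, for isomorphism classes `[A]` and `[B]`. -/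
def stalkClass {A : Type u} [Category.{v} A] [Abelian A] (p : IsoClass A × IsoClass A) :
    IsoClass (Z2Complex A) :=
  IsoClass.mk (stalkOne p.1.rep ⊞ stalkZero p.2.rep)

/-! ### The modified Ringel-Hall algebra -/

/-- The two-sided ideal generated by all `[L] - [K ⊕ M]` for short exact sequences
`0 ⟶ K ⟶ L ⟶ M ⟶ 0` with `K` acyclic. -/
def hallIdeal (A : Type u) [Category.{v} A] [Abelian A] : TwoSidedIdeal (HallAlgebra (Z2Complex A)) :=
  TwoSidedIdeal.span
    {x | ∃ T : ShortComplex (Z2Complex A), T.ShortExact ∧ T.X₁.Acyclic ∧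
      x = HallAlgebra.cls T.X₂ - HallAlgebra.cls (T.X₁ ⊞ T.X₃)}

/-- The quotient of the Hall algebra of `ℤ/2`-graded complexes by the ideal `hallIdeal`. -/
abbrev HallQuotient (A : Type u) [Category.{v} A] [Abelian A] : Type (max u v) :=
  (hallIdeal A).ringCon.Quotient

/-- The quotient map. -/
def toHallQuotient {A : Type u} [Category.{v} A] [Abelian A] (x : HallAlgebra (Z2Complex A)) :
    HallQuotient A :=
  (hallIdeal A).ringCon.toQuotient x

/-- The identity of the quotient algebra, the class of the zero complex. -/
def hallOne (A : Type u) [Category.{v} A] [Abelian A] : HallQuotient A :=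
  toHallQuotient (HallAlgebra.cls 0)

/-- The set of all `q[K]`, with `q` a nonzero rational number and `K` acyclic. -/
def acyclicSet (A : Type u) [Category.{v} A] [Abelian A] : Set (HallQuotient A) :=
  {x | ∃ (q : ℚ) (K : Z2Complex A), q ≠ 0 ∧ K.Acyclic ∧ x = toHallQuotient (q • HallAlgebra.cls K)}

/-- The modified Ringel-Hall algebra: the elements of `acyclicSet` are inverted in `HallQuotient`. -/
abbrev ModifiedHallAlgebra (A : Type u) [Category.{v} A] [Abelian A] : Type (max u v) :=
  InvertingRing (hallOne A) (acyclicSet A)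

/-- The canonical map from the quotient algebra to the modified Ringel-Hall algebra. -/
abbrev toModifiedHall (A : Type u) [Category.{v} A] [Abelian A] :
    HallQuotient A →ₙ+* ModifiedHallAlgebra A :=
  InvertingRing.of (hallOne A) (acyclicSet A)

/-- The class of a complex in the modified Ringel-Hall algebra. -/
def mhClass {A : Type u} [Category.{v} A] [Abelian A] (M : Z2Complex A) : ModifiedHallAlgebra A :=
  toModifiedHall A (toHallQuotient (HallAlgebra.cls M))

/-! ### The quantum torus of acyclic complexes -/

/-- The acyclic `ℤ/2`-graded complexes. -/
abbrev AcyclicComplex (A : Type u) [Category.{v} A] [Abelian A] : Type (max u v) :=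
  {K : Z2Complex A // K.Acyclic}

/-- The Grothendieck group of the exact category of acyclic complexes: generated by the acyclic
complexes, with `[K₂] = [K₁] + [K₃]` for short exact sequences `0 ⟶ K₁ ⟶ K₂ ⟶ K₃ ⟶ 0`. -/
abbrev AcyclicK0 (A : Type u) [Category.{v} A] [Abelian A] : Type (max u v) :=
  FreeAbelianGroup (AcyclicComplex A) ⧸ AddSubgroup.closure
    {x : FreeAbelianGroup (AcyclicComplex A) | ∃ (K₁ K₂ K₃ : AcyclicComplex A)
      (f : K₁.1 ⟶ K₂.1) (g : K₂.1 ⟶ K₃.1) (h : f ≫ g = 0), (ShortComplex.mk f g h).ShortExact ∧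
      x = FreeAbelianGroup.of K₂ - FreeAbelianGroup.of K₁ - FreeAbelianGroup.of K₃}

/-- The class of an acyclic complex in the Grothendieck group. -/
def AcyclicK0.cls {A : Type u} [Category.{v} A] [Abelian A] (K : AcyclicComplex A) : AcyclicK0 A :=
  QuotientAddGroup.mk (FreeAbelianGroup.of K)

/-- `χ` is the Euler form on the Grothendieck group of acyclic complexes: the bilinear form with
values in `ℚˣ` and `χ([K], [L]) = |Hom(K, L)| / |Ext^1(K, L)|`. Bilinearity is part of the type, and
the values on classes determine `χ`. -/
def IsEulerForm {A : Type u} [Category.{v} A] [Abelian A]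
    (χ : AcyclicK0 A →+ AcyclicK0 A →+ Additive ℚˣ) : Prop :=
  ∀ K L : AcyclicComplex A,
    ((χ (AcyclicK0.cls K) (AcyclicK0.cls L)).toMul : ℚ) =
      (Nat.card (K.1 ⟶ L.1) : ℚ) / (Nat.card (ExtGroup K.1 L.1 1) : ℚ)

/-- The group algebra over `ℚ` of an abelian group `G`, with its multiplication twisted by the
inverse of a bilinear form `χ`: on basis elements `e_a * e_b = χ(a, b)⁻¹ e_{a + b}`. -/
def TwistedGroupAlgebra {G : Type*} [AddCommGroup G] (_χ : G →+ G →+ Additive ℚˣ) : Type _ :=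
  G →₀ ℚ

namespace TwistedGroupAlgebra

variable {G : Type*} [AddCommGroup G] (χ : G →+ G →+ Additive ℚˣ)

instance : AddCommGroup (TwistedGroupAlgebra χ) := inferInstanceAs (AddCommGroup (G →₀ ℚ))

instance : Module ℚ (TwistedGroupAlgebra χ) := inferInstanceAs (Module ℚ (G →₀ ℚ))

/-- The basis element of the twisted group algebra indexed by `a`. -/
def of (a : G) : TwistedGroupAlgebra χ := (Finsupp.single a 1 : G →₀ ℚ)

/-- The twisted multiplication as a bilinear map. -/
def mulMap : TwistedGroupAlgebra χ →ₗ[ℚ] TwistedGroupAlgebra χ →ₗ[ℚ] TwistedGroupAlgebra χ :=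
  Finsupp.linearCombination ℚ (fun a : G =>
    (Finsupp.linearCombination ℚ (fun b : G =>
      (((χ a b).toMul⁻¹ : ℚˣ) : ℚ) • of χ (a + b)) : (G →₀ ℚ) →ₗ[ℚ] TwistedGroupAlgebra χ))

theorem mulMap_of (a b : G) :
    mulMap χ (of χ a) (of χ b) = (((χ a b).toMul⁻¹ : ℚˣ) : ℚ) • of χ (a + b) := by
  have h1 : mulMap χ (of χ a) = (Finsupp.linearCombination ℚ (fun b : G =>
      (((χ a b).toMul⁻¹ : ℚˣ) : ℚ) • of χ (a + b)) : (G →₀ ℚ) →ₗ[ℚ] TwistedGroupAlgebra χ) := by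
    refine (Finsupp.linearCombination_single ℚ (1 : ℚ) a).trans ?_
    exact one_smul ℚ _
  rw [h1]
  refine (Finsupp.linearCombination_single ℚ (1 : ℚ) b).trans ?_
  exact one_smul ℚ _

@[elab_as_elim]
theorem induction {p : TwistedGroupAlgebra χ → Prop} (x : TwistedGroupAlgebra χ)
    (h0 : p 0) (hadd : ∀ x y, p x → p y → p (x + y)) (hof : ∀ (c : ℚ) a, p (c • of χ a)) : p x := by
  refine Finsupp.induction_linear (motive := fun y : G →₀ ℚ => p y) x h0
    (fun x y hx hy => hadd x y hx hy) (fun a c => ?_)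
  have h := hof c a
  have e : (c • of χ a : TwistedGroupAlgebra χ) = (Finsupp.single a c : G →₀ ℚ) := by
    change c • (Finsupp.single a 1 : G →₀ ℚ) = _
    rw [Finsupp.smul_single, smul_eq_mul, mul_one]
  rwa [e] at h

theorem mulMap_assoc (x y z : TwistedGroupAlgebra χ) :
    mulMap χ (mulMap χ x y) z = mulMap χ x (mulMap χ y z) := by
  induction x using TwistedGroupAlgebra.induction with
  | h0 => simp
  | hadd x x' hx hx' => simp [hx, hx']
  | hof r a =>
    induction y using TwistedGroupAlgebra.induction with
    | h0 => simp
    | hadd y y' hy hy' => simp only [map_add, LinearMap.add_apply, hy, hy']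
    | hof s b =>
      induction z using TwistedGroupAlgebra.induction with
      | h0 => simp
      | hadd z z' hz hz' => simp only [map_add, hz, hz']
      | hof t c =>
        simp only [map_smul, LinearMap.smul_apply, mulMap_of, smul_smul, map_add,
          AddMonoidHom.add_apply, toMul_add, mul_inv, Units.val_mul, add_assoc]
        congr 1
        ring

theorem one_mulMap (x : TwistedGroupAlgebra χ) : mulMap χ (of χ 0) x = x := by
  induction x using TwistedGroupAlgebra.induction with
  | h0 => simp
  | hadd x y hx hy => rw [map_add, hx, hy]
  | hof c a => simp [mulMap_of]

theorem mulMap_one (x : TwistedGroupAlgebra χ) : mulMap χ x (of χ 0) = x := by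
  induction x using TwistedGroupAlgebra.induction with
  | h0 => simp
  | hadd x y hx hy => rw [map_add, LinearMap.add_apply, hx, hy]
  | hof c a => simp [mulMap_of]

instance : Ring (TwistedGroupAlgebra χ) :=
  { (inferInstance : AddCommGroup (TwistedGroupAlgebra χ)) with
    mul := fun a b => mulMap χ a b
    one := of χ 0
    left_distrib := fun a b c => map_add (mulMap χ a) b c
    right_distrib := fun a b c => by
      change mulMap χ (a + b) c = mulMap χ a c + mulMap χ b c
      rw [map_add, LinearMap.add_apply]
    zero_mul := fun a => by
      change mulMap χ 0 a = 0
      rw [map_zero, LinearMap.zero_apply]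
    mul_zero := fun a => map_zero (mulMap χ a)
    mul_assoc := mulMap_assoc χ
    one_mul := one_mulMap χ
    mul_one := mulMap_one χ }

end TwistedGroupAlgebra

/-- The quantum torus of acyclic complexes: the group algebra of their Grothendieck group, twisted
by the inverse of the Euler form `χ`. -/
abbrev QuantumTorus {A : Type u} [Category.{v} A] [Abelian A]
    (χ : AcyclicK0 A →+ AcyclicK0 A →+ Additive ℚˣ) : Type (max u v) :=
  TwistedGroupAlgebra χ

/-! ### Bases along a ring homomorphism -/

/-- `b` is a basis of `R` as a left `T`-module, where `T` acts through `φ` and the left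
multiplication of `R`. -/
def IsLeftBasis {T R ι : Type*} [Ring T] [Ring R] (φ : T →+* R) (b : ι → R) : Prop :=
  letI : Module T R := Module.compHom R φ
  ∃ B : Module.Basis ι T R, ⇑B = b

/-- `b` is a basis of `R` as a right `T`-module, where `T` acts through `φ` and the right
multiplication of `R`. -/
def IsRightBasis {T R ι : Type*} [Ring T] [Ring R] (φ : T →+* R) (b : ι → R) : Prop :=
  letI : Module Tᵐᵒᵖ R := Module.compHom R (RingHom.op φ)
  ∃ B : Module.Basis ι Tᵐᵒᵖ R, ⇑B = b

end

end ModifiedHall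

open ModifiedHall

namespace ModifiedHall

open Abelian HomologicalComplex

/-! ### Extension classes: effaceability, realization, lifting -/

section Ext

variable {C : Type u} [Category.{v} C] [Abelian C]

/-! The Hall algebra of complexes is made to act on the vector space `TorusSpace A` with basis
K₀(C_ac) × Iso(A) × Iso(A), and the structure of the modified algebra is read off from this action.
A complex M has a `degree`: its homology classes together with its `defect` in K₀(C_ac), which
measures how far M is from its homology.

The hereditary hypothesis enters through `exists_lift_extension` and its dual: extensions lift along
epimorphisms because the obstruction lies in Ext². One consequence is a roof M ← X → H(M) whose two
legs are epimorphisms with acyclic kernels R and R' (`exists_roof`); then the defect of M is [R'] -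
[R]. Another is that acyclic complexes are resolved by contractible ones. Contractible complexes are
adjoint to evaluation on both sides, so their Ext groups embed in those of A, and it follows that
Ext²(M, K) = 0 = Ext²(K, M) for K acyclic and M arbitrary.

For an exact sequence 0 → K → L → M → 0 with K acyclic, this vanishing makes Ext¹(N, L) → Ext¹(N, M)
surjective, with fibres of constant size, and corresponding middle terms differ by K. In terms of
degrees, [N][L] is therefore [N][M] translated by [K] and divided by the Euler form of N and K
(`IsExtension.map_cls_mul_cls_right`). Roofs then show that left multiplication by N depends only on
degrees (`actObj_toTorusSpace`). The generators of the ideal act by zero (`act_of_isExtension`), and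
acyclic complexes act by invertible monomial operators (`act_acyclic_single`), so the modified Hall
algebra acts.

Conversely, an element whose image in the torus space vanishes is killed in the Hall quotient by
right multiplication by an acyclic complex (`mem_acyclicTorsion`). In the torus space, acyclic
classes commute with all classes up to nonzero scalars, which gives the Ore condition and the right
localization; it also makes evaluation at the class of the zero complex injective on the modified
algebra (`evalVacuum_injective`). The quantum torus acts on the same space by operators in the image
of the modified algebra, and so maps to it. In the coordinates given by evaluation, the products of
the e_a with [C_A ⊕ C_B^*], on either side, are nonzero multiples of the basis vectors indexed by
(a, ([A], [B])), whence both bases.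

Associativity is the double count of two-step filtrations that follows from Riedtmann's formula. For
the derived category, roofs become isomorphisms, and homology is an invariant that separates the
sums of stalk complexes. -/

lemma epi_f_of_quasiIsoAt_single {X : C} {K : CochainComplex C ℤ} {i : ℤ}
    (π : K ⟶ (single C (ComplexShape.up ℤ) i).obj X) [K.IsStrictlyLE i] [QuasiIsoAt π i] :
    Epi (π.f i) := by
  -- Since `K` vanishes above degree `i`, everything in degree `i` is a cycle, and `π.f i` is the
  -- projection to homology followed by isomorphisms.
  let e := K.iCyclesIso i (i + 1) (by simp)
    ((K.isZero_of_isStrictlyLE i (i + 1) (by simp)).eq_of_tgt _ _)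
  let α := e.inv ≫ K.homologyπ i ≫ homologyMap π i ≫ (singleObjHomologySelfIso _ _ _).hom
  have : π.f i = α ≫ (singleObjXSelf (ComplexShape.up ℤ) i X).inv := by
    rw [← cancel_epi e.hom]
    dsimp [α, e]
    simp only [Category.assoc, Iso.hom_inv_id_assoc]
    change K.iCycles i ≫ _ = _
    rw [homologyπ_naturality_assoc, homologyπ_singleObjHomologySelfIso_hom_assoc,
      ← singleObjCyclesSelfIso_inv_iCycles, Iso.hom_inv_id_assoc, ← cyclesMap_i]
  rw [this]
  infer_instance

/-- Write `φ` as a right fraction with denominator `π : K ⟶ X`, where `K` lives in degrees ≤ 0. The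
epimorphism `π.f 0` lifts to a map from `K.X 0`, placed in degree 0, to `K`; the numerator vanishes
on it because `L` is zero in degree 0. -/
lemma exists_epi_single_comp_eq_zero [HasDerivedCategory.{w} C] {X : C}
    {L : CochainComplex C ℤ} (φ : DerivedCategory.Q.obj ((single C (ComplexShape.up ℤ) 0).obj X) ⟶
      DerivedCategory.Q.obj L) (n : ℤ) (hn : n < 0) [L.IsStrictlyLE n] :
    ∃ (X' : C) (p : X' ⟶ X), Epi p ∧
      DerivedCategory.Q.map ((single C (ComplexShape.up ℤ) 0).map p) ≫ φ = 0 := by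
  have : CochainComplex.IsStrictlyLE ((single C (ComplexShape.up ℤ) 0).obj X) 0 :=
    inferInstanceAs (CochainComplex.IsStrictlyLE ((CochainComplex.singleFunctor C 0).obj X) 0)
  obtain ⟨K, _, π, h, g, rfl⟩ := DerivedCategory.right_fac_of_isStrictlyLE φ 0
  have hq := h
  rw [DerivedCategory.isIso_Q_map_iff_quasiIso] at hq
  have := epi_f_of_quasiIsoAt_single π
  let ι : (single C (ComplexShape.up ℤ) 0).obj (K.X 0) ⟶ K :=
    mkHomFromSingle (𝟙 _) (by
      rintro _ rfl
      apply (K.isZero_of_isStrictlyLE 0 1 (by simp)).eq_of_tgt)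
  let p : K.X 0 ⟶ X := π.f 0 ≫ (singleObjXSelf (ComplexShape.up ℤ) 0 X).hom
  have hp : (single C (ComplexShape.up ℤ) 0).map p = ι ≫ π := by
    apply HomologicalComplex.from_single_hom_ext
    rw [single_map_f_self]
    simp [ι, p]
  have hg : ι ≫ g = 0 := by
    apply HomologicalComplex.from_single_hom_ext
    apply (L.isZero_of_isStrictlyLE n 0 hn).eq_of_tgt
  refine ⟨_, p, inferInstanceAs (Epi (_ ≫ _)), ?_⟩
  rw [hp, Functor.map_comp, Category.assoc, IsIso.hom_inv_id_assoc, ← Functor.map_comp, hg,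
    Functor.map_zero]

/-- The pushout of a short exact sequence. -/
lemma exists_shortExact_pushout {S : ShortComplex C} (hS : S.ShortExact) {Y : C} (a : S.X₁ ⟶ Y) :
    ∃ (E : C) (f : Y ⟶ E) (g : E ⟶ S.X₃) (h : f ≫ g = 0)
      (_ : (ShortComplex.mk f g h).ShortExact) (b : S.X₂ ⟶ E),
        S.f ≫ b = a ≫ f ∧ b ≫ g = S.g := by
  have := hS.mono_f
  have := hS.epi_g
  have sq : IsPushout S.f a (pushout.inl S.f a) (pushout.inr S.f a) := IsPushout.of_hasPushout _ _
  let g : pushout S.f a ⟶ S.X₃ := pushout.desc S.g 0 (by simp)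
  have hg : pushout.inl S.f a ≫ g = S.g := pushout.inl_desc _ _ _
  have hg' : pushout.inr S.f a ≫ g = 0 := pushout.inr_desc _ _ _
  have : Epi g := epi_of_epi_fac hg
  refine ⟨pushout S.f a, pushout.inr _ _, g, hg', ⟨?_⟩, pushout.inl _ _, pushout.condition, hg⟩
  apply ShortComplex.exact_of_g_is_cokernel
  refine CokernelCofork.IsColimit.ofπ _ _ (fun {Z} k hk => hS.exact.desc
    (pushout.inl S.f a ≫ k) (by rw [pushout.condition_assoc, hk, comp_zero])) ?_ ?_
  · intro Z k hk
    apply pushout.hom_ext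
    · rw [← Category.assoc]
      erw [hg, hS.exact.g_desc]
    · rw [← Category.assoc]
      erw [hg', zero_comp, hk]
  · intro Z k hk m hm
    rw [← cancel_epi S.g, hS.exact.g_desc, ← hm, ← hg, Category.assoc]

variable [HasExt.{w} C]

/-- Effaceability of Ext in positive degrees: after a shift, the target is concentrated in the
negative degree -(n+1). -/
lemma exists_epi_comp_eq_zero {X Y : C} {n : ℕ} (e : Ext X Y (n + 1)) :
    ∃ (X' : C) (p : X' ⟶ X), Epi p ∧ (Ext.mk₀ p).comp e (zero_add _) = 0 := by
  let := HasDerivedCategory.standard C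
  let s := ((DerivedCategory.singleFunctors C).shiftIso (n + 1 : ℤ) (-(n + 1 : ℤ)) 0 (by lia)).hom.app Y
  have : CochainComplex.IsStrictlyLE
      ((single C (ComplexShape.up ℤ) (-(n + 1 : ℤ))).obj Y) (-(n + 1 : ℤ)) :=
    inferInstanceAs (CochainComplex.IsStrictlyLE
      ((CochainComplex.singleFunctor C (-(n + 1 : ℤ))).obj Y) (-(n + 1 : ℤ)))
  obtain ⟨X', p, hp, h⟩ := exists_epi_single_comp_eq_zero
    (L := (single C (ComplexShape.up ℤ) (-(n + 1 : ℤ))).obj Y)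
    (e.hom ≫ s) (-(n + 1)) (by lia)
  refine ⟨X', p, hp, ?_⟩
  apply Ext.homEquiv.injective
  have hs : IsIso s := inferInstance
  have h1 : ((Ext.mk₀ p).comp e (zero_add _)).hom ≫ s = 0 := by
    rw [← Ext.singleFunctor_map_comp_hom]
    exact (Category.assoc _ _ _).trans h
  have h2 : ((Ext.mk₀ p).comp e (zero_add _)).hom = 0 :=
    (cancel_mono s).1 (h1.trans zero_comp.symm)
  exact h2.trans (Ext.zero_hom _ _ _).symm

/-- Dimension shifting, the basis of the inductions on the degree of an Ext class: a class that dies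
on an epimorphism comes from its kernel by the connecting map. -/
lemma exists_extClass_comp {X Y : C} {n : ℕ} (e : Ext X Y (n + 1)) :
    ∃ (K X' : C) (i : K ⟶ X') (p : X' ⟶ X) (h : i ≫ p = 0)
      (hS : (ShortComplex.mk i p h).ShortExact) (y : Ext K Y n),
      hS.extClass.comp y (add_comm 1 n) = e := by
  obtain ⟨X', p, hp, h⟩ := exists_epi_comp_eq_zero e
  have hS : (ShortComplex.mk _ _ (kernel.condition p)).ShortExact :=
    { exact := ShortComplex.exact_of_f_is_kernel _ (kernelIsKernel p) }
  obtain ⟨y, hy⟩ := Ext.contravariant_sequence_exact₃ hS Y e h (add_comm 1 n)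
  exact ⟨_, _, _, _, _, hS, y, hy⟩

/-- Every class in `Ext^1` is the class of an extension. -/
theorem exists_extClass_eq {X Y : C} (e : Ext X Y 1) :
    ∃ (E : C) (f : Y ⟶ E) (g : E ⟶ X) (h : f ≫ g = 0)
      (hS : (ShortComplex.mk f g h).ShortExact), hS.extClass = e := by
  obtain ⟨K, X', i, p, h, hS, y, rfl⟩ := exists_extClass_comp e
  obtain ⟨a, rfl⟩ := (Ext.mk₀_bijective _ _).2 y
  obtain ⟨E, f, g, h', hT, b, hb, hb'⟩ := exists_shortExact_pushout hS a
  refine ⟨E, f, g, h', hT, ?_⟩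
  let φ : ShortComplex.mk i p h ⟶ ShortComplex.mk f g h' :=
    { τ₁ := a, τ₂ := b, τ₃ := 𝟙 _, comm₁₂ := hb.symm, comm₂₃ := by simpa using hb' }
  have := ShortComplex.ShortExact.extClass_naturality hS hT φ
  simpa [φ] using this.symm

/-- A pair of morphisms compatible with the classes of two extensions extends to a morphism of
extensions. -/
theorem exists_hom_of_extClass {S T : ShortComplex C} (hS : S.ShortExact) (hT : T.ShortExact)
    (a : S.X₁ ⟶ T.X₁) (c : S.X₃ ⟶ T.X₃)
    (h : hS.extClass.comp (Ext.mk₀ a) (add_zero 1) = (Ext.mk₀ c).comp hT.extClass (zero_add 1)) :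
    ∃ b : S.X₂ ⟶ T.X₂, S.f ≫ b = a ≫ T.f ∧ b ≫ T.g = S.g ≫ c := by
  have := hS.epi_g
  -- The obstruction to extending `a ≫ T.f` along `S.f` is the class of `S` pushed forward by `a ≫
  -- T.f`. By hypothesis this is the class of `T`, pulled back along `c`, followed by `T.f`, which
  -- is zero.
  obtain ⟨x, hx⟩ := Ext.contravariant_sequence_exact₁ hS T.X₂ (Ext.mk₀ (a ≫ T.f)) (add_zero 1) (by
    rw [← Ext.mk₀_comp_mk₀, ← Ext.comp_assoc_of_third_deg_zero, h,
      Ext.comp_assoc_of_third_deg_zero, hT.extClass_comp, Ext.comp_zero])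
  obtain ⟨b₀, rfl⟩ := (Ext.mk₀_bijective _ _).2 x
  rw [Ext.mk₀_comp_mk₀] at hx
  have hb₀ := (Ext.mk₀_bijective _ _).1 hx
  let c' : S.X₃ ⟶ T.X₃ := hS.exact.desc (b₀ ≫ T.g) (by
    rw [← Category.assoc, hb₀, Category.assoc, T.zero, comp_zero])
  have hc' : S.g ≫ c' = b₀ ≫ T.g := hS.exact.g_desc _ _
  let φ : S ⟶ T := { τ₁ := a, τ₂ := b₀, τ₃ := c', comm₁₂ := hb₀.symm, comm₂₃ := hc'.symm }
  have hn := ShortComplex.ShortExact.extClass_naturality hS hT φ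
  -- The extension `b₀` may induce the wrong map `c'` on the quotients. The difference `c - c'`
  -- pulls the class of `T` back to zero, hence lifts to `T.X₂`, and the lift corrects `b₀`.
  obtain ⟨x, hx⟩ := Ext.covariant_sequence_exact₃ _ hT (Ext.mk₀ (c - c')) (zero_add 1) (by
    have : c - c' = c + - c' := sub_eq_add_neg _ _
    rw [this, Ext.mk₀_add, Ext.mk₀_neg, Ext.add_comp, Ext.neg_comp, ← h, hn, add_neg_cancel])
  obtain ⟨w, rfl⟩ := (Ext.mk₀_bijective _ _).2 x
  rw [Ext.mk₀_comp_mk₀] at hx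
  have hw := (Ext.mk₀_bijective _ _).1 hx
  refine ⟨b₀ + S.g ≫ w, by simp [hb₀], ?_⟩
  rw [Preadditive.add_comp, Category.assoc, hw, Preadditive.comp_sub, hc']
  abel

lemma exists_iso_of_extClass_eq {X Y E E' : C} {f : Y ⟶ E} {g : E ⟶ X} {h : f ≫ g = 0}
    {f' : Y ⟶ E'} {g' : E' ⟶ X} {h' : f' ≫ g' = 0}
    (hS : (ShortComplex.mk f g h).ShortExact) (hT : (ShortComplex.mk f' g' h').ShortExact)
    (e : hS.extClass = hT.extClass) : ∃ b : E ≅ E', f ≫ b.hom = f' ∧ b.hom ≫ g' = g := by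
  obtain ⟨b, hb, hb'⟩ := exists_hom_of_extClass hS hT (𝟙 _) (𝟙 _) (by simp [e])
  let φ : ShortComplex.mk f g h ⟶ ShortComplex.mk f' g' h' :=
    { τ₁ := 𝟙 _, τ₂ := b, τ₃ := 𝟙 _, comm₁₂ := by simpa using hb.symm, comm₂₃ := by simpa using hb' }
  have : IsIso φ.τ₁ := inferInstanceAs (IsIso (𝟙 _))
  have : IsIso φ.τ₃ := inferInstanceAs (IsIso (𝟙 _))
  have : IsIso b := ShortComplex.isIso₂_of_shortExact_of_isIso₁₃ φ hS hT
  exact ⟨asIso b, by simpa using hb, by simpa using hb'⟩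

lemma extClass_eq_of_hom {X Y E E' : C} {f : Y ⟶ E} {g : E ⟶ X} {h : f ≫ g = 0}
    {f' : Y ⟶ E'} {g' : E' ⟶ X} {h' : f' ≫ g' = 0}
    (hS : (ShortComplex.mk f g h).ShortExact) (hT : (ShortComplex.mk f' g' h').ShortExact)
    (b : E ⟶ E') (h₁ : f ≫ b = f') (h₂ : b ≫ g' = g) : hS.extClass = hT.extClass := by
  have := ShortComplex.ShortExact.extClass_naturality hS hT
    { τ₁ := 𝟙 _, τ₂ := b, τ₃ := 𝟙 _, comm₁₂ := by simpa using h₁.symm, comm₂₃ := by simpa using h₂ }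
  simpa using this

/-- If `Ext^2(H, -) = 0`, an extension of `H` by the image of `f` lifts along `f`. -/
theorem exists_lift_extension {M Z H : C} (f : M ⟶ Z) (π : Z ⟶ H) (w : f ≫ π = 0)
    (hex : (ShortComplex.mk f π w).Exact) [Epi π] (h2 : ∀ Y : C, Subsingleton (Ext H Y 2)) :
    ∃ (V : C) (j : M ⟶ V) (q : V ⟶ Z) (h : j ≫ q ≫ π = 0),
      (ShortComplex.mk j (q ≫ π) h).ShortExact ∧ j ≫ q = f := by
  let p := Limits.factorThruImage f
  let i := Limits.image.ι f
  have hpi : p ≫ i = f := Limits.image.fac f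
  have hi : i ≫ π = 0 := by rw [← cancel_epi p, ← Category.assoc, hpi, w, comp_zero]
  have hS : (ShortComplex.mk i π hi).ShortExact :=
    { exact := by
        let φ : ShortComplex.mk f π w ⟶ ShortComplex.mk i π hi :=
          { τ₁ := p, τ₂ := 𝟙 _, τ₃ := 𝟙 _, comm₁₂ := by simp [hpi], comm₂₃ := by simp }
        have : Epi φ.τ₁ := inferInstanceAs (Epi p)
        have : IsIso φ.τ₂ := inferInstanceAs (IsIso (𝟙 _))
        have : Mono φ.τ₃ := inferInstanceAs (Mono (𝟙 _))
        exact (ShortComplex.exact_iff_of_epi_of_isIso_of_mono φ).1 hex }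
  have hT : (ShortComplex.mk _ _ (kernel.condition p)).ShortExact :=
    { exact := ShortComplex.exact_of_f_is_kernel _ (kernelIsKernel p) }
  -- The obstruction to lifting the class along the epimorphism `p` lies in Ext² from `H` to the
  -- kernel of `p`.
  obtain ⟨x, hx⟩ := Ext.covariant_sequence_exact₃ H hT hS.extClass (n₁ := 2) rfl
    (Subsingleton.elim _ _)
  obtain ⟨V, j, g, h, hV, rfl⟩ := exists_extClass_eq x
  obtain ⟨b, hb, hb'⟩ := exists_hom_of_extClass hV hS p (𝟙 _) (by simpa using hx)
  dsimp at b hb hb'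
  rw [Category.comp_id] at hb'
  subst hb'
  exact ⟨V, j, b, h, hV, by rw [hb, hpi]⟩

/-- Dual of `exists_lift_extension`. -/
theorem exists_colift_extension {M Z H : C} (f : Z ⟶ M) (i : H ⟶ Z) (w : i ≫ f = 0)
    (hex : (ShortComplex.mk i f w).Exact) [Mono i] (h2 : ∀ Y : C, Subsingleton (Ext Y H 2)) :
    ∃ (V : C) (j : Z ⟶ V) (q : V ⟶ M) (h : (i ≫ j) ≫ q = 0),
      (ShortComplex.mk (i ≫ j) q h).ShortExact ∧ j ≫ q = f := by
  let p := Limits.factorThruImage f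
  let k := Limits.image.ι f
  have hpi : p ≫ k = f := Limits.image.fac f
  have hi : i ≫ p = 0 := by rw [← cancel_mono k, Category.assoc, hpi, w, zero_comp]
  have hS : (ShortComplex.mk i p hi).ShortExact :=
    { exact := by
        let φ : ShortComplex.mk i p hi ⟶ ShortComplex.mk i f w :=
          { τ₁ := 𝟙 _, τ₂ := 𝟙 _, τ₃ := k, comm₁₂ := by simp, comm₂₃ := by simp [hpi] }
        have : Epi φ.τ₁ := inferInstanceAs (Epi (𝟙 _))
        have : IsIso φ.τ₂ := inferInstanceAs (IsIso (𝟙 _))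
        have : Mono φ.τ₃ := inferInstanceAs (Mono k)
        exact (ShortComplex.exact_iff_of_epi_of_isIso_of_mono φ).2 hex }
  have hT : (ShortComplex.mk _ _ (cokernel.condition k)).ShortExact :=
    { exact := ShortComplex.exact_of_g_is_cokernel _ (cokernelIsCokernel k) }
  obtain ⟨x, hx⟩ := Ext.contravariant_sequence_exact₁ hT H hS.extClass (n₁ := 2) rfl
    (Subsingleton.elim _ _)
  obtain ⟨V, g, q, h, hV, rfl⟩ := exists_extClass_eq x
  obtain ⟨b, hb, hb'⟩ := exists_hom_of_extClass hS hV (𝟙 _) k (by simpa using hx.symm)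
  dsimp at b hb hb'
  rw [Category.id_comp] at hb
  subst hb
  exact ⟨V, b, q, h, hV, by rw [hb', hpi]⟩

end Ext

/-! ### Ext under exact adjoint functors -/

section Naturality

variable {C : Type u} [Category.{v} C] [Abelian C] [HasExt.{w} C]
  {D : Type*} [Category* D] [Abelian D] [HasExt.{w} D]
  (F : C ⥤ D) (G : D ⥤ C) [F.Additive] [G.Additive]
  [PreservesFiniteLimits F] [PreservesFiniteColimits F]
  [PreservesFiniteLimits G] [PreservesFiniteColimits G]

lemma mapExactFunctor_extClass_comp_counit (ε : F ⋙ G ⟶ 𝟭 C) {S : ShortComplex C}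
    (hS : S.ShortExact) :
    ((hS.extClass.mapExactFunctor F).mapExactFunctor G).comp (Ext.mk₀ (ε.app S.X₁)) (add_zero 1) =
      (Ext.mk₀ (ε.app S.X₃)).comp hS.extClass (zero_add 1) := by
  have h : (hS.extClass.mapExactFunctor F).mapExactFunctor G =
      ((hS.map_of_exact F).map_of_exact G).extClass :=
    (congrArg _ (Ext.mapExactFunctor_extClass F hS)).trans (Ext.mapExactFunctor_extClass G _)
  rw [h]
  exact ShortComplex.ShortExact.extClass_naturality ((hS.map_of_exact F).map_of_exact G) hS
    { τ₁ := ε.app _, τ₂ := ε.app _, τ₃ := ε.app _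
      comm₁₂ := (ε.naturality _).symm, comm₂₃ := (ε.naturality _).symm }

lemma extClass_comp_unit (η : 𝟭 C ⟶ F ⋙ G) {S : ShortComplex C} (hS : S.ShortExact) :
    hS.extClass.comp (Ext.mk₀ (η.app S.X₁)) (add_zero 1) =
      (Ext.mk₀ (η.app S.X₃)).comp ((hS.extClass.mapExactFunctor F).mapExactFunctor G)
        (zero_add 1) := by
  have h : (hS.extClass.mapExactFunctor F).mapExactFunctor G =
      ((hS.map_of_exact F).map_of_exact G).extClass :=
    (congrArg _ (Ext.mapExactFunctor_extClass F hS)).trans (Ext.mapExactFunctor_extClass G _)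
  rw [h]
  exact ShortComplex.ShortExact.extClass_naturality hS ((hS.map_of_exact F).map_of_exact G)
    { τ₁ := η.app _, τ₂ := η.app _, τ₃ := η.app _
      comm₁₂ := (η.naturality _).symm, comm₂₃ := (η.naturality _).symm }

/-- Naturality of `ε` on Ext of all degrees: degree zero is ordinary naturality, extension classes
are natural for morphisms of exact sequences, and dimension shifting reduces a general class to
these two cases. -/
lemma mapExactFunctor_comp_counit (ε : F ⋙ G ⟶ 𝟭 C) {X Y : C} {n : ℕ} (e : Ext X Y n) :
    ((e.mapExactFunctor F).mapExactFunctor G).comp (Ext.mk₀ (ε.app Y)) (add_zero n) =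
      (Ext.mk₀ (ε.app X)).comp e (zero_add n) := by
  induction n generalizing X Y with
  | zero =>
    obtain ⟨f, rfl⟩ := (Ext.mk₀_bijective _ _).2 e
    rw [Ext.mapExactFunctor_mk₀, Ext.mapExactFunctor_mk₀, Ext.mk₀_comp_mk₀]
    erw [Ext.mk₀_comp_mk₀]
    congr 1
    exact ε.naturality f
  | succ n ih =>
    obtain ⟨K, X', i, p, h, hS, y, rfl⟩ := exists_extClass_comp e
    have hε := mapExactFunctor_extClass_comp_counit F G ε hS
    dsimp only at hε
    rw [Ext.mapExactFunctor_comp, Ext.mapExactFunctor_comp, Ext.comp_assoc_of_third_deg_zero, ih,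
      ← Ext.comp_assoc_of_second_deg_zero]
    refine (congrArg (fun z => Ext.comp z y (add_comm 1 n)) hε).trans ?_
    rw [Ext.comp_assoc (a₂₃ := n + 1)]
    all_goals omega

lemma unit_comp_mapExactFunctor (η : 𝟭 C ⟶ F ⋙ G) {X Y : C} {n : ℕ} (e : Ext X Y n) :
    e.comp (Ext.mk₀ (η.app Y)) (add_zero n) =
      (Ext.mk₀ (η.app X)).comp ((e.mapExactFunctor F).mapExactFunctor G) (zero_add n) := by
  induction n generalizing X Y with
  | zero =>
    obtain ⟨f, rfl⟩ := (Ext.mk₀_bijective _ _).2 e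
    rw [Ext.mapExactFunctor_mk₀, Ext.mapExactFunctor_mk₀]
    erw [Ext.mk₀_comp_mk₀, Ext.mk₀_comp_mk₀]
    congr 1
    exact η.naturality f
  | succ n ih =>
    obtain ⟨K, X', i, p, h, hS, y, rfl⟩ := exists_extClass_comp e
    have hη := extClass_comp_unit F G η hS
    dsimp only at hη
    rw [Ext.mapExactFunctor_comp, Ext.mapExactFunctor_comp, Ext.comp_assoc_of_third_deg_zero, ih,
      ← Ext.comp_assoc_of_second_deg_zero]
    refine (congrArg (fun z => Ext.comp z ((y.mapExactFunctor F).mapExactFunctor G)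
      (add_comm 1 n)) hη).trans ?_
    exact Ext.comp_assoc _ _ _ _ _ (by omega)

/-- The usual inverse of the adjunction, namely apply `F`, compose with the counit and precompose
with the image of the unit, recovers the class by naturality of the counit and a triangle identity.
-/
lemma mapExactFunctor_injective_of_rightAdjoint (adj : F ⊣ G) {X : C} {Y : D} {n : ℕ} :
    Function.Injective (fun e : Ext (F.obj X) Y n => e.mapExactFunctor G) := by
  refine Function.LeftInverse.injective
    (g := fun y => (Ext.mk₀ (F.map (adj.unit.app X))).comp
      ((y.mapExactFunctor F).comp (Ext.mk₀ (adj.counit.app Y)) (add_zero n)) (zero_add n)) ?_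
  intro e
  refine (congrArg (fun z => (Ext.mk₀ (F.map (adj.unit.app X))).comp z (zero_add n))
    (mapExactFunctor_comp_counit G F adj.counit e)).trans ?_
  refine (Ext.mk₀_comp_mk₀_assoc _ _ _).trans ?_
  refine (congrArg (fun f => (Ext.mk₀ f).comp e (zero_add n))
    (adj.left_triangle_components X)).trans ?_
  exact Ext.mk₀_id_comp e

lemma mapExactFunctor_injective_of_leftAdjoint (adj : F ⊣ G) {X : C} {Y : D} {n : ℕ} :
    Function.Injective (fun e : Ext X (G.obj Y) n => e.mapExactFunctor F) := by
  refine Function.LeftInverse.injective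
    (g := fun y => ((Ext.mk₀ (adj.unit.app X)).comp (y.mapExactFunctor G) (zero_add n)).comp
      (Ext.mk₀ (G.map (adj.counit.app Y))) (add_zero n)) ?_
  intro e
  refine (congrArg (fun z => Ext.comp z (Ext.mk₀ (G.map (adj.counit.app Y))) (add_zero n))
    (unit_comp_mapExactFunctor F G adj.unit e).symm).trans ?_
  refine (Ext.comp_assoc_of_third_deg_zero _ _ _ _).trans ?_
  refine (congrArg (fun z => Ext.comp e z (add_zero n)) (Ext.mk₀_comp_mk₀ _ _)).trans ?_
  refine (congrArg (fun f => e.comp (Ext.mk₀ f) (add_zero n))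
    (adj.right_triangle_components Y)).trans ?_
  exact Ext.comp_mk₀_id e

end Naturality

end ModifiedHall

namespace ModifiedHall

open Abelian

/-! ### Counting lemmas -/

lemma card_eq_mul_of_card_fiber {α β : Type*} [Finite α] [Finite β] (f : α → β) (n : ℕ)
    (h : ∀ b, Nat.card {a // f a = b} = n) : Nat.card α = Nat.card β * n := by
  have := Fintype.ofFinite β
  rw [← Nat.card_congr (Equiv.sigmaFiberEquiv f), Nat.card_sigma]
  simp [h]

lemma card_eq_of_rel {α β : Type*} (R : α → β → Prop) (h₁ : ∀ a, ∃ b, R a b)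
    (h₂ : ∀ b, ∃ a, R a b) (h₃ : ∀ a b b', R a b → R a b' → b = b')
    (h₄ : ∀ a a' b, R a b → R a' b → a = a') : Nat.card α = Nat.card β := by
  choose f hf using h₁
  refine Nat.card_eq_of_bijective f ⟨fun a a' h => h₄ _ _ _ (hf a) (h ▸ hf a'), fun b => ?_⟩
  obtain ⟨a, ha⟩ := h₂ b
  exact ⟨a, h₃ _ _ _ (hf a) ha⟩

section

variable {C : Type u} [Category.{v} C]

lemma IsoClass.mk_eq_iff {X Y : C} : IsoClass.mk X = IsoClass.mk Y ↔ Nonempty (X ≅ Y) :=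
  Quotient.eq (r := isIsomorphicSetoid C)

lemma IsoClass.mk_rep (x : IsoClass C) : IsoClass.mk x.rep = x :=
  Quotient.out_eq (s := isIsomorphicSetoid C) x

/-- An isomorphism from the chosen representative of an isomorphism class. -/
noncomputable def IsoClass.repIso (X : C) : (IsoClass.mk X).rep ≅ X :=
  (IsoClass.mk_eq_iff.1 (IsoClass.mk_rep (IsoClass.mk X))).some

lemma HallAlgebra.cls_eq_of_iso {X Y : C} (e : X ≅ Y) : HallAlgebra.cls X = HallAlgebra.cls Y := by
  unfold HallAlgebra.cls
  rw [IsoClass.mk_eq_iff.2 ⟨e⟩]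

/-- The Hall algebra as a space of finitely supported functions. -/
noncomputable def HallAlgebra.toFinsupp : HallAlgebra C ≃ₗ[ℚ] (IsoClass C →₀ ℚ) :=
  LinearEquiv.refl ℚ (IsoClass C →₀ ℚ)

lemma HallAlgebra.toFinsupp_cls (X : C) :
    HallAlgebra.toFinsupp (HallAlgebra.cls X) = Finsupp.single (IsoClass.mk X) 1 := rfl

lemma HallAlgebra.toFinsupp_cls_rep (x : IsoClass C) :
    HallAlgebra.toFinsupp (HallAlgebra.cls x.rep) = Finsupp.single x 1 := by
  rw [toFinsupp_cls, IsoClass.mk_rep]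

lemma HallAlgebra.eq_sum (h : HallAlgebra C) :
    h = ∑ x ∈ (HallAlgebra.toFinsupp h).support,
      HallAlgebra.toFinsupp h x • HallAlgebra.cls x.rep := by
  apply HallAlgebra.toFinsupp.injective
  rw [map_sum]
  conv_lhs => rw [← Finsupp.sum_single (HallAlgebra.toFinsupp h)]
  refine Finset.sum_congr rfl fun x _ => ?_
  rw [map_smul, toFinsupp_cls_rep, Finsupp.smul_single, smul_eq_mul, mul_one]

@[elab_as_elim]
lemma HallAlgebra.induction {p : HallAlgebra C → Prop} (x : HallAlgebra C) (h0 : p 0)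
    (hadd : ∀ x y, p x → p y → p (x + y)) (hcls : ∀ (c : ℚ) X, p (c • HallAlgebra.cls X)) : p x := by
  rw [HallAlgebra.eq_sum x]
  exact Finset.sum_induction _ p hadd h0 fun _ _ => hcls _ _

end

/-! ### The Hall algebra: Riedtmann's formula, associativity and unit -/

section Hall

variable {C : Type u} [Category.{v} C] [Abelian C]

/-- The short exact sequences `0 ⟶ M ⟶ X ⟶ L ⟶ 0`. -/
abbrev SES (M X L : C) : Type v :=
  {s : (M ⟶ X) × (X ⟶ L) // ∃ h : s.1 ≫ s.2 = 0, (ShortComplex.mk s.1 s.2 h).ShortExact}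

attribute [local instance] HasExt.standard

/-- The class of an extension. -/
noncomputable def SES.extClass {M X L : C} (s : SES M X L) : ExtGroup L M 1 :=
  s.2.choose_spec.extClass

lemma SES.extClass_mem {M X L : C} (s : SES M X L) : s.extClass ∈ extWithMiddle L M X :=
  ⟨s.1.1, s.1.2, s.2.choose, s.2.choose_spec, rfl⟩

lemma mem_extWithMiddle_iff {L M X : C} (e : ExtGroup L M 1) :
    e ∈ extWithMiddle L M X ↔ ∃ s : SES M X L, s.extClass = e := by
  constructor
  · rintro ⟨f, g, h, hS, rfl⟩
    exact ⟨⟨(f, g), h, hS⟩, rfl⟩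
  · rintro ⟨s, rfl⟩
    exact s.extClass_mem

/-- Transport of short exact sequences along isomorphisms. -/
def SES.congr {M X L M' X' L' : C} (a : M ≅ M') (b : X ≅ X') (c : L ≅ L') :
    SES M X L ≃ SES M' X' L' where
  toFun s := ⟨(a.inv ≫ s.1.1 ≫ b.hom, b.inv ≫ s.1.2 ≫ c.hom), by
    obtain ⟨⟨f, g⟩, h, hS⟩ := s
    refine ⟨by simp [reassoc_of% h], ShortComplex.shortExact_of_iso
      (ShortComplex.isoMk a b c ?_ ?_) hS⟩ <;> simp⟩
  invFun s := ⟨(a.hom ≫ s.1.1 ≫ b.inv, b.hom ≫ s.1.2 ≫ c.inv), by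
    obtain ⟨⟨f, g⟩, h, hS⟩ := s
    refine ⟨by simp [reassoc_of% h], ShortComplex.shortExact_of_iso
      (ShortComplex.isoMk a.symm b.symm c.symm ?_ ?_) hS⟩ <;> simp⟩
  left_inv s := by ext <;> simp
  right_inv s := by ext <;> simp

/-- The middle term of an extension of the given class. -/
noncomputable def midTerm {L M : C} (e : ExtGroup L M 1) : C := (exists_extClass_eq e).choose

lemma exists_midTerm {L M : C} (e : ExtGroup L M 1) :
    ∃ (f : M ⟶ midTerm e) (g : midTerm e ⟶ L) (h : f ≫ g = 0)
      (hS : (ShortComplex.mk f g h).ShortExact), hS.extClass = e :=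
  (exists_extClass_eq e).choose_spec

lemma mem_extWithMiddle_iff_midTerm {L M X : C} (e : ExtGroup L M 1) :
    e ∈ extWithMiddle L M X ↔ IsoClass.mk (midTerm e) = IsoClass.mk X := by
  obtain ⟨f, g, h, hS, he⟩ := exists_midTerm e
  rw [IsoClass.mk_eq_iff]
  constructor
  · rintro ⟨f', g', h', hS', he'⟩
    obtain ⟨b, -, -⟩ := exists_iso_of_extClass_eq hS hS' (he.trans he'.symm)
    exact ⟨b⟩
  · rintro ⟨b⟩
    have hS' := ((SES.congr (Iso.refl M) b (Iso.refl L)) ⟨(f, g), h, hS⟩).2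
    obtain ⟨h', hS'⟩ := hS'
    exact ⟨_, _, h', hS', by
      exact (extClass_eq_of_hom hS hS' b.hom (by simp [SES.congr]) (by simp [SES.congr])).symm.trans
        he⟩

lemma cls_mul_cls_eq_hallProduct (L M : C) :
    HallAlgebra.cls L * HallAlgebra.cls M = hallProduct (IsoClass.mk L) (IsoClass.mk M) := by
  change hallMul C (Finsupp.single _ _ : IsoClass C →₀ ℚ) (Finsupp.single _ _ : IsoClass C →₀ ℚ) = _
  unfold hallMul
  erw [Finsupp.linearCombination_single, one_smul, Finsupp.linearCombination_single, one_smul]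

lemma hall_smul_mul (c : ℚ) (x y : HallAlgebra C) : (c • x) * y = c • (x * y) := by
  change hallMul C (c • x) y = c • hallMul C x y
  rw [map_smul, LinearMap.smul_apply]

lemma hall_mul_smul (c : ℚ) (x y : HallAlgebra C) : x * (c • y) = c • (x * y) :=
  map_smul (hallMul C x) c y

lemma card_ext_ne_zero (X Y : C) [Finite (ExtGroup X Y 1)] :
    (Nat.card (ExtGroup X Y 1) : ℚ) ≠ 0 :=
  have : Nonempty (ExtGroup X Y 1) := ⟨0⟩
  Nat.cast_ne_zero.2 Nat.card_pos.ne'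

/-- The isomorphisms between two extensions of the same class form a torsor under `Hom(L, M)`. -/
lemma card_iso_of_extClass_eq {M X L : C} {f₀ f : M ⟶ X} {g₀ g : X ⟶ L} {h₀ : f₀ ≫ g₀ = 0}
    {h : f ≫ g = 0} (hS₀ : (ShortComplex.mk f₀ g₀ h₀).ShortExact)
    (hS : (ShortComplex.mk f g h).ShortExact) (he : hS₀.extClass = hS.extClass) :
    Nat.card {a : X ≅ X // f₀ ≫ a.hom = f ∧ a.hom ≫ g = g₀} = Nat.card (L ⟶ M) := by
  have := hS₀.mono_f
  have := hS₀.epi_g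
  have := hS.mono_f
  dsimp only at *
  obtain ⟨a₀, ha₀, ha₀'⟩ := exists_iso_of_extClass_eq hS₀ hS he
  symm
  have hiso (b : X ⟶ X) (hb : f₀ ≫ b = f) (hb' : b ≫ g = g₀) : IsIso b := by
    let φ : ShortComplex.mk f₀ g₀ h₀ ⟶ ShortComplex.mk f g h :=
      { τ₁ := 𝟙 _, τ₂ := b, τ₃ := 𝟙 _, comm₁₂ := by simpa using hb.symm,
        comm₂₃ := by simpa using hb' }
    have : IsIso φ.τ₁ := inferInstanceAs (IsIso (𝟙 _))
    have : IsIso φ.τ₃ := inferInstanceAs (IsIso (𝟙 _))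
    exact ShortComplex.isIso₂_of_shortExact_of_isIso₁₃ φ hS₀ hS
  -- Two isomorphisms of the same extensions differ by a map that vanishes on `M` and has zero image
  -- in `L`, that is, by `g₀ ≫ k ≫ f` for a unique `k`.
  have h1 (k : L ⟶ M) : f₀ ≫ (a₀.hom + g₀ ≫ k ≫ f) = f := by simp [ha₀, reassoc_of% h₀]
  have h2 (k : L ⟶ M) : (a₀.hom + g₀ ≫ k ≫ f) ≫ g = g₀ := by simp [ha₀', h]
  refine Nat.card_eq_of_bijective (fun k : L ⟶ M => ⟨@asIso _ _ _ _ (a₀.hom + g₀ ≫ k ≫ f)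
    (hiso _ (h1 k) (h2 k)), h1 k, h2 k⟩) ⟨?_, ?_⟩
  · intro k k' hk
    have hk' : a₀.hom + g₀ ≫ k ≫ f = a₀.hom + g₀ ≫ k' ≫ f :=
      congrArg (fun t => (Subtype.val t).hom) hk
    have := add_left_cancel hk'
    rwa [cancel_epi, cancel_mono] at this
  · rintro ⟨a, ha1, ha2⟩
    let l := hS₀.exact.desc (a.hom - a₀.hom) (by
      change f₀ ≫ (a.hom - a₀.hom) = 0
      rw [Preadditive.comp_sub, ha1, ha₀, sub_self])
    have hl : g₀ ≫ l = a.hom - a₀.hom := hS₀.exact.g_desc _ _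
    let k := hS.exact.lift l (by
      change l ≫ g = 0
      rw [← cancel_epi g₀, ← Category.assoc, hl, Preadditive.sub_comp, ha2, ha₀', sub_self,
        comp_zero])
    have hk : k ≫ f = l := hS.exact.lift_f _ _
    refine ⟨k, Subtype.ext (Iso.ext ?_)⟩
    change a₀.hom + g₀ ≫ k ≫ f = a.hom
    rw [hk, hl]
    abel

lemma SES.extClass_congr_mid {M X L : C} (s : SES M X L) (a : X ≅ X) :
    (SES.congr (Iso.refl M) a (Iso.refl L) s).extClass = s.extClass := by
  obtain ⟨⟨f, g⟩, h, hS⟩ := s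
  obtain ⟨h', hS'⟩ := (SES.congr (Iso.refl M) a (Iso.refl L) ⟨(f, g), h, hS⟩).2
  exact (extClass_eq_of_hom hS hS' a.hom (by simp [SES.congr]) (by simp [SES.congr])).symm

lemma SES.congr_mid_eq_iff {M X L : C} (s t : SES M X L) (a : X ≅ X) :
    SES.congr (Iso.refl M) a (Iso.refl L) s = t ↔
      s.1.1 ≫ a.hom = t.1.1 ∧ a.hom ≫ t.1.2 = s.1.2 := by
  rw [Subtype.ext_iff, Prod.ext_iff]
  simp only [SES.congr, Iso.refl_inv, Iso.refl_hom, Category.id_comp, Category.comp_id,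
    Equiv.coe_fn_mk, Iso.inv_comp_eq]
  exact and_congr_right fun _ => eq_comm

lemma shortExact_comp_iso {X Y Z Z' : C} {f : X ⟶ Y} {g : Y ⟶ Z} {h : f ≫ g = 0}
    (hS : (ShortComplex.mk f g h).ShortExact) (e : Z ≅ Z') :
    (ShortComplex.mk f (g ≫ e.hom) (by rw [← Category.assoc, h, zero_comp])).ShortExact :=
  ShortComplex.shortExact_of_iso (ShortComplex.isoMk (S₁ := ShortComplex.mk f g h)
    (S₂ := ShortComplex.mk f (g ≫ e.hom) (by rw [← Category.assoc, h, zero_comp]))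
    (Iso.refl X) (Iso.refl Y) e (by simp) (by simp)) hS

lemma shortExact_iso_comp {X X' Y Z : C} {f : X ⟶ Y} {g : Y ⟶ Z} {h : f ≫ g = 0}
    (hS : (ShortComplex.mk f g h).ShortExact) (e : X' ≅ X) :
    (ShortComplex.mk (e.hom ≫ f) g (by rw [Category.assoc, h, comp_zero])).ShortExact :=
  ShortComplex.shortExact_of_iso (ShortComplex.isoMk (S₁ := ShortComplex.mk f g h)
    (S₂ := ShortComplex.mk (e.hom ≫ f) g (by rw [Category.assoc, h, comp_zero]))
    e.symm (Iso.refl Y) (Iso.refl Z) (by simp) (by simp)) hS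

/-- Counting filtrations of `Z` with subquotients `N`, `M`, `L` in two ways. -/
lemma card_flag_eq (L M N Z : C) :
    Nat.card (Σ i : {i : N ⟶ Z // Mono i}, SES M (cokernel i.1) L) =
      Nat.card (Σ p : {p : Z ⟶ L // Epi p}, SES N (kernel p.1) M) := by
  -- A filtration N ⊂ Z' ⊂ Z is recorded on one side by N ⊂ Z and Z'/N ⊂ Z/N, on the other by Z' =
  -- ker(Z → L) and N ⊂ Z'. The relation says that both come from one filtration, with the same
  -- identifications of the three subquotients.
  refine card_eq_of_rel (fun u w => u.1.1 = w.2.1.1 ≫ kernel.ι w.1.1 ∧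
    w.1.1 = cokernel.π u.1.1 ≫ u.2.1.2 ∧
    w.2.1.2 ≫ u.2.1.1 = kernel.ι w.1.1 ≫ cokernel.π u.1.1) ?_ ?_ ?_ ?_
  · rintro ⟨⟨i, hi⟩, ⟨⟨a, b⟩, h, hS⟩⟩
    dsimp only at a b h hS
    have := hS.mono_f
    have := hS.epi_g
    dsimp only at *
    have hp : Epi (cokernel.π i ≫ b) := inferInstance
    let j : N ⟶ kernel (cokernel.π i ≫ b) := kernel.lift _ i (by simp)
    have hj : j ≫ kernel.ι _ = i := kernel.lift_ι _ _ _
    let q : kernel (cokernel.π i ≫ b) ⟶ M := hS.exact.lift (kernel.ι _ ≫ cokernel.π i) (by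
      change (kernel.ι (cokernel.π i ≫ b) ≫ cokernel.π i) ≫ b = 0
      rw [Category.assoc, kernel.condition])
    have hq : q ≫ a = kernel.ι _ ≫ cokernel.π i := hS.exact.lift_f _ _
    have hjq : j ≫ q = 0 := by
      rw [← cancel_mono a, Category.assoc, hq, reassoc_of% hj, cokernel.condition, zero_comp]
    have hqe : Epi q := by
      rw [epi_iff_surjective_up_to_refinements]
      intro T y
      obtain ⟨T', π, hπ, x, hx⟩ := surjective_up_to_refinements_of_epi (cokernel.π i) (y ≫ a)
      refine ⟨T', π, hπ, kernel.lift _ x ?_, ?_⟩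
      · rw [← Category.assoc, ← hx, Category.assoc, Category.assoc, h, comp_zero, comp_zero]
      · rw [← cancel_mono a, Category.assoc, Category.assoc, hq, kernel.lift_ι_assoc, hx]
    have hjm : Mono j := mono_of_mono_fac hj
    refine ⟨⟨⟨_, hp⟩, ⟨(j, q), hjq, ⟨?_⟩⟩⟩, hj.symm, rfl, hq⟩
    rw [ShortComplex.exact_iff_exact_up_to_refinements]
    intro T x hx
    dsimp only at x hx
    obtain ⟨T', π, hπ, n, hn⟩ := (ShortComplex.exact_cokernel i).exact_up_to_refinements
      (x ≫ kernel.ι _) (by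
        dsimp only
        rw [Category.assoc, ← hq, ← Category.assoc, hx, zero_comp])
    refine ⟨T', π, hπ, n, ?_⟩
    rw [← cancel_mono (kernel.ι _), Category.assoc, hn, Category.assoc]
    dsimp only
    rw [hj]
  · rintro ⟨⟨p, hp⟩, ⟨⟨j, q⟩, h, hS⟩⟩
    dsimp only at j q h hS
    have := hS.mono_f
    have := hS.epi_g
    dsimp only at *
    have hi : Mono (j ≫ kernel.ι p) := inferInstance
    let b : cokernel (j ≫ kernel.ι p) ⟶ L := cokernel.desc _ p (by simp)
    have hb : cokernel.π _ ≫ b = p := cokernel.π_desc _ _ _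
    let a : M ⟶ cokernel (j ≫ kernel.ι p) := hS.exact.desc (kernel.ι _ ≫ cokernel.π _) (by
      change j ≫ kernel.ι p ≫ cokernel.π (j ≫ kernel.ι p) = 0
      rw [← Category.assoc, cokernel.condition])
    have ha : q ≫ a = kernel.ι _ ≫ cokernel.π _ := hS.exact.g_desc _ _
    have hab : a ≫ b = 0 := by
      rw [← cancel_epi q, ← Category.assoc, ha, Category.assoc, hb, kernel.condition, comp_zero]
    have ham : Mono a := by
      refine Preadditive.mono_of_cancel_zero _ fun {T} g hg => ?_
      obtain ⟨T', π, hπ, x, hx⟩ := surjective_up_to_refinements_of_epi q g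
      obtain ⟨T'', π', hπ', n, hn⟩ :=
        (ShortComplex.exact_cokernel (j ≫ kernel.ι p)).exact_up_to_refinements
        (x ≫ kernel.ι _) (by
          dsimp only
          rw [Category.assoc, ← ha, ← Category.assoc, ← hx, Category.assoc, hg, comp_zero])
      dsimp only at hn
      rw [← Category.assoc, ← Category.assoc, cancel_mono] at hn
      rw [← cancel_epi π, ← cancel_epi π', hx, ← Category.assoc, hn, Category.assoc, h, comp_zero,
        comp_zero, comp_zero]
    have hbe : Epi b := epi_of_epi_fac hb
    refine ⟨⟨⟨_, hi⟩, ⟨(a, b), hab, ⟨?_⟩⟩⟩, rfl, hb.symm, ha⟩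
    rw [ShortComplex.exact_iff_exact_up_to_refinements]
    intro T x hx
    dsimp only at x hx
    obtain ⟨T', π, hπ, y, hy⟩ := surjective_up_to_refinements_of_epi (cokernel.π _) x
    refine ⟨T', π, hπ, kernel.lift p y ?_ ≫ q, ?_⟩
    · rw [← hb, ← Category.assoc, ← hy, Category.assoc, hx, comp_zero]
    · dsimp only
      rw [Category.assoc, ha, kernel.lift_ι_assoc, hy]
  · rintro ⟨⟨i, hi⟩, ⟨⟨a, b⟩, h, hS⟩⟩ ⟨⟨p, hp⟩, ⟨⟨j, q⟩, h', hS'⟩⟩ ⟨⟨p', hp'⟩, ⟨⟨j', q'⟩, h'', hS''⟩⟩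
      ⟨h1, h2, h3⟩ ⟨h4, h5, h6⟩
    have := hS.mono_f
    dsimp only at *
    subst h2 h5
    obtain rfl : j = j' := by rw [← cancel_mono (kernel.ι _), ← h1, ← h4]
    obtain rfl : q = q' := by rw [← cancel_mono a, h3, h6]
    rfl
  · rintro ⟨⟨i, hi⟩, ⟨⟨a, b⟩, h, hS⟩⟩ ⟨⟨i', hi'⟩, ⟨⟨a', b'⟩, h'', hS''⟩⟩ ⟨⟨p, hp⟩, ⟨⟨j, q⟩, h', hS'⟩⟩
      ⟨h1, h2, h3⟩ ⟨h4, h5, h6⟩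
    have := hS'.epi_g
    dsimp only at *
    subst h1 h4
    obtain rfl : b = b' := by rw [← cancel_epi (cokernel.π _), ← h2, ← h5]
    obtain rfl : a = a' := by rw [← cancel_epi q, h3, h6]
    rfl

lemma ext_subsingleton_of_isZero_left {X : C} (hX : IsZero X) (Y : C) (n : ℕ) :
    Subsingleton (ExtGroup X Y n) :=
  subsingleton_of_forall_eq 0 fun e => by
    rw [← Ext.mk₀_id_comp e, hX.eq_of_src (𝟙 X) 0, Ext.mk₀_zero, Ext.zero_comp]

lemma ext_subsingleton_of_isZero_right {X : C} (hX : IsZero X) (Y : C) (n : ℕ) :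
    Subsingleton (ExtGroup Y X n) :=
  subsingleton_of_forall_eq 0 fun e => by
    rw [← Ext.comp_mk₀_id e, hX.eq_of_src (𝟙 X) 0, Ext.mk₀_zero, Ext.comp_zero]

variable [hH : ∀ X Y : C, Finite (X ⟶ Y)]

instance (X Y : C) : Finite (X ≅ Y) :=
  Finite.of_injective (fun e : X ≅ Y => e.hom) fun _ _ h => Iso.ext h

lemma card_hom_ne_zero (X Y : C) : (Nat.card (X ⟶ Y) : ℚ) ≠ 0 :=
  Nat.cast_ne_zero.2 Nat.card_pos.ne'

set_option linter.unusedSectionVars false in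
lemma card_aut_ne_zero (X : C) : (Nat.card (X ≅ X) : ℚ) ≠ 0 :=
  have : Nonempty (X ≅ X) := ⟨Iso.refl X⟩
  Nat.cast_ne_zero.2 Nat.card_pos.ne'

/-- The automorphism group of the middle term acts on the extensions of a given class, with
stabilizers `Hom(L, M)`. -/
lemma card_fiber_extClass_mul {M X L : C} (s₀ : SES M X L) :
    Nat.card {s : SES M X L // s.extClass = s₀.extClass} * Nat.card (L ⟶ M) =
      Nat.card (X ≅ X) := by
  symm
  refine card_eq_mul_of_card_fiber (fun a : X ≅ X =>
    (⟨SES.congr (Iso.refl M) a (Iso.refl L) s₀, s₀.extClass_congr_mid a⟩ :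
      {s : SES M X L // s.extClass = s₀.extClass})) _ ?_
  rintro ⟨s, hs⟩
  rw [← card_iso_of_extClass_eq s₀.2.choose_spec s.2.choose_spec hs.symm]
  exact Nat.card_congr (Equiv.subtypeEquivRight fun a =>
    Subtype.ext_iff.trans (SES.congr_mid_eq_iff _ _ _))

/-- Extensions `0 ⟶ N ⟶ Z ⟶ X ⟶ 0` are monomorphisms `N ⟶ Z` with an isomorphism from the cokernel
to `X`. -/
lemma card_ses_eq_card_mono (N Z X : C) :
    Nat.card (SES N Z X) =
      Nat.card {i : {i : N ⟶ Z // Mono i} // IsoClass.mk (cokernel i.1) = IsoClass.mk X} *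
        Nat.card (X ≅ X) := by
  refine card_eq_mul_of_card_fiber (fun s => ⟨⟨s.1.1, s.2.choose_spec.mono_f⟩, by
    have hS := s.2.choose_spec
    exact IsoClass.mk_eq_iff.2 ⟨(cokernelIsCokernel s.1.1).coconePointUniqueUpToIso
      hS.gIsCokernel⟩⟩) _ ?_
  · rintro ⟨⟨i, hi⟩, h⟩
    obtain ⟨e⟩ := IsoClass.mk_eq_iff.1 h
    dsimp only at e
    have hc : (ShortComplex.mk _ _ (cokernel.condition i)).ShortExact :=
      { exact := ShortComplex.exact_of_g_is_cokernel _ (cokernelIsCokernel i) }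
    symm
    refine Nat.card_eq_of_bijective (fun a : X ≅ X =>
      ⟨⟨(i, cokernel.π i ≫ (e ≪≫ a).hom), by rw [cokernel.condition_assoc, zero_comp],
        shortExact_comp_iso hc (e ≪≫ a)⟩, rfl⟩) ⟨?_, ?_⟩
    · intro a b hab
      have h1 : cokernel.π i ≫ (e ≪≫ a).hom = cokernel.π i ≫ (e ≪≫ b).hom :=
        congrArg (fun t => t.1.1.2) hab
      simp only [Iso.trans_hom] at h1
      rw [cancel_epi, cancel_epi] at h1
      exact Iso.ext h1
    · rintro ⟨⟨⟨f, g⟩, w, hS⟩, hf⟩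
      have hf' : f = i := congrArg (fun t => t.1.1) hf
      subst hf'
      let c := (cokernelIsCokernel f).coconePointUniqueUpToIso hS.gIsCokernel
      have hc : cokernel.π f ≫ c.hom = g :=
        IsColimit.comp_coconePointUniqueUpToIso_hom (cokernelIsCokernel f) hS.gIsCokernel
          WalkingParallelPair.one
      refine ⟨e.symm ≪≫ c, Subtype.ext (Subtype.ext (Prod.ext rfl ?_))⟩
      change cokernel.π f ≫ e.hom ≫ e.inv ≫ c.hom = g
      rw [Iso.hom_inv_id_assoc, hc]

lemma card_ses_eq_card_epi (X Z L : C) :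
    Nat.card (SES X Z L) =
      Nat.card {p : {p : Z ⟶ L // Epi p} // IsoClass.mk (kernel p.1) = IsoClass.mk X} *
        Nat.card (X ≅ X) := by
  refine card_eq_mul_of_card_fiber (fun s => ⟨⟨s.1.2, s.2.choose_spec.epi_g⟩, by
    have hS := s.2.choose_spec
    exact IsoClass.mk_eq_iff.2 ⟨(kernelIsKernel s.1.2).conePointUniqueUpToIso hS.fIsKernel⟩⟩) _ ?_
  · rintro ⟨⟨p, hp⟩, h⟩
    obtain ⟨e⟩ := IsoClass.mk_eq_iff.1 h
    dsimp only at e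
    have hc : (ShortComplex.mk _ _ (kernel.condition p)).ShortExact :=
      { exact := ShortComplex.exact_of_f_is_kernel _ (kernelIsKernel p) }
    symm
    refine Nat.card_eq_of_bijective (fun a : X ≅ X =>
      ⟨⟨((a ≪≫ e.symm).hom ≫ kernel.ι p, p), by rw [Category.assoc, kernel.condition, comp_zero],
        shortExact_iso_comp hc (a ≪≫ e.symm)⟩, rfl⟩) ⟨?_, ?_⟩
    · intro a b hab
      have h1 : (a ≪≫ e.symm).hom ≫ kernel.ι p = (b ≪≫ e.symm).hom ≫ kernel.ι p :=
        congrArg (fun t => t.1.1.1) hab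
      simp only [Iso.trans_hom, Iso.symm_hom] at h1
      rw [cancel_mono, cancel_mono] at h1
      exact Iso.ext h1
    · rintro ⟨⟨⟨f, g⟩, w, hS⟩, hf⟩
      have hf' : g = p := congrArg (fun t => t.1.1) hf
      subst hf'
      let c := hS.fIsKernel.conePointUniqueUpToIso (kernelIsKernel g)
      have hc : c.hom ≫ kernel.ι g = f :=
        IsLimit.conePointUniqueUpToIso_hom_comp hS.fIsKernel (kernelIsKernel g)
          WalkingParallelPair.zero
      refine ⟨c ≪≫ e, Subtype.ext (Subtype.ext (Prod.ext ?_ rfl))⟩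
      change ((c.hom ≫ e.hom) ≫ e.inv) ≫ kernel.ι g = f
      rw [Category.assoc, Category.assoc, Iso.hom_inv_id_assoc, hc]

variable [hE : ∀ X Y : C, Finite (ExtGroup X Y 1)]

/-- Riedtmann's formula. -/
theorem hallCoeff_eq (L M X : C) :
    hallCoeff L M X = (Nat.card (SES M X L) : ℚ) / Nat.card (X ≅ X) := by
  -- The class map on `SES M X L` has all its nonempty fibres of size |Aut X| / |Hom(L, M)|, by
  -- orbit and stabilizer.
  have key : Nat.card (SES M X L) * Nat.card (L ⟶ M) =
      Nat.card (extWithMiddle L M X) * Nat.card (X ≅ X) := by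
    rcases isEmpty_or_nonempty (SES M X L) with hs | ⟨⟨s₀⟩⟩
    · have : IsEmpty (extWithMiddle L M X) := ⟨fun e =>
        hs.elim ((mem_extWithMiddle_iff _).1 e.2).choose⟩
      simp
    · let f (s : SES M X L) : extWithMiddle L M X := ⟨s.extClass, s.extClass_mem⟩
      have hf : ∀ b, Nat.card {s // f s = b} =
          Nat.card {s : SES M X L // s.extClass = s₀.extClass} := by
        rintro ⟨e, he⟩
        obtain ⟨s, rfl⟩ := (mem_extWithMiddle_iff _).1 he
        have h1 := card_fiber_extClass_mul s
        rw [← card_fiber_extClass_mul s₀] at h1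
        refine Eq.trans (Nat.card_congr (Equiv.subtypeEquivRight fun s' => ?_))
          (Nat.eq_of_mul_eq_mul_right Nat.card_pos h1)
        exact Subtype.ext_iff
      rw [card_eq_mul_of_card_fiber f _ hf, mul_assoc, card_fiber_extClass_mul]
  rw [hallCoeff, div_eq_div_iff (card_hom_ne_zero _ _) (card_aut_ne_zero _)]
  exact_mod_cast key.symm

lemma hallCoeff_congr {L M X L' M' X' : C} (a : L ≅ L') (b : M ≅ M') (c : X ≅ X') :
    hallCoeff L M X = hallCoeff L' M' X' := by
  rw [hallCoeff_eq, hallCoeff_eq, Nat.card_congr (SES.congr b c a),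
    Nat.card_congr ((Iso.isoCongrLeft c).trans (Iso.isoCongrRight c))]

open scoped Classical in
lemma cls_mul_cls_eq_sum_image (L M : C) [Fintype (ExtGroup L M 1)] :
    HallAlgebra.cls L * HallAlgebra.cls M =
      ∑ x ∈ Finset.univ.image (fun e : ExtGroup L M 1 => IsoClass.mk (midTerm e)),
        hallCoeff L M x.rep • HallAlgebra.cls x.rep := by
  rw [cls_mul_cls_eq_hallProduct, hallProduct]
  rw [finsum_eq_sum_of_support_subset]
  · exact Finset.sum_congr rfl fun x _ => by
      rw [hallCoeff_congr (IsoClass.repIso L) (IsoClass.repIso M) (Iso.refl _)]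
  · intro x hx
    rw [Function.mem_support, hallCoeff_congr (IsoClass.repIso L) (IsoClass.repIso M)
      (Iso.refl _)] at hx
    by_contra hx'
    apply hx
    have : IsEmpty (extWithMiddle L M x.rep) := ⟨fun e => hx' (by
      have := (mem_extWithMiddle_iff_midTerm e.1).1 e.2
      rw [IsoClass.mk_rep] at this
      simp [← this])⟩
    simp [hallCoeff]

/-- The Hall product as a sum over extension classes. -/
theorem cls_mul_cls (L M : C) [Fintype (ExtGroup L M 1)] :
    HallAlgebra.cls L * HallAlgebra.cls M =
      (Nat.card (L ⟶ M) : ℚ)⁻¹ • ∑ e : ExtGroup L M 1, HallAlgebra.cls (midTerm e) := by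
  classical
  have h : ∑ e : ExtGroup L M 1, HallAlgebra.cls (midTerm e) =
      ∑ x ∈ Finset.univ.image (fun e : ExtGroup L M 1 => IsoClass.mk (midTerm e)),
        (Nat.card (extWithMiddle L M x.rep) : ℚ) • HallAlgebra.cls x.rep := by
    have := Finset.sum_comp (s := Finset.univ) (fun x : IsoClass C => HallAlgebra.cls x.rep)
      (fun e : ExtGroup L M 1 => IsoClass.mk (midTerm e))
    rw [Finset.sum_congr rfl fun e _ => HallAlgebra.cls_eq_of_iso (IsoClass.repIso (midTerm e))]
      at this
    rw [this]
    refine Finset.sum_congr rfl fun x _ => ?_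
    rw [Nat.cast_smul_eq_nsmul]
    congr 1
    rw [← Fintype.card_subtype, ← Nat.card_eq_fintype_card]
    refine Nat.card_congr (Equiv.subtypeEquivRight fun e => ?_)
    rw [mem_extWithMiddle_iff_midTerm, IsoClass.mk_rep]
  rw [h, cls_mul_cls_eq_sum_image, Finset.smul_sum]
  refine Finset.sum_congr rfl fun x _ => ?_
  rw [smul_smul, hallCoeff, div_eq_inv_mul]

/-- The coefficient of `[z]` in `[L] * [M]`. -/
lemma toFinsupp_cls_mul_cls (L M : C) (z : IsoClass C) :
    HallAlgebra.toFinsupp (HallAlgebra.cls L * HallAlgebra.cls M) z = hallCoeff L M z.rep := by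
  classical
  have := Fintype.ofFinite (ExtGroup L M 1)
  rw [cls_mul_cls_eq_sum_image, map_sum, Finsupp.finsetSum_apply]
  simp only [map_smul, HallAlgebra.toFinsupp_cls_rep, Finsupp.smul_apply, Finsupp.single_apply,
    smul_eq_mul, mul_ite, mul_one, mul_zero, Finset.sum_ite_eq', ite_eq_left_iff]
  intro hz
  have : IsEmpty (extWithMiddle L M z.rep) := ⟨fun e => hz (by
    have := (mem_extWithMiddle_iff_midTerm e.1).1 e.2
    rw [IsoClass.mk_rep] at this
    simp [← this])⟩
  simp [hallCoeff]

/-- Turns a sum over intermediate isomorphism classes, weighted by the numbers of subobjects or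
quotients in each class, into a sum over the subobjects or quotients themselves. -/
lemma sum_mul_card_fiber {α β : Type*} [Finite α] [DecidableEq β] (g : α → β) (F : β → ℚ)
    (T : Finset β) (hT : ∀ b, F b ≠ 0 → b ∈ T) (G : α → ℕ) (hG : ∀ a, F (g a) = G a) :
    ∑ b ∈ T, F b * (Nat.card {a // g a = b} : ℚ) = ∑ᶠ a, (G a : ℚ) := by
  have := Fintype.ofFinite α
  rw [finsum_eq_sum_of_fintype]
  simp only [← hG]
  have h1 : ∀ b ∈ T, F b * (Nat.card {a // g a = b} : ℚ) =
      ∑ a : α, if g a = b then F b else 0 := by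
    intro b _
    rw [Nat.card_eq_fintype_card, Fintype.card_subtype, ← Finset.sum_filter, Finset.sum_const,
      nsmul_eq_mul, mul_comm]
  rw [Finset.sum_congr rfl h1, Finset.sum_comm]
  refine Finset.sum_congr rfl fun a _ => ?_
  rw [Finset.sum_ite_eq]
  split_ifs with h
  · rfl
  · by_contra h'
    exact h (hT _ (Ne.symm h'))

lemma finsum_card {α : Type*} [Finite α] (β : α → Type*) [∀ a, Finite (β a)] :
    ∑ᶠ a, (Nat.card (β a) : ℚ) = Nat.card (Σ a, β a) := by
  have := Fintype.ofFinite α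
  rw [finsum_eq_sum_of_fintype, Nat.card_sigma]
  simp

/-- Apply Riedtmann's formula to both products. The automorphisms of the intermediate term cancel,
and summing over its class amounts to summing over the monomorphisms from `N`, sorted by cokernel.
-/
lemma toFinsupp_cls_mul_cls_mul_cls (L M N : C) (z : IsoClass C) :
    HallAlgebra.toFinsupp (HallAlgebra.cls L * HallAlgebra.cls M * HallAlgebra.cls N) z =
      (Nat.card (Σ i : {i : N ⟶ z.rep // Mono i}, SES M (cokernel i.1) L) : ℚ) /
        Nat.card (z.rep ≅ z.rep) := by
  classical
  set P := HallAlgebra.toFinsupp (HallAlgebra.cls L * HallAlgebra.cls M) with hP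
  have h1 : HallAlgebra.toFinsupp (HallAlgebra.cls L * HallAlgebra.cls M * HallAlgebra.cls N) z =
      ∑ x ∈ P.support, P x * HallAlgebra.toFinsupp (HallAlgebra.cls x.rep * HallAlgebra.cls N) z := by
    conv_lhs => rw [HallAlgebra.eq_sum (HallAlgebra.cls L * HallAlgebra.cls M), Finset.sum_mul]
    rw [map_sum, Finsupp.finsetSum_apply]
    refine Finset.sum_congr rfl fun x _ => ?_
    rw [hall_smul_mul, map_smul, Finsupp.smul_apply, smul_eq_mul]
  rw [h1, ← finsum_card, ← sum_mul_card_fiber (fun i : {i : N ⟶ z.rep // Mono i} =>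
    IsoClass.mk (cokernel i.1)) (fun x => P x * Nat.card (x.rep ≅ x.rep)) P.support,
    Finset.sum_div]
  · refine Finset.sum_congr rfl fun x _ => ?_
    rw [toFinsupp_cls_mul_cls x.rep, hallCoeff_eq, card_ses_eq_card_mono N z.rep, IsoClass.mk_rep]
    push_cast
    ring
  · intro x hx
    rw [Finsupp.mem_support_iff]
    exact left_ne_zero_of_mul hx
  · intro i
    rw [hP, toFinsupp_cls_mul_cls, hallCoeff_eq, div_mul_cancel₀ _ (card_aut_ne_zero _)]
    rw [Nat.card_congr (SES.congr (Iso.refl M) (IsoClass.repIso (cokernel i.1)) (Iso.refl L))]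

lemma toFinsupp_cls_mul_cls_mul_cls' (L M N : C) (z : IsoClass C) :
    HallAlgebra.toFinsupp (HallAlgebra.cls L * (HallAlgebra.cls M * HallAlgebra.cls N)) z =
      (Nat.card (Σ p : {p : z.rep ⟶ L // Epi p}, SES N (kernel p.1) M) : ℚ) /
        Nat.card (z.rep ≅ z.rep) := by
  classical
  set P := HallAlgebra.toFinsupp (HallAlgebra.cls M * HallAlgebra.cls N) with hP
  have h1 : HallAlgebra.toFinsupp (HallAlgebra.cls L * (HallAlgebra.cls M * HallAlgebra.cls N)) z =
      ∑ x ∈ P.support, P x * HallAlgebra.toFinsupp (HallAlgebra.cls L * HallAlgebra.cls x.rep) z := by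
    conv_lhs => rw [HallAlgebra.eq_sum (HallAlgebra.cls M * HallAlgebra.cls N), Finset.mul_sum]
    rw [map_sum, Finsupp.finsetSum_apply]
    refine Finset.sum_congr rfl fun x _ => ?_
    rw [hall_mul_smul, map_smul, Finsupp.smul_apply, smul_eq_mul]
  rw [h1, ← finsum_card, ← sum_mul_card_fiber (fun p : {p : z.rep ⟶ L // Epi p} =>
    IsoClass.mk (kernel p.1)) (fun x => P x * Nat.card (x.rep ≅ x.rep)) P.support,
    Finset.sum_div]
  · refine Finset.sum_congr rfl fun x _ => ?_
    rw [toFinsupp_cls_mul_cls L, hallCoeff_eq, card_ses_eq_card_epi x.rep, IsoClass.mk_rep]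
    push_cast
    ring
  · intro x hx
    rw [Finsupp.mem_support_iff]
    exact left_ne_zero_of_mul hx
  · intro i
    rw [hP, toFinsupp_cls_mul_cls, hallCoeff_eq, div_mul_cancel₀ _ (card_aut_ne_zero _)]
    rw [Nat.card_congr (SES.congr (Iso.refl N) (IsoClass.repIso (kernel i.1)) (Iso.refl M))]

/-- On classes, each coefficient of either triple product is the number of filtrations with the
given subquotients, divided by the order of the automorphism group of the filtered object. -/
theorem hall_mul_assoc (x y z : HallAlgebra C) : x * y * z = x * (y * z) := by
  induction x using HallAlgebra.induction with
  | h0 => simp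
  | hadd x x' hx hx' => simp only [add_mul, hx, hx']
  | hcls c X =>
    induction y using HallAlgebra.induction with
    | h0 => simp
    | hadd y y' hy hy' => simp only [add_mul, mul_add, hy, hy']
    | hcls c' Y =>
      induction z using HallAlgebra.induction with
      | h0 => simp
      | hadd z z' hz hz' => simp only [mul_add, hz, hz']
      | hcls c'' Z =>
        simp only [hall_smul_mul, hall_mul_smul]
        congr 3
        apply HallAlgebra.toFinsupp.injective
        ext z
        rw [toFinsupp_cls_mul_cls_mul_cls, toFinsupp_cls_mul_cls_mul_cls', card_flag_eq]

/-- A product of classes with no nontrivial extensions and no morphisms. -/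
lemma cls_mul_cls_of_unique {L M X : C} [Subsingleton (ExtGroup L M 1)] [Subsingleton (L ⟶ M)]
    (f : M ⟶ X) (g : X ⟶ L) (h : f ≫ g = 0) (hS : (ShortComplex.mk f g h).ShortExact) :
    HallAlgebra.cls L * HallAlgebra.cls M = HallAlgebra.cls X := by
  have := Fintype.ofFinite (ExtGroup L M 1)
  have h1 : Nat.card (L ⟶ M) = 1 := Nat.card_eq_one_iff_unique.2 ⟨inferInstance, ⟨0⟩⟩
  rw [cls_mul_cls, h1, Fintype.sum_subsingleton _ hS.extClass]
  have := (mem_extWithMiddle_iff_midTerm hS.extClass).1 ⟨f, g, h, hS, rfl⟩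
  rw [Nat.cast_one, inv_one, one_smul]
  exact HallAlgebra.cls_eq_of_iso (IsoClass.mk_eq_iff.1 this).some

theorem hall_one_mul (x : HallAlgebra C) : HallAlgebra.cls (0 : C) * x = x := by
  induction x using HallAlgebra.induction with
  | h0 => simp
  | hadd x y hx hy => rw [mul_add, hx, hy]
  | hcls c X =>
    have := ext_subsingleton_of_isZero_left (isZero_zero C) X 1
    have hS : (ShortComplex.mk (𝟙 X) (0 : X ⟶ 0) (by simp)).ShortExact :=
      { exact := (ShortComplex.exact_iff_epi _ rfl).2 inferInstance }
    rw [hall_mul_smul, cls_mul_cls_of_unique _ _ _ hS]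

theorem hall_mul_one (x : HallAlgebra C) : x * HallAlgebra.cls (0 : C) = x := by
  induction x using HallAlgebra.induction with
  | h0 => simp
  | hadd x y hx hy => rw [add_mul, hx, hy]
  | hcls c X =>
    have := ext_subsingleton_of_isZero_right (isZero_zero C) X 1
    have hS : (ShortComplex.mk (0 : 0 ⟶ X) (𝟙 X) (by simp)).ShortExact :=
      { exact := (ShortComplex.exact_iff_mono _ rfl).2 inferInstance }
    rw [hall_smul_mul, cls_mul_cls_of_unique _ _ _ hS]

end Hall

end ModifiedHall

namespace ModifiedHall

open Abelian HomologicalComplex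

noncomputable section

/-! ### `ℤ/2`-graded complexes -/

lemma zmodTwo_forall {P : ZMod 2 → Prop} (h0 : P 0) (h1 : P 1) : ∀ i, P i := by
  intro i
  fin_cases i
  · exact h0
  · exact h1

lemma zmodTwo_rel' (i : ZMod 2) : (ComplexShape.up (ZMod 2)).Rel (i + 1) i := by
  change i + 1 + 1 = i
  rw [add_assoc, show (1 + 1 : ZMod 2) = 0 from rfl, add_zero]

variable {A : Type u} [Category.{v} A] [Abelian A]

/-- The `ℤ/2`-graded complex with components `X₀`, `X₁` and differentials `d₀`, `d₁`. -/
def mkComplex (X₀ X₁ : A) (d₀ : X₀ ⟶ X₁) (d₁ : X₁ ⟶ X₀) (h₀ : d₀ ≫ d₁ = 0) (h₁ : d₁ ≫ d₀ = 0) :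
    Z2Complex A where
  X := fun i : Fin 2 => match i with
    | 0 => X₀
    | 1 => X₁
  d := fun i j : Fin 2 => match i, j with
    | 0, 0 => 0
    | 0, 1 => d₀
    | 1, 0 => d₁
    | 1, 1 => 0
  shape := by
    refine zmodTwo_forall (zmodTwo_forall (fun _ => rfl) fun h => (h rfl).elim)
      (zmodTwo_forall (fun h => (h rfl).elim) fun _ => rfl)
  d_comp_d' := by
    rintro i j k rfl rfl
    revert i
    exact zmodTwo_forall h₀ h₁

/-- A morphism of `ℤ/2`-graded complexes. -/
def mkHom {M N : Z2Complex A} (f₀ : M.X 0 ⟶ N.X 0) (f₁ : M.X 1 ⟶ N.X 1)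
    (h₀ : f₀ ≫ N.d 0 1 = M.d 0 1 ≫ f₁) (h₁ : f₁ ≫ N.d 1 0 = M.d 1 0 ≫ f₀) : M ⟶ N where
  f := fun i : Fin 2 => match i with
    | 0 => f₀
    | 1 => f₁
  comm' := by
    rintro i j rfl
    revert i
    exact zmodTwo_forall h₀ h₁

lemma hom_ext_zmodTwo {M N : Z2Complex A} {f g : M ⟶ N} (h₀ : f.f 0 = g.f 0) (h₁ : f.f 1 = g.f 1) :
    f = g := by
  ext i
  revert i
  exact zmodTwo_forall h₀ h₁

lemma exactAt_zero_iff (M : Z2Complex A) :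
    M.ExactAt 0 ↔ (ShortComplex.mk (M.d 1 0) (M.d 0 1) (M.d_comp_d _ _ _)).Exact :=
  M.exactAt_iff' 1 0 1 (ComplexShape.prev_eq' _ rfl) (ComplexShape.next_eq' _ rfl)

lemma exactAt_one_iff (M : Z2Complex A) :
    M.ExactAt 1 ↔ (ShortComplex.mk (M.d 0 1) (M.d 1 0) (M.d_comp_d _ _ _)).Exact :=
  M.exactAt_iff' 0 1 0 (ComplexShape.prev_eq' _ rfl) (ComplexShape.next_eq' _ rfl)

lemma acyclic_iff (M : Z2Complex A) : M.Acyclic ↔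
    (ShortComplex.mk (M.d 1 0) (M.d 0 1) (M.d_comp_d _ _ _)).Exact ∧
      (ShortComplex.mk (M.d 0 1) (M.d 1 0) (M.d_comp_d _ _ _)).Exact := by
  rw [← exactAt_zero_iff, ← exactAt_one_iff]
  exact ⟨fun h => ⟨h 0, h 1⟩, fun h => zmodTwo_forall h.1 h.2⟩

lemma shortExact_of_degreewise (S : ShortComplex (Z2Complex A))
    (h₀ : (S.map (eval A (ComplexShape.up (ZMod 2)) 0)).ShortExact)
    (h₁ : (S.map (eval A (ComplexShape.up (ZMod 2)) 1)).ShortExact) : S.ShortExact :=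
  shortExact_of_degreewise_shortExact S (zmodTwo_forall h₀ h₁)

/-- The contractible complex on `X` in degrees `i` and `i + 1`. -/
abbrev contractibleObj (i : ZMod 2) (X : A) : Z2Complex A where
  X _ := X
  d k k' := if i = k ∧ k + 1 = k' then 𝟙 X else 0
  shape k k' h := if_neg fun h' => h h'.2
  d_comp_d' := by
    rintro k k' k'' rfl rfl
    by_cases h : i = k
    · subst h
      rw [if_neg (c := i = i + 1 ∧ _) (fun h => by simp at h), comp_zero]
    · rw [if_neg (by tauto), zero_comp]

/-- The functor sending `X` to the contractible complex on `X` in degrees `i` and `i + 1`. -/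
abbrev contractible (i : ZMod 2) : A ⥤ Z2Complex A where
  obj X := contractibleObj i X
  map f :=
    { f := fun _ => f
      comm' := fun k k' _ => by
        change f ≫ (if i = k ∧ k + 1 = k' then 𝟙 _ else 0) = (if i = k ∧ k + 1 = k' then 𝟙 _ else 0) ≫ f
        split_ifs <;> simp }

instance (i : ZMod 2) : (contractible (A := A) i).Additive where

lemma zmodTwo_eq_or (i k : ZMod 2) : k = i ∨ k = i + 1 := by
  revert i k
  decide

lemma zmodTwo_ne (i : ZMod 2) : i ≠ i + 1 := by
  revert i
  decide

lemma zmodTwo_add_add (i : ZMod 2) : i + 1 + 1 = i := zmodTwo_rel' i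

lemma contractibleObj_d (i : ZMod 2) (X : A) : (contractibleObj i X).d i (i + 1) = 𝟙 X :=
  if_pos ⟨rfl, rfl⟩

lemma contractibleObj_d_succ (i : ZMod 2) (X : A) (k : ZMod 2) :
    (contractibleObj i X).d (i + 1) k = 0 :=
  if_neg fun h => zmodTwo_ne i h.1

/-- The morphism from a contractible complex determined by its component in degree `i`. -/
def contractibleDesc (i : ZMod 2) {X : A} {M : Z2Complex A} (g : X ⟶ M.X i) :
    contractibleObj i X ⟶ M where
  f k := if h : i = k then g ≫ (M.XIsoOfEq h).hom else g ≫ M.d i k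
  comm' := by
    rintro k k' rfl
    obtain rfl | rfl := zmodTwo_eq_or i k
    · rw [dif_pos rfl, dif_neg (zmodTwo_ne k), contractibleObj_d]
      simp
    · rw [dif_neg (zmodTwo_ne i), contractibleObj_d_succ]
      simp

@[simp]
lemma contractibleDesc_f (i : ZMod 2) {X : A} {M : Z2Complex A} (g : X ⟶ M.X i) :
    (contractibleDesc i g).f i = g := by
  change dite _ _ _ = _
  rw [dif_pos rfl]
  simp

lemma contractible_hom_ext (i : ZMod 2) {X : A} {M : Z2Complex A} {f g : contractibleObj i X ⟶ M}
    (h : f.f i = g.f i) : f = g := by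
  ext k
  obtain rfl | rfl := zmodTwo_eq_or i k
  · exact h
  · have hf := f.comm i (i + 1)
    have hg := g.comm i (i + 1)
    rw [contractibleObj_d] at hf hg
    exact (Category.id_comp _).symm.trans (hf.symm.trans ((congrArg (· ≫ M.d i (i + 1)) h).trans
      (hg.trans (Category.id_comp _))))

/-- The morphism to a contractible complex determined by its component in degree `i + 1`. -/
def contractibleLift (i : ZMod 2) {X : A} {M : Z2Complex A} (g : M.X (i + 1) ⟶ X) :
    M ⟶ contractibleObj i X where
  f k := if h : i + 1 = k then (M.XIsoOfEq h).inv ≫ g else M.d k (i + 1) ≫ g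
  comm' := by
    rintro k k' rfl
    obtain rfl | rfl := zmodTwo_eq_or i k
    · rw [dif_pos rfl, dif_neg (zmodTwo_ne k).symm, contractibleObj_d]
      simp
    · rw [dif_pos rfl, dif_neg (zmodTwo_ne _), contractibleObj_d_succ]
      simp

@[simp]
lemma contractibleLift_f (i : ZMod 2) {X : A} {M : Z2Complex A} (g : M.X (i + 1) ⟶ X) :
    (contractibleLift i g).f (i + 1) = g := by
  change dite _ _ _ = _
  rw [dif_pos rfl]
  simp

lemma hom_contractible_ext (i : ZMod 2) {X : A} {M : Z2Complex A} {f g : M ⟶ contractibleObj i X}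
    (h : f.f (i + 1) = g.f (i + 1)) : f = g := by
  ext k
  obtain rfl | rfl := zmodTwo_eq_or i k
  · have hf := f.comm k (k + 1)
    have hg := g.comm k (k + 1)
    rw [contractibleObj_d] at hf hg
    exact (Category.comp_id _).symm.trans (hf.trans ((congrArg (M.d k (k + 1) ≫ ·) h).trans
      (hg.symm.trans (Category.comp_id _))))
  · exact h

/-- The contractible complexes on `X` corepresent evaluation. -/
def contractibleAdj (i : ZMod 2) : contractible (A := A) i ⊣ eval A (ComplexShape.up (ZMod 2)) i :=
  Adjunction.mkOfHomEquiv
  { homEquiv := fun _ _ =>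
      { toFun := fun f => f.f i
        invFun := fun g => contractibleDesc i g
        left_inv := fun _ => contractible_hom_ext i (contractibleDesc_f i _)
        right_inv := fun g => contractibleDesc_f i g }
    homEquiv_naturality_left_symm := fun _ _ => contractible_hom_ext i
      ((contractibleDesc_f i _).trans (congrArg (_ ≫ ·) (contractibleDesc_f i _).symm))
    homEquiv_naturality_right := fun _ _ => rfl }

/-- The contractible complexes on `X` represent evaluation. -/
def adjContractible (i : ZMod 2) :
    eval A (ComplexShape.up (ZMod 2)) (i + 1) ⊣ contractible (A := A) i :=
  Adjunction.mkOfHomEquiv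
  { homEquiv := fun _ _ =>
      { toFun := fun g => contractibleLift i g
        invFun := fun f => f.f (i + 1)
        left_inv := fun g => contractibleLift_f i g
        right_inv := fun _ => hom_contractible_ext i (contractibleLift_f i _) }
    homEquiv_naturality_left_symm := fun _ _ => rfl
    homEquiv_naturality_right := fun _ _ => hom_contractible_ext i
      ((contractibleLift_f i _).trans (congrArg (· ≫ _) (contractibleLift_f i _).symm)) }

instance (i : ZMod 2) : PreservesFiniteColimits (contractible (A := A) i) :=
  have := (contractibleAdj (A := A) i).leftAdjoint_preservesColimits
  inferInstance

instance (i : ZMod 2) : PreservesFiniteLimits (contractible (A := A) i) :=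
  have := (adjContractible (A := A) i).rightAdjoint_preservesLimits
  inferInstance

end

end ModifiedHall

namespace ModifiedHall

open Abelian HomologicalComplex

noncomputable section

/-! ### Short exact sequences, and finiteness and vanishing of Ext along them -/

section ShortExact

variable {C : Type u} [Category.{v} C] [Abelian C]

/-- `Y` is an extension of `Z` by `X`. -/
def IsExtension (X Y Z : C) : Prop :=
  ∃ (f : X ⟶ Y) (g : Y ⟶ Z) (w : f ≫ g = 0), (ShortComplex.mk f g w).ShortExact

lemma isExtension_biprod (X Y : C) : IsExtension X (X ⊞ Y) Y :=
  ⟨biprod.inl, biprod.snd, biprod.inl_snd, (ShortComplex.Splitting.ofHasBinaryBiproduct X Y).shortExact⟩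

lemma shortExact_of_kernel {X Y Z : C} {f : X ⟶ Y} {g : Y ⟶ Z} (w : f ≫ g = 0) (hf : Mono f)
    (hg : Epi g) (h : ∀ (T : C) (x : T ⟶ Y), x ≫ g = 0 → ∃ y, y ≫ f = x) :
    (ShortComplex.mk f g w).ShortExact where
  exact := by
    rw [ShortComplex.exact_iff_exact_up_to_refinements]
    intro T x hx
    obtain ⟨y, hy⟩ := h T x hx
    exact ⟨T, 𝟙 T, inferInstance, y, (Category.id_comp _).trans hy.symm⟩

lemma exists_lift_of_shortExact {X Y Z : C} {f : X ⟶ Y} {g : Y ⟶ Z} {w : f ≫ g = 0}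
    (hS : (ShortComplex.mk f g w).ShortExact) {T : C} (x : T ⟶ Y) (hx : x ≫ g = 0) :
    ∃ y, y ≫ f = x :=
  have := hS.mono_f
  ⟨hS.exact.lift x hx, hS.exact.lift_f x hx⟩

lemma shortExact_of_cokernel {X Y Z : C} {f : X ⟶ Y} {g : Y ⟶ Z} (w : f ≫ g = 0) (hf : Mono f)
    (hg : Epi g) (h : ∀ (T : C) (x : Y ⟶ T), f ≫ x = 0 → ∃ y, g ≫ y = x) :
    (ShortComplex.mk f g w).ShortExact where
  exact := by
    obtain ⟨y, hy⟩ := h _ (cokernel.π f) (cokernel.condition f)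
    refine ShortComplex.exact_of_g_is_cokernel _ (CokernelCofork.IsColimit.ofπ _ _
      (fun k hk => Classical.choose (h _ k hk)) (fun k hk => Classical.choose_spec (h _ k hk)) ?_)
    intro T k hk m hm
    rw [← cancel_epi g]
    exact hm.trans (Classical.choose_spec (h _ k hk)).symm

lemma exists_desc_of_shortExact {X Y Z : C} {f : X ⟶ Y} {g : Y ⟶ Z} {w : f ≫ g = 0}
    (hS : (ShortComplex.mk f g w).ShortExact) {T : C} (x : Y ⟶ T) (hx : f ≫ x = 0) :
    ∃ y, g ≫ y = x :=
  have := hS.epi_g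
  ⟨hS.exact.desc x hx, hS.exact.g_desc x hx⟩

/-- The kernel of (1, z) is the graph of -z. This sequence supplies the components of the map from a
resolution or a roof to the original complex. -/
lemma shortExact_neg_graph {X Y : C} (z : X ⟶ Y) :
    (ShortComplex.mk (biprod.lift (-z) (𝟙 X)) (biprod.desc (𝟙 Y) z) (by simp)).ShortExact :=
  ShortComplex.Splitting.shortExact
    { r := biprod.snd
      s := biprod.inl
      f_r := by simp
      s_g := by simp
      id := by
        apply biprod.hom_ext' <;> apply biprod.hom_ext <;> simp }

lemma shortExact_graph {X Y : C} (z : X ⟶ Y) :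
    (ShortComplex.mk (biprod.lift (𝟙 X) z) (biprod.desc (-z) (𝟙 Y)) (by simp)).ShortExact :=
  ShortComplex.Splitting.shortExact
    { r := biprod.fst
      s := biprod.inr
      f_r := by simp
      s_g := by simp
      id := by
        apply biprod.hom_ext' <;> apply biprod.hom_ext <;> simp }

end ShortExact

section Finite

/-- With a set-theoretic section `s` of `g` on its image, every `y` is `s (g y)` plus an element hit
by `f`, so the pairs in `X × Z` cover `Y`. -/
lemma finite_of_exact {X Y Z : Type*} [AddGroup Y] [AddGroup Z] [Finite X] [Finite Z]
    (f : X → Y) (g : Y →+ Z) (h : ∀ y, g y = 0 → ∃ x, f x = y) : Finite Y := by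
  classical
  let s : Z → Y := fun z => if hz : ∃ y, g y = z then hz.choose else 0
  have hs : ∀ y, g (s (g y)) = g y := fun y => by
    have hz : ∃ y', g y' = g y := ⟨y, rfl⟩
    simp only [s, dif_pos hz]
    exact hz.choose_spec
  refine Finite.of_surjective (fun p : X × Z => f p.1 + s p.2) fun y => ?_
  obtain ⟨x, hx⟩ := h (y - s (g y)) (by rw [map_sub, hs, sub_self])
  exact ⟨(x, g y), (congrArg (· + s (g y)) hx).trans (sub_add_cancel _ _)⟩

variable {C : Type u} [Category.{v} C] [Abelian C] [HasExt.{w} C] {X Y Z : C}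

lemma IsExtension.finite_ext_left (h : IsExtension X Y Z) (N : C) (n : ℕ)
    [Finite (Ext X N n)] [Finite (Ext Z N n)] : Finite (Ext Y N n) := by
  obtain ⟨f, g, w, hS⟩ := h
  refine finite_of_exact (fun z : Ext Z N n => (Ext.mk₀ g).comp z (zero_add n))
    ((Ext.mk₀ f).precomp N (zero_add n)) fun y hy => ?_
  exact Ext.contravariant_sequence_exact₂ hS N y hy

lemma IsExtension.finite_ext_right (h : IsExtension X Y Z) (N : C) (n : ℕ)
    [Finite (Ext X N n)] [Finite (Ext Y N (n + 1))] : Finite (Ext Z N (n + 1)) := by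
  obtain ⟨f, g, w, hS⟩ := h
  refine finite_of_exact (fun z : Ext X N n => hS.extClass.comp z (add_comm 1 n))
    ((Ext.mk₀ g).precomp N (zero_add (n + 1))) fun y hy => ?_
  exact Ext.contravariant_sequence_exact₃ hS N y hy (add_comm 1 n)

lemma IsExtension.subsingleton_ext_middle (h : IsExtension X Y Z) (N : C) (n : ℕ)
    [Subsingleton (Ext X N n)] [Subsingleton (Ext Z N n)] : Subsingleton (Ext Y N n) := by
  obtain ⟨f, g, w, hS⟩ := h
  refine subsingleton_of_forall_eq 0 fun y => ?_
  obtain ⟨z, rfl⟩ := Ext.contravariant_sequence_exact₂ hS N y (Subsingleton.elim _ _)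
  rw [Subsingleton.elim z 0, Ext.comp_zero]

lemma IsExtension.subsingleton_ext_middle' (h : IsExtension X Y Z) (N : C) (n : ℕ)
    [Subsingleton (Ext N X n)] [Subsingleton (Ext N Z n)] : Subsingleton (Ext N Y n) := by
  obtain ⟨f, g, w, hS⟩ := h
  refine subsingleton_of_forall_eq 0 fun y => ?_
  obtain ⟨z, rfl⟩ := Ext.covariant_sequence_exact₂ N hS y (Subsingleton.elim _ _)
  rw [Subsingleton.elim z 0, Ext.zero_comp]

lemma IsExtension.subsingleton_ext_left (h : IsExtension X Y Z) (N : C) (n : ℕ)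
    [Subsingleton (Ext Z N (n + 1))] [Subsingleton (Ext Y N n)] : Subsingleton (Ext X N n) := by
  obtain ⟨f, g, w, hS⟩ := h
  refine subsingleton_of_forall_eq 0 fun y => ?_
  obtain ⟨z, rfl⟩ := Ext.contravariant_sequence_exact₁ hS N y (add_comm 1 n) (Subsingleton.elim _ _)
  rw [Subsingleton.elim z 0, Ext.comp_zero]

lemma IsExtension.subsingleton_ext_right (h : IsExtension X Y Z) (N : C) (n : ℕ)
    [Subsingleton (Ext N X (n + 1))] [Subsingleton (Ext N Y n)] : Subsingleton (Ext N Z n) := by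
  obtain ⟨f, g, w, hS⟩ := h
  refine subsingleton_of_forall_eq 0 fun y => ?_
  obtain ⟨z, rfl⟩ := Ext.covariant_sequence_exact₃ N hS y rfl (Subsingleton.elim _ _)
  rw [Subsingleton.elim z 0, Ext.zero_comp]

end Finite

end

end ModifiedHall

/-! ### Resolutions of acyclic complexes by contractible ones -/

namespace ModifiedHall

open Abelian HomologicalComplex

noncomputable section

attribute [local instance] HasExt.standard

/-- An abelian category with finite `Hom` and `Ext^1`, and with `Ext^n = 0` for `n ≥ 2`. -/
class FinitaryHereditary (A : Type u) [Category.{v} A] [Abelian A] : Prop where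
  finite_hom (X Y : A) : Finite (X ⟶ Y)
  finite_ext (X Y : A) : Finite (ExtGroup X Y 1)
  subsingleton_ext (X Y : A) (n : ℕ) (hn : 2 ≤ n) : Subsingleton (ExtGroup X Y n)

attribute [instance] FinitaryHereditary.finite_hom FinitaryHereditary.finite_ext

variable {A : Type u} [Category.{v} A] [Abelian A]

section Contractible

/-- Evaluation in degree `i` is an exact right adjoint of the exact functor `contractible i`. This
is how finiteness and vanishing of Ext pass from the base category to complexes. -/
lemma ext_contractible_injective (i : ZMod 2) (X : A) (M : Z2Complex A) (n : ℕ) :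
    ∃ f : ExtGroup (contractibleObj i X) M n → ExtGroup X (M.X i) n, Function.Injective f :=
  ⟨fun e => e.mapExactFunctor (eval A _ i), mapExactFunctor_injective_of_rightAdjoint
    (contractible i) (eval A _ i) (contractibleAdj i) (X := X) (Y := M) (n := n)⟩

lemma ext_injective_contractible (i : ZMod 2) (M : Z2Complex A) (X : A) (n : ℕ) :
    ∃ f : ExtGroup M (contractibleObj i X) n → ExtGroup (M.X (i + 1)) X n, Function.Injective f :=
  ⟨_, mapExactFunctor_injective_of_leftAdjoint (eval A _ (i + 1)) (contractible i)
    (adjContractible i) (X := M) (Y := X) (n := n)⟩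

lemma acyclic_contractible (i : ZMod 2) (X : A) : (contractibleObj i X).Acyclic := by
  intro k
  rw [exactAt_iff_exact_up_to_refinements _ (k + 1) k (k + 1)
    (ComplexShape.prev_eq' _ (zmodTwo_rel' k)) (ComplexShape.next_eq' _ rfl)]
  intro T x hx
  obtain rfl | rfl := zmodTwo_eq_or i k
  · rw [contractibleObj_d] at hx
    refine ⟨T, 𝟙 T, inferInstance, 0, ?_⟩
    exact (Category.id_comp _).trans (((Category.comp_id x).symm.trans hx).trans zero_comp.symm)
  · refine ⟨T, 𝟙 T, inferInstance, x, ?_⟩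
    exact (Category.id_comp _).trans ((Category.comp_id x).symm.trans
      (congrArg (x ≫ ·) (if_pos ⟨(zmodTwo_add_add i).symm, zmodTwo_add_add (i + 1)⟩).symm))

end Contractible

lemma toCycles_epi_of_acyclic {K : Z2Complex A} (hK : K.Acyclic) (i : ZMod 2) :
    Epi (K.toCycles i (i + 1)) := by
  have h := (K.exactAt_iff_isZero_homology _).1 (hK (i + 1))
  exact Preadditive.epi_of_isZero_cokernel' _
    (K.homologyIsCokernel i (i + 1) (ComplexShape.prev_eq' _ rfl)) h

lemma exact_toCycles_of_acyclic {K : Z2Complex A} (hK : K.Acyclic) :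
    (ShortComplex.mk (K.d 0 1) (K.toCycles 1 0) (K.d_toCycles 0 1 0)).Exact := by
  let φ : ShortComplex.mk (K.d 0 1) (K.toCycles 1 0) (K.d_toCycles 0 1 0) ⟶
    ShortComplex.mk (K.d 0 1) (K.d 1 0) (K.d_comp_d _ _ _) :=
    { τ₁ := 𝟙 _, τ₂ := 𝟙 _, τ₃ := K.iCycles 0, comm₁₂ := by simp, comm₂₃ := by simp }
  have : Epi φ.τ₁ := inferInstanceAs (Epi (𝟙 _))
  have : IsIso φ.τ₂ := inferInstanceAs (IsIso (𝟙 _))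
  have : Mono φ.τ₃ := inferInstanceAs (Mono (K.iCycles 0))
  exact (ShortComplex.exact_iff_of_epi_of_isIso_of_mono φ).2 ((acyclic_iff K).1 hK).2

lemma isExtension_of_degreewise {M N P : Z2Complex A} {f₀ : M.X 0 ⟶ N.X 0} {f₁ : M.X 1 ⟶ N.X 1}
    {g₀ : N.X 0 ⟶ P.X 0} {g₁ : N.X 1 ⟶ P.X 1} {w₀ : f₀ ≫ g₀ = 0} {w₁ : f₁ ≫ g₁ = 0}
    (hS₀ : (ShortComplex.mk f₀ g₀ w₀).ShortExact) (hS₁ : (ShortComplex.mk f₁ g₁ w₁).ShortExact)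
    (hf₀ : f₀ ≫ N.d 0 1 = M.d 0 1 ≫ f₁) (hf₁ : f₁ ≫ N.d 1 0 = M.d 1 0 ≫ f₀)
    (hg₀ : g₀ ≫ P.d 0 1 = N.d 0 1 ≫ g₁) (hg₁ : g₁ ≫ P.d 1 0 = N.d 1 0 ≫ g₀) :
    IsExtension M N P :=
  ⟨mkHom f₀ f₁ hf₀ hf₁, mkHom g₀ g₁ hg₀ hg₁, hom_ext_zmodTwo w₀ w₁,
    shortExact_of_degreewise _ hS₀ hS₁⟩

lemma contractibleObj_zero_d (X : A) : (contractibleObj 0 X).d 0 1 = 𝟙 X := contractibleObj_d 0 X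

lemma contractibleObj_zero_d' (X : A) : (contractibleObj 0 X).d 1 0 = 0 :=
  contractibleObj_d_succ 0 X 0

lemma contractibleObj_one_d (X : A) : (contractibleObj 1 X).d 1 0 = 𝟙 X := contractibleObj_d 1 X

lemma contractibleObj_one_d' (X : A) : (contractibleObj 1 X).d 0 1 = 0 :=
  contractibleObj_d_succ 1 X 1

/-- An acyclic complex is a quotient of an extension of contractible complexes by a contractible
complex. -/
lemma exists_acyclic_resolution [FinitaryHereditary A] (K : Z2Complex A) (hK : K.Acyclic) :
    ∃ K' : Z2Complex A,
      IsExtension (contractibleObj 0 (K.X 0)) K' (contractibleObj 1 (K.cycles 0)) ∧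
      IsExtension (contractibleObj 0 (K.cycles 0)) K' K := by
  have hex := exact_toCycles_of_acyclic hK
  have : Epi (K.toCycles 1 0) := toCycles_epi_of_acyclic hK 1
  -- By acyclicity K¹ is an extension of Z⁰ by the image of K⁰. It lifts to an extension `V` of Z⁰
  -- by K⁰ itself, with `j ≫ q` equal to the differential.
  obtain ⟨V, j, q, h, hV, hj⟩ := exists_lift_extension (K.d 0 1) (K.toCycles 1 0) _ hex
    (fun Y => FinitaryHereditary.subsingleton_ext _ _ 2 le_rfl)
  let z := K.iCycles 0
  have hz : K.toCycles 1 0 ≫ z = K.d 1 0 := K.toCycles_i 1 0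
  have hz0 : z ≫ K.d 0 1 = 0 := K.iCycles_d 0 1
  have := hV.mono_f
  have hqe : Epi (q ≫ K.toCycles 1 0) := hV.epi_g
  -- The map `q` is onto Z⁰ after composition, and its image contains that of `j ≫ q`, which is the
  -- kernel of K¹ → Z⁰.
  have hq : Epi q := by
    rw [epi_iff_surjective_up_to_refinements]
    intro T y
    obtain ⟨T', π, hπ, x, hx⟩ :=
      surjective_up_to_refinements_of_epi (q ≫ K.toCycles 1 0) (y ≫ K.toCycles 1 0)
    obtain ⟨T'', π', hπ', x', hx'⟩ := hex.exact_up_to_refinements (π ≫ y - x ≫ q) (by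
      dsimp only
      rw [Preadditive.sub_comp, Category.assoc, Category.assoc, hx, sub_self])
    dsimp only at hx'
    refine ⟨T'', π' ≫ π, inferInstance, π' ≫ x + x' ≫ j, ?_⟩
    rw [Preadditive.add_comp, Category.assoc x', hj, ← hx', Preadditive.comp_sub]
    simp
  have hS₁ : (ShortComplex.mk (-z ≫ j) q (by simp [hj, hz0])).ShortExact := by
    have : Mono (z ≫ j) := mono_comp _ _
    refine shortExact_of_kernel _ (by infer_instance) hq fun T x hx => ?_
    obtain ⟨y, hy⟩ := exists_lift_of_shortExact hV x (by rw [reassoc_of% hx, zero_comp])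
    have hy0 : y ≫ K.d 0 1 = 0 := by rw [← hj, reassoc_of% hy, hx]
    refine ⟨-K.liftCycles y 1 (ComplexShape.next_eq' _ rfl) hy0, ?_⟩
    rw [← hy]
    simp [z]
  -- K⁰ ⊞ Z⁰ ⇄ V joins an identity of K⁰, embedded in `V` by `j`, to an identity of Z⁰ as a
  -- quotient. It maps onto `K` by (1, z) and `q`; the kernel is Z⁰ in both degrees, embedded by
  -- (-z, 1) and by `-z ≫ j`.
  refine ⟨mkComplex (K.X 0 ⊞ K.cycles 0) V (biprod.fst ≫ j) (q ≫ K.toCycles 1 0 ≫ biprod.inr)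
    (by simp [reassoc_of% h]) (by simp), ?_, ?_⟩
  · refine isExtension_of_degreewise
      (ShortComplex.Splitting.ofHasBinaryBiproduct (K.X 0) (K.cycles 0)).shortExact hV ?_ ?_ ?_ ?_
    · change biprod.inl ≫ biprod.fst ≫ j = (contractibleObj 0 (K.X 0)).d 0 1 ≫ j
      rw [contractibleObj_zero_d]
      simp
    · change j ≫ q ≫ K.toCycles 1 0 ≫ biprod.inr = (contractibleObj 0 (K.X 0)).d 1 0 ≫ biprod.inl
      rw [contractibleObj_zero_d']
      simp [reassoc_of% h]
    · change biprod.snd ≫ (contractibleObj 1 (K.cycles 0)).d 0 1 =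
        (biprod.fst ≫ j) ≫ q ≫ K.toCycles 1 0
      rw [contractibleObj_one_d']
      simp [h]
    · change (q ≫ K.toCycles 1 0) ≫ (contractibleObj 1 (K.cycles 0)).d 1 0 =
        (q ≫ K.toCycles 1 0 ≫ biprod.inr) ≫ biprod.snd
      rw [contractibleObj_one_d]
      simp
  · refine isExtension_of_degreewise (shortExact_neg_graph z) hS₁ ?_ ?_ ?_ ?_
    · change biprod.lift (-z) (𝟙 _) ≫ biprod.fst ≫ j =
        (contractibleObj 0 (K.cycles 0)).d 0 1 ≫ (-z ≫ j)
      rw [contractibleObj_zero_d]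
      simp
    · change (-z ≫ j) ≫ q ≫ K.toCycles 1 0 ≫ biprod.inr =
        (contractibleObj 0 (K.cycles 0)).d 1 0 ≫ biprod.lift (-z) (𝟙 _)
      rw [contractibleObj_zero_d']
      simp [reassoc_of% h]
    · change biprod.desc (𝟙 _) z ≫ K.d 0 1 = (biprod.fst ≫ j) ≫ q
      apply biprod.hom_ext' <;> simp [hj, hz0]
    · change q ≫ K.d 1 0 = (q ≫ K.toCycles 1 0 ≫ biprod.inr) ≫ biprod.desc (𝟙 _) z
      simp [hz]

lemma shortExact_inr_fst {C : Type*} [Category* C] [Abelian C] (X Y : C) :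
    (ShortComplex.mk (biprod.inr : Y ⟶ X ⊞ Y) biprod.fst biprod.inr_fst).ShortExact :=
  ShortComplex.Splitting.shortExact
    { r := biprod.snd
      s := biprod.inl
      id := (add_comm _ _).trans biprod.total }

/-- An acyclic complex embeds with contractible quotient in an extension of contractible
complexes. -/
lemma exists_acyclic_coresolution [FinitaryHereditary A] (K : Z2Complex A) (hK : K.Acyclic) :
    ∃ K' : Z2Complex A,
      IsExtension (contractibleObj 1 (K.cycles 0)) K' (contractibleObj 0 (K.X 1)) ∧
      IsExtension K K' (contractibleObj 0 (K.cycles 0)) := by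
  have hex := exact_toCycles_of_acyclic hK
  let t := K.toCycles 1 0
  have : Epi t := toCycles_epi_of_acyclic hK 1
  let z := K.iCycles 0
  have hz : t ≫ z = K.d 1 0 := K.toCycles_i 1 0
  have hz0 : z ≫ K.d 0 1 = 0 := K.iCycles_d 0 1
  have hdt : K.d 0 1 ≫ t = 0 := K.d_toCycles 0 1 0
  have hzK : (ShortComplex.mk z (K.d 0 1) hz0).Exact :=
    ShortComplex.exact_of_f_is_kernel _ (K.cyclesIsKernel 0 1 (ComplexShape.next_eq' _ rfl))
  -- Dually, the extension of the image of d : K⁰ → K¹ by Z⁰ given by K⁰ is enlarged to an extension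
  -- `V` of all of K¹ by Z⁰.
  obtain ⟨V, j, q, h, hV, hj⟩ := exists_colift_extension (K.d 0 1) z hz0 hzK
    (fun Y => FinitaryHereditary.subsingleton_ext _ _ 2 le_rfl)
  have h' : z ≫ j ≫ q = 0 := (Category.assoc _ _ _).symm.trans h
  have hm : Mono (z ≫ j) := hV.mono_f
  have hq : Epi q := hV.epi_g
  have hjm : Mono j := Preadditive.mono_of_cancel_zero _ fun {T} x hx => by
    obtain ⟨y, hy⟩ : ∃ y, y ≫ z = x := ⟨K.liftCycles x 1 (ComplexShape.next_eq' _ rfl)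
      (by rw [← hj, reassoc_of% hx, zero_comp]), by simp [z]⟩
    have hy0 : y = 0 := by
      rw [← cancel_mono (z ≫ j), reassoc_of% hy, hx, zero_comp]
    rw [← hy, hy0, zero_comp]
  have hS₀ : (ShortComplex.mk j (-q ≫ t)
      (by rw [Preadditive.comp_neg, reassoc_of% hj, hdt, neg_zero])).ShortExact := by
    have : Epi (q ≫ t) := epi_comp _ _
    refine shortExact_of_cokernel _ hjm (by infer_instance) fun T x hx => ?_
    obtain ⟨y, hy⟩ := exists_desc_of_shortExact hV x (by rw [Category.assoc, hx, comp_zero])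
    have hy0 : K.d 0 1 ≫ y = 0 := by rw [← hj, Category.assoc, hy, hx]
    refine ⟨-hex.desc y hy0, ?_⟩
    have := hex.g_desc y hy0
    dsimp only at this
    rw [Preadditive.neg_comp_neg, Category.assoc, this, hy]
  refine ⟨mkComplex V (K.X 1 ⊞ K.cycles 0) (q ≫ biprod.inl) (biprod.snd ≫ z ≫ j)
    (by simp) (by simp [reassoc_of% h']), ?_, ?_⟩
  · refine isExtension_of_degreewise hV (shortExact_inr_fst (K.X 1) (K.cycles 0)) ?_ ?_ ?_ ?_
    · change (z ≫ j) ≫ q ≫ biprod.inl = (contractibleObj 1 (K.cycles 0)).d 0 1 ≫ biprod.inr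
      rw [contractibleObj_one_d']
      simp [reassoc_of% h']
    · change biprod.inr ≫ biprod.snd ≫ z ≫ j = (contractibleObj 1 (K.cycles 0)).d 1 0 ≫ z ≫ j
      rw [contractibleObj_one_d]
      simp
    · change q ≫ (contractibleObj 0 (K.X 1)).d 0 1 = (q ≫ biprod.inl) ≫ biprod.fst
      rw [contractibleObj_zero_d]
      simp
    · change biprod.fst ≫ (contractibleObj 0 (K.X 1)).d 1 0 = (biprod.snd ≫ z ≫ j) ≫ q
      rw [contractibleObj_zero_d']
      simp [h']
  · refine isExtension_of_degreewise hS₀ (shortExact_graph t) ?_ ?_ ?_ ?_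
    · change j ≫ q ≫ biprod.inl = K.d 0 1 ≫ biprod.lift (𝟙 _) t
      apply biprod.hom_ext <;> simp [hj, hdt]
    · change biprod.lift (𝟙 _) t ≫ biprod.snd ≫ z ≫ j = K.d 1 0 ≫ j
      simp [← hz]
    · change (-q ≫ t) ≫ (contractibleObj 0 (K.cycles 0)).d 0 1 =
        (q ≫ biprod.inl) ≫ biprod.desc (-t) (𝟙 _)
      rw [contractibleObj_zero_d]
      simp
    · change biprod.desc (-t) (𝟙 _) ≫ (contractibleObj 0 (K.cycles 0)).d 1 0 =
        (biprod.snd ≫ z ≫ j) ≫ (-q ≫ t)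
      rw [contractibleObj_zero_d']
      simp [reassoc_of% h']

/-! ### Vanishing of Ext² against acyclic complexes, finiteness of Hom and Ext¹ -/

section ExtVanishing

/-- The contractible complex covering `M`. -/
abbrev contractibleCover (M : Z2Complex A) : Z2Complex A :=
  contractibleObj 0 (M.X 0) ⊞ contractibleObj 1 (M.X 1)

/-- The covering map of `contractibleCover`. -/
abbrev contractibleCoverMap (M : Z2Complex A) : contractibleCover M ⟶ M :=
  biprod.desc (contractibleDesc 0 (𝟙 (M.X 0))) (contractibleDesc 1 (𝟙 (M.X 1)))

lemma epi_contractibleCoverMap (M : Z2Complex A) : Epi (contractibleCoverMap M) where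
  left_cancellation g h e := by
    have h₀ : contractibleDesc 0 (𝟙 (M.X 0)) ≫ g = contractibleDesc 0 (𝟙 (M.X 0)) ≫ h := by
      simpa using congrArg (biprod.inl ≫ ·) e
    have h₁ : contractibleDesc 1 (𝟙 (M.X 1)) ≫ g = contractibleDesc 1 (𝟙 (M.X 1)) ≫ h := by
      simpa using congrArg (biprod.inr ≫ ·) e
    apply hom_ext_zmodTwo
    · simpa using congrArg (fun f => f.f 0) h₀
    · simpa using congrArg (fun f => f.f 1) h₁

/-- The contractible complex in which `M` embeds. -/
abbrev contractibleHull (M : Z2Complex A) : Z2Complex A :=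
  contractibleObj 1 (M.X (1 + 1)) ⊞ contractibleObj 0 (M.X (0 + 1))

/-- The embedding in `contractibleHull`. -/
abbrev contractibleHullMap (M : Z2Complex A) : M ⟶ contractibleHull M :=
  biprod.lift (contractibleLift 1 (𝟙 (M.X (1 + 1)))) (contractibleLift 0 (𝟙 (M.X (0 + 1))))

lemma mono_contractibleHullMap (M : Z2Complex A) : Mono (contractibleHullMap M) where
  right_cancellation g h e := by
    have h₀ : g ≫ contractibleLift 1 (𝟙 (M.X (1 + 1))) =
        h ≫ contractibleLift 1 (𝟙 (M.X (1 + 1))) := by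
      simpa using congrArg (· ≫ biprod.fst) e
    have h₁ : g ≫ contractibleLift 0 (𝟙 (M.X (0 + 1))) =
        h ≫ contractibleLift 0 (𝟙 (M.X (0 + 1))) := by
      simpa using congrArg (· ≫ biprod.snd) e
    have h₀' : g.f (1 + 1) = h.f (1 + 1) := by simpa using congrArg (fun f => f.f (1 + 1)) h₀
    have h₁' : g.f (0 + 1) = h.f (0 + 1) := by simpa using congrArg (fun f => f.f (0 + 1)) h₁
    exact hom_ext_zmodTwo h₀' h₁'

lemma isExtension_kernel {C : Type*} [Category* C] [Abelian C] {X Y : C} (p : X ⟶ Y) [Epi p] :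
    IsExtension (kernel p) X Y :=
  ⟨_, _, kernel.condition p, { exact := ShortComplex.exact_of_f_is_kernel _ (kernelIsKernel p) }⟩

lemma isExtension_cokernel {C : Type*} [Category* C] [Abelian C] {X Y : C} (p : X ⟶ Y) [Mono p] :
    IsExtension X Y (cokernel p) :=
  ⟨_, _, cokernel.condition p,
    { exact := ShortComplex.exact_of_g_is_cokernel _ (cokernelIsCokernel p) }⟩

variable [FinitaryHereditary A]

instance (X Y : A) (n : ℕ) : Subsingleton (ExtGroup X Y (n + 2)) :=
  FinitaryHereditary.subsingleton_ext _ _ _ (by omega)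

instance (i : ZMod 2) (X : A) (M : Z2Complex A) (n : ℕ) :
    Subsingleton (ExtGroup (contractibleObj i X) M (n + 2)) :=
  let ⟨_, hf⟩ := ext_contractible_injective i X M (n + 2)
  hf.subsingleton

instance (i : ZMod 2) (X : A) (M : Z2Complex A) (n : ℕ) :
    Subsingleton (ExtGroup M (contractibleObj i X) (n + 2)) :=
  let ⟨_, hf⟩ := ext_injective_contractible i M X (n + 2)
  hf.subsingleton

instance (i : ZMod 2) (X : A) (M : Z2Complex A) : Finite (ExtGroup (contractibleObj i X) M 1) :=
  let ⟨_, hf⟩ := ext_contractible_injective i X M 1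
  Finite.of_injective _ hf

/-- `K` is the quotient of `K'` by a contractible complex. Ext²(M, K') vanishes because `K'` is
built from contractible complexes, and Ext³ into the contractible kernel vanishes too. -/
lemma subsingleton_ext_to_acyclic (M : Z2Complex A) {K : Z2Complex A} (hK : K.Acyclic) :
    Subsingleton (ExtGroup M K 2) := by
  obtain ⟨K', h₁, h₂⟩ := exists_acyclic_resolution K hK
  have : Subsingleton (ExtGroup M K' 2) := h₁.subsingleton_ext_middle' M 2
  exact h₂.subsingleton_ext_right M 2

lemma subsingleton_ext_from_acyclic (M : Z2Complex A) {K : Z2Complex A} (hK : K.Acyclic) :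
    Subsingleton (ExtGroup K M 2) := by
  obtain ⟨K', h₁, h₂⟩ := exists_acyclic_coresolution K hK
  have : Subsingleton (ExtGroup K' M 2) := h₁.subsingleton_ext_middle M 2
  exact h₂.subsingleton_ext_left M 2

instance (M N : Z2Complex A) : Finite (M ⟶ N) :=
  Finite.of_injective (fun f : M ⟶ N => (f.f 0, f.f 1)) fun _ _ h =>
    hom_ext_zmodTwo (congrArg Prod.fst h) (congrArg Prod.snd h)

/-- Ext¹(M, N) lies in an exact sequence between maps to `N` from the kernel of the contractible
cover and Ext¹ from the cover, which embeds componentwise in Ext¹ of the base category. -/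
instance (M N : Z2Complex A) : Finite (ExtGroup M N 1) := by
  have := epi_contractibleCoverMap M
  have h := isExtension_kernel (contractibleCoverMap M)
  have h' := isExtension_biprod (contractibleObj 0 (M.X 0)) (contractibleObj 1 (M.X 1))
  have : Finite (ExtGroup (contractibleCover M) N (0 + 1)) := h'.finite_ext_left N 1
  have : Finite (ExtGroup (kernel (contractibleCoverMap M)) N 0) :=
    Finite.of_equiv _ Ext.homEquiv₀.symm
  exact h.finite_ext_right N 0

end ExtVanishing

end

end ModifiedHall

namespace ModifiedHall

open Abelian HomologicalComplex

noncomputable section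

attribute [local instance] HasExt.standard

variable {A : Type u} [Category.{v} A] [Abelian A]

/-! ### Roofs between a complex and its homology -/

section Roof

lemma exact_epi_comp_mono {C : Type*} [Category* C] [Abelian C] {X' X Y Z Z' : C} {e : X' ⟶ X}
    {f : X ⟶ Y} {g : Y ⟶ Z} {m : Z ⟶ Z'} {w : f ≫ g = 0} (h : (ShortComplex.mk f g w).Exact)
    [Epi e] [Mono m] (w' : (e ≫ f) ≫ g ≫ m = 0) :
    (ShortComplex.mk (e ≫ f) (g ≫ m) w').Exact := by
  rw [ShortComplex.exact_iff_exact_up_to_refinements]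
  intro T x hx
  have hx' : x ≫ g = 0 := by
    rw [← cancel_mono m, Category.assoc, hx, zero_comp]
  obtain ⟨T', π, hπ, y, hy⟩ := h.exact_up_to_refinements x hx'
  obtain ⟨T'', π', hπ', y', hy'⟩ := surjective_up_to_refinements_of_epi e y
  refine ⟨T'', π' ≫ π, inferInstance, y', ?_⟩
  dsimp only at hy ⊢
  rw [Category.assoc, hy, reassoc_of% hy']

/-- `W` lifts the extension of H^k by the boundaries given by Z^k to an extension of H^k by M^i. As
the boundary map M^i → Z^k has kernel Z^i, `W` is also an extension of Z^k by Z^i. The first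
description yields the homology leg of the roof, the second the acyclicity of the kernel of the
other leg. -/
lemma exists_lift_cycles [FinitaryHereditary A] (M : Z2Complex A) {i k : ZMod 2}
    (hik : (ComplexShape.up (ZMod 2)).Rel i k) :
    ∃ (W : A) (j : M.X i ⟶ W) (q : W ⟶ M.cycles k) (h : j ≫ q ≫ M.homologyπ k = 0)
      (h' : (M.iCycles i ≫ j) ≫ q = 0),
      (ShortComplex.mk j (q ≫ M.homologyπ k) h).ShortExact ∧
      (ShortComplex.mk (M.iCycles i ≫ j) q h').ShortExact ∧ j ≫ q = M.toCycles i k := by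
  have hex : (ShortComplex.mk (M.toCycles i k) (M.homologyπ k)
      (M.toCycles_comp_homologyπ i k)).Exact :=
    ShortComplex.exact_of_g_is_cokernel _
      (M.homologyIsCokernel i k (ComplexShape.prev_eq' _ hik))
  obtain ⟨W, j, q, h, hV, hj⟩ := exists_lift_extension _ _ _ hex
    (fun Y => FinitaryHereditary.subsingleton_ext _ _ 2 le_rfl)
  have := hV.mono_f
  have hqe : Epi (q ≫ M.homologyπ k) := hV.epi_g
  have hq : Epi q := by
    rw [epi_iff_surjective_up_to_refinements]
    intro T y
    obtain ⟨T', π, hπ, x, hx⟩ :=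
      surjective_up_to_refinements_of_epi (q ≫ M.homologyπ k) (y ≫ M.homologyπ k)
    obtain ⟨T'', π', hπ', x', hx'⟩ := hex.exact_up_to_refinements (π ≫ y - x ≫ q) (by
      dsimp only
      rw [Preadditive.sub_comp, Category.assoc, Category.assoc, hx, sub_self])
    dsimp only at hx'
    refine ⟨T'', π' ≫ π, inferInstance, π' ≫ x + x' ≫ j, ?_⟩
    rw [Preadditive.add_comp, Category.assoc x', hj, ← hx', Preadditive.comp_sub]
    simp
  have hz : M.iCycles i ≫ M.toCycles i k = 0 := by
    rw [← cancel_mono (M.iCycles k)]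
    simp
  refine ⟨W, j, q, h, by rw [Category.assoc, hj, hz], hV, ?_, hj⟩
  refine shortExact_of_kernel _ (mono_comp _ _) hq fun T x hx => ?_
  obtain ⟨y, hy⟩ := exists_lift_of_shortExact hV x (by rw [reassoc_of% hx, zero_comp])
  have hy0 : y ≫ M.d i k = 0 := by
    rw [← M.toCycles_i i k, ← hj, Category.assoc, reassoc_of% hy, reassoc_of% hx, zero_comp]
  refine ⟨M.liftCycles y k (ComplexShape.next_eq' _ hik) hy0, ?_⟩
  rw [← hy]
  simp

lemma exact_neg {C : Type*} [Category* C] [Abelian C] {X Y Z : C} {f : X ⟶ Y} {g : Y ⟶ Z}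
    {w : f ≫ g = 0} (h : (ShortComplex.mk f g w).Exact) (w' : f ≫ (-g) = 0) :
    (ShortComplex.mk f (-g) w').Exact := by
  rw [ShortComplex.exact_iff_exact_up_to_refinements]
  intro T x hx
  exact h.exact_up_to_refinements x (by simpa using hx)

lemma shortExact_biprod_map {C : Type*} [Category* C] [Abelian C] {X Y Z : C} (T : C) {f : X ⟶ Y}
    {g : Y ⟶ Z} {w : f ≫ g = 0} (h : (ShortComplex.mk f g w).ShortExact) :
    (ShortComplex.mk (biprod.map (𝟙 T) f) (biprod.snd ≫ g) (by simp [w])).ShortExact := by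
  have : Mono f := h.mono_f
  have : Epi g := h.epi_g
  refine shortExact_of_kernel _ inferInstance (epi_comp _ _) fun S x hx => ?_
  obtain ⟨y, hy⟩ := exists_lift_of_shortExact h (x ≫ biprod.snd) (by rwa [Category.assoc])
  refine ⟨biprod.lift (x ≫ biprod.fst) y, ?_⟩
  apply biprod.hom_ext <;> simp [hy]

/-- The complex with the homology of `M` and zero differentials. -/
abbrev homologyComplex (M : Z2Complex A) : Z2Complex A :=
  mkComplex (M.homology 0) (M.homology 1) 0 0 comp_zero comp_zero

/-- Every complex is connected to its homology by epimorphisms with acyclic kernels. -/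
theorem exists_roof [FinitaryHereditary A] (M : Z2Complex A) :
    ∃ X R R' : Z2Complex A, R.Acyclic ∧ R'.Acyclic ∧ IsExtension R X M ∧
      IsExtension R' X (homologyComplex M) := by
  obtain ⟨W₀, j₀, q₀, h₀, h₀', hV₀, hZ₀, hj₀⟩ := exists_lift_cycles M (show (ComplexShape.up (ZMod 2)).Rel 0 1 from rfl)
  obtain ⟨W₁, j₁, q₁, h₁, h₁', hV₁, hZ₁, hj₁⟩ := exists_lift_cycles M (show (ComplexShape.up (ZMod 2)).Rel 1 0 from rfl)
  have h₀'' : M.iCycles 0 ≫ j₀ ≫ q₀ = 0 := (Category.assoc _ _ _).symm.trans h₀'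
  have h₁'' : M.iCycles 1 ≫ j₁ ≫ q₁ = 0 := (Category.assoc _ _ _).symm.trans h₁'
  have hd₀ : j₀ ≫ q₀ ≫ M.iCycles 1 = M.d 0 1 := by rw [reassoc_of% hj₀, M.toCycles_i]
  have hd₁ : j₁ ≫ q₁ ≫ M.iCycles 0 = M.d 1 0 := by rw [reassoc_of% hj₁, M.toCycles_i]
  have := hZ₀.epi_g
  have := hZ₁.epi_g
  have := hZ₀.mono_f
  have := hZ₁.mono_f
  dsimp only at *
  have hR₀ : (ShortComplex.mk ((-q₀) ≫ M.iCycles 1 ≫ j₁) ((-q₁) ≫ M.iCycles 0 ≫ j₀)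
      (by simp [reassoc_of% h₁''])).Exact :=
    exact_epi_comp_mono (exact_neg hZ₁.exact (by simp [h₁''])) _
  have hR₁ : (ShortComplex.mk ((-q₁) ≫ M.iCycles 0 ≫ j₀) ((-q₀) ≫ M.iCycles 1 ≫ j₁)
      (by simp [reassoc_of% h₀''])).Exact :=
    exact_epi_comp_mono (exact_neg hZ₀.exact (by simp [h₀''])) _
  have hR' (X Y : A) : (ShortComplex.mk (biprod.fst ≫ biprod.inr : X ⊞ Y ⟶ Y ⊞ X)
      (biprod.fst ≫ biprod.inr : Y ⊞ X ⟶ X ⊞ Y) (by simp)).Exact :=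
    exact_epi_comp_mono (shortExact_inr_fst Y X).exact _
  -- X = (M⁰ ⊞ W₁ ⇄ M¹ ⊞ W₀), where each Mⁱ maps to Wᵢ by jᵢ. It maps to `M` by the identity and Wᵢ
  -- → Z → M, with kernel W₁ ⇄ W₀, acyclic by the sequences with cycles at both ends. It maps to the
  -- homology by the projections of W₁ and W₀, with a kernel made of identities of M⁰ and M¹.
  refine ⟨mkComplex (M.X 0 ⊞ W₁) (M.X 1 ⊞ W₀) (biprod.fst ≫ j₀ ≫ biprod.inr)
      (biprod.fst ≫ j₁ ≫ biprod.inr) (by simp) (by simp),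
    mkComplex W₁ W₀ ((-q₁) ≫ M.iCycles 0 ≫ j₀) ((-q₀) ≫ M.iCycles 1 ≫ j₁) (by simp [reassoc_of% h₀''])
      (by simp [reassoc_of% h₁'']),
    mkComplex (M.X 0 ⊞ M.X 1) (M.X 1 ⊞ M.X 0) (biprod.fst ≫ biprod.inr) (biprod.fst ≫ biprod.inr)
      (by simp) (by simp), ?_, ?_, ?_, ?_⟩
  · exact (acyclic_iff _).2 ⟨hR₀, hR₁⟩
  · exact (acyclic_iff _).2 ⟨hR' _ _, hR' _ _⟩
  · refine isExtension_of_degreewise (shortExact_neg_graph (q₁ ≫ M.iCycles 0))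
      (shortExact_neg_graph (q₀ ≫ M.iCycles 1)) ?_ ?_ ?_ ?_
    · change biprod.lift (-(q₁ ≫ M.iCycles 0)) (𝟙 W₁) ≫ biprod.fst ≫ j₀ ≫ biprod.inr =
        ((-q₁) ≫ M.iCycles 0 ≫ j₀) ≫ biprod.lift (-(q₀ ≫ M.iCycles 1)) (𝟙 W₀)
      apply biprod.hom_ext <;> simp [hd₀]
    · change biprod.lift (-(q₀ ≫ M.iCycles 1)) (𝟙 W₀) ≫ biprod.fst ≫ j₁ ≫ biprod.inr =
        ((-q₀) ≫ M.iCycles 1 ≫ j₁) ≫ biprod.lift (-(q₁ ≫ M.iCycles 0)) (𝟙 W₁)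
      apply biprod.hom_ext <;> simp [hd₁]
    · change biprod.desc (𝟙 (M.X 0)) (q₁ ≫ M.iCycles 0) ≫ M.d 0 1 =
        (biprod.fst ≫ j₀ ≫ biprod.inr) ≫ biprod.desc (𝟙 (M.X 1)) (q₀ ≫ M.iCycles 1)
      apply biprod.hom_ext' <;> simp [hd₀]
    · change biprod.desc (𝟙 (M.X 1)) (q₀ ≫ M.iCycles 1) ≫ M.d 1 0 =
        (biprod.fst ≫ j₁ ≫ biprod.inr) ≫ biprod.desc (𝟙 (M.X 0)) (q₁ ≫ M.iCycles 0)
      apply biprod.hom_ext' <;> simp [hd₁]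
  · refine isExtension_of_degreewise (shortExact_biprod_map (M.X 0) hV₁)
      (shortExact_biprod_map (M.X 1) hV₀) ?_ ?_ ?_ ?_
    · change biprod.map (𝟙 _) j₁ ≫ biprod.fst ≫ j₀ ≫ biprod.inr =
        (biprod.fst ≫ biprod.inr) ≫ biprod.map (𝟙 _) j₀
      simp
    · change biprod.map (𝟙 _) j₀ ≫ biprod.fst ≫ j₁ ≫ biprod.inr =
        (biprod.fst ≫ biprod.inr) ≫ biprod.map (𝟙 _) j₁
      simp
    · change (biprod.snd ≫ q₁ ≫ M.homologyπ 0) ≫ 0 =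
        (biprod.fst ≫ j₀ ≫ biprod.inr) ≫ biprod.snd ≫ q₀ ≫ M.homologyπ 1
      simp [h₀]
    · change (biprod.snd ≫ q₀ ≫ M.homologyπ 1) ≫ 0 =
        (biprod.fst ≫ j₁ ≫ biprod.inr) ≫ biprod.snd ≫ q₁ ≫ M.homologyπ 0
      simp [h₁]

end Roof

/-! ### Homology and cycles in extensions by acyclic complexes -/

section Extension

lemma IsExtension.map {C : Type*} [Category* C] [Abelian C] {D : Type*} [Category* D] [Abelian D]
    (F : C ⥤ D) [F.PreservesZeroMorphisms] [PreservesFiniteLimits F] [PreservesFiniteColimits F]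
    {X Y Z : C} (h : IsExtension X Y Z) : IsExtension (F.obj X) (F.obj Y) (F.obj Z) := by
  obtain ⟨f, g, w, hS⟩ := h
  exact ⟨F.map f, F.map g, _, hS.map_of_exact F⟩

lemma isExtension_of_isZero {C : Type*} [Category* C] [Abelian C] {X Y Z : C} (h : IsZero X)
    (e : Y ≅ Z) : IsExtension X Y Z :=
  ⟨0, e.hom, zero_comp, shortExact_of_kernel _ ⟨fun _ _ _ => h.eq_of_tgt _ _⟩ inferInstance
    fun _ x hx => ⟨0, by rw [← cancel_mono e.hom, hx, zero_comp, zero_comp]⟩⟩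

variable {K L M : Z2Complex A}

lemma IsExtension.acyclic (h : IsExtension K L M) (hK : K.Acyclic) (hM : M.Acyclic) :
    L.Acyclic := by
  obtain ⟨f, g, w, hS⟩ := h
  exact hS.acyclic_X₂ hK hM

lemma isIso_homologyMap_of_acyclic_left {f : K ⟶ L} {g : L ⟶ M} {w : f ≫ g = 0}
    (hS : (ShortComplex.mk f g w).ShortExact) (hK : K.Acyclic) (i : ZMod 2) :
    IsIso (homologyMap g i) := by
  have h (k : ZMod 2) : IsZero (K.homology k) := (K.exactAt_iff_isZero_homology k).1 (hK k)
  have : Mono (homologyMap g i) :=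
    (hS.homology_exact₂ i).mono_g ((h i).eq_of_src _ _)
  have : Epi (homologyMap g i) :=
    (hS.homology_exact₃ i (i + 1) rfl).epi_f ((h (i + 1)).eq_of_tgt _ _)
  exact isIso_of_mono_of_epi _

lemma isIso_homologyMap_of_acyclic_right {f : K ⟶ L} {g : L ⟶ M} {w : f ≫ g = 0}
    (hS : (ShortComplex.mk f g w).ShortExact) (hM : M.Acyclic) (i : ZMod 2) :
    IsIso (homologyMap f i) := by
  have h (k : ZMod 2) : IsZero (M.homology k) := (M.exactAt_iff_isZero_homology k).1 (hM k)
  have : Epi (homologyMap f i) :=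
    (hS.homology_exact₂ i).epi_f ((h i).eq_of_tgt _ _)
  have : Mono (homologyMap f i) :=
    (hS.homology_exact₁ (i + 1) i (zmodTwo_rel' i)).mono_g ((h (i + 1)).eq_of_src _ _)
  exact isIso_of_mono_of_epi _

lemma isExtension_cycles {f : K ⟶ L} {g : L ⟶ M} {w : f ≫ g = 0}
    (hS : (ShortComplex.mk f g w).ShortExact) (i : ZMod 2) (hg : Epi (cyclesMap g i)) :
    IsExtension (K.cycles i) (L.cycles i) (M.cycles i) := by
  have := hS.mono_f
  have hf : Mono (K.iCycles i ≫ f.f i) := by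
    have := (hS.map_of_exact (eval A _ i)).mono_f
    exact mono_comp _ (f.f i)
  have : Mono (cyclesMap f i) :=
    mono_of_mono_fac (h := K.iCycles i ≫ f.f i) (cyclesMap_i f i)
  exact ⟨cyclesMap f i, cyclesMap g i, _,
    { exact := cycles_left_exact _ hS.exact i, mono_f := this, epi_g := hg }⟩

/-- Only surjectivity on cycles needs acyclicity: every cycle of `M` is a boundary up to refinement,
and boundaries lift because `g` is epi in the preceding degree. -/
lemma IsExtension.cycles_of_acyclic_right (h : IsExtension K L M) (hM : M.Acyclic) (i : ZMod 2) :
    IsExtension (K.cycles i) (L.cycles i) (M.cycles i) := by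
  obtain ⟨f, g, w, hS⟩ := h
  refine isExtension_cycles hS i ?_
  have hi : (ComplexShape.up (ZMod 2)).Rel (i + 1) i := zmodTwo_rel' i
  have h1 : L.toCycles (i + 1) i ≫ cyclesMap g i = g.f (i + 1) ≫ M.toCycles (i + 1) i := by
    rw [← cancel_mono (M.iCycles i)]
    simp
  have : Epi (M.toCycles (i + 1) i) :=
    Preadditive.epi_of_isZero_cokernel' _
      (M.homologyIsCokernel (i + 1) i (ComplexShape.prev_eq' _ hi))
      ((M.exactAt_iff_isZero_homology _).1 (hM i))
  have : Epi (g.f (i + 1)) := (hS.map_of_exact (eval A _ (i + 1))).epi_g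
  have : Epi (g.f (i + 1) ≫ M.toCycles (i + 1) i) := epi_comp _ _
  exact epi_of_epi_fac h1

/-- Lift a cycle of `M` to a chain `x` of `L`. Its differential is a cycle of `K`, hence a boundary,
and subtracting a chain of `K` with that boundary makes `x` a cycle. -/
lemma IsExtension.cycles_of_acyclic_left (h : IsExtension K L M) (hK : K.Acyclic) (i : ZMod 2) :
    IsExtension (K.cycles i) (L.cycles i) (M.cycles i) := by
  obtain ⟨f, g, w, hS⟩ := h
  refine isExtension_cycles hS i ?_
  rw [epi_iff_surjective_up_to_refinements]
  intro T y
  have hi := hS.map_of_exact (eval A (ComplexShape.up (ZMod 2)) i)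
  have hi' := hS.map_of_exact (eval A (ComplexShape.up (ZMod 2)) (i + 1))
  have hgi : Epi (g.f i) := hi.epi_g
  have hfi : Mono (f.f (i + 1)) := hi'.mono_f
  have hfi' : Mono (f.f i) := hi.mono_f
  obtain ⟨T', π, hπ, x, hx⟩ := surjective_up_to_refinements_of_epi (g.f i) (y ≫ M.iCycles i)
  obtain ⟨k, hk⟩ : ∃ k, k ≫ f.f (i + 1) = x ≫ L.d i (i + 1) :=
    exists_lift_of_shortExact hi' (x ≫ L.d i (i + 1)) (by
      change (x ≫ L.d i (i + 1)) ≫ g.f (i + 1) = 0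
      rw [Category.assoc, ← g.comm, ← reassoc_of% hx]
      simp)
  have hk0 : k ≫ K.d (i + 1) i = 0 := by
    rw [← cancel_mono (f.f i), Category.assoc, ← f.comm, reassoc_of% hk]
    simp
  have hKi := (K.exactAt_iff' i (i + 1) i (ComplexShape.prev_eq' _ rfl)
    (ComplexShape.next_eq' _ (zmodTwo_rel' i))).1 (hK (i + 1))
  obtain ⟨T'', π', hπ', k', hk''⟩ : ∃ (T'' : A) (π' : T'' ⟶ T') (_ : Epi π') (k' : T'' ⟶ K.X i),
    π' ≫ k = k' ≫ K.d i (i + 1) := hKi.exact_up_to_refinements k hk0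
  have hd : (π' ≫ x - k' ≫ f.f i) ≫ L.d i (i + 1) = 0 := by
    rw [Preadditive.sub_comp, Category.assoc, Category.assoc, f.comm, ← reassoc_of% hk'', hk,
      sub_self]
  have hfg : f.f i ≫ g.f i = 0 := by rw [← comp_f, w, zero_f]
  refine ⟨T'', π' ≫ π, inferInstance, L.liftCycles _ (i + 1) (ComplexShape.next_eq' _ rfl) hd, ?_⟩
  rw [← cancel_mono (M.iCycles i)]
  simp [hx, hfg]

end Extension

/-! ### The Grothendieck group of acyclic complexes and the defect -/

section K0

lemma AcyclicK0.cls_of_isExtension {K₁ K₂ K₃ : AcyclicComplex A}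
    (h : IsExtension K₁.1 K₂.1 K₃.1) :
    AcyclicK0.cls K₂ = AcyclicK0.cls K₁ + AcyclicK0.cls K₃ := by
  obtain ⟨f, g, w, hS⟩ := h
  have : AcyclicK0.cls K₂ - AcyclicK0.cls K₁ - AcyclicK0.cls K₃ = 0 :=
    (QuotientAddGroup.eq_zero_iff _).2 (AddSubgroup.subset_closure ⟨K₁, K₂, K₃, f, g, w, hS, rfl⟩)
  rw [← sub_eq_zero, ← this]
  abel

lemma AcyclicK0.cls_of_isZero {K : AcyclicComplex A} (h : IsZero K.1) : AcyclicK0.cls K = 0 := by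
  have := AcyclicK0.cls_of_isExtension (isExtension_of_isZero h (Iso.refl K.1))
  rwa [left_eq_add] at this

lemma AcyclicK0.cls_congr {K L : AcyclicComplex A} (e : K.1 ≅ L.1) :
    AcyclicK0.cls K = AcyclicK0.cls L := by
  let Z : AcyclicComplex A := ⟨0, acyclic_of_isZero _ (Limits.isZero_zero _)⟩
  have := AcyclicK0.cls_of_isExtension (K₁ := Z) (isExtension_of_isZero (Limits.isZero_zero _) e)
  rwa [AcyclicK0.cls_of_isZero (K := Z) (Limits.isZero_zero _), zero_add] at this

lemma acyclic_biprod {K L : Z2Complex A} (hK : K.Acyclic) (hL : L.Acyclic) : (K ⊞ L).Acyclic :=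
  (isExtension_biprod K L).acyclic hK hL

lemma AcyclicK0.cls_biprod (K L : AcyclicComplex A) :
    AcyclicK0.cls ⟨K.1 ⊞ L.1, acyclic_biprod K.2 L.2⟩ = AcyclicK0.cls K + AcyclicK0.cls L :=
  AcyclicK0.cls_of_isExtension (isExtension_biprod K.1 L.1)

lemma AcyclicK0.exists_eq_sub (x : AcyclicK0 A) :
    ∃ K L : AcyclicComplex A, x = AcyclicK0.cls K - AcyclicK0.cls L := by
  let Z : AcyclicComplex A := ⟨0, acyclic_of_isZero _ (Limits.isZero_zero _)⟩
  have hZ : AcyclicK0.cls Z = 0 := AcyclicK0.cls_of_isZero (Limits.isZero_zero _)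
  obtain ⟨x, rfl⟩ := QuotientAddGroup.mk_surjective x
  induction x using FreeAbelianGroup.induction_on with
  | zero => exact ⟨Z, Z, (sub_self _).symm⟩
  | of K => exact ⟨K, Z, by rw [hZ, sub_zero]; rfl⟩
  | neg K _ => exact ⟨Z, K, by rw [hZ, zero_sub]; rfl⟩
  | add x y hx hy =>
    obtain ⟨K, L, h⟩ := hx
    obtain ⟨K', L', h'⟩ := hy
    refine ⟨⟨K.1 ⊞ K'.1, acyclic_biprod K.2 K'.2⟩, ⟨L.1 ⊞ L'.1, acyclic_biprod L.2 L'.2⟩, ?_⟩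
    rw [AcyclicK0.cls_biprod, AcyclicK0.cls_biprod, QuotientAddGroup.mk_add, h, h']
    abel

/-- The class of a contractible complex. -/
def contractibleClass (i : ZMod 2) (X : A) : AcyclicK0 A :=
  AcyclicK0.cls ⟨contractibleObj i X, acyclic_contractible i X⟩

lemma contractibleClass_of_isExtension (i : ZMod 2) {X Y Z : A} (h : IsExtension X Y Z) :
    contractibleClass i Y = contractibleClass i X + contractibleClass i Z :=
  AcyclicK0.cls_of_isExtension (h.map (contractible i))

lemma contractibleClass_congr (i : ZMod 2) {X Y : A} (e : X ≅ Y) :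
    contractibleClass i X = contractibleClass i Y :=
  AcyclicK0.cls_congr ((contractible i).mapIso e)

lemma contractibleClass_of_isZero (i : ZMod 2) {X : A} (h : IsZero X) :
    contractibleClass i X = 0 :=
  AcyclicK0.cls_of_isZero ((contractible i).map_isZero h)

/-- The defect in the Grothendieck group of acyclic complexes between a complex and its homology. -/
def defect (M : Z2Complex A) : AcyclicK0 A :=
  (contractibleClass 0 (M.cycles 1) - contractibleClass 0 (M.homology 1)) +
    (contractibleClass 1 (M.cycles 0) - contractibleClass 1 (M.homology 0))

lemma defect_congr {M N : Z2Complex A} (e : M ≅ N) : defect M = defect N := by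
  rw [defect, defect, contractibleClass_congr 0 (cyclesMapIso e 1),
    contractibleClass_congr 0 (homologyMapIso e 1), contractibleClass_congr 1 (cyclesMapIso e 0),
    contractibleClass_congr 1 (homologyMapIso e 0)]

/-- The two descriptions of the resolution `K'` give [K⁰] + [Z⁰, shifted] = [Z⁰] + [K] for
contractible classes. The exact sequence Z⁰ → K⁰ → Z¹ replaces [K⁰] by [Z⁰] + [Z¹], and [Z⁰]
cancels. -/
lemma defect_of_acyclic [FinitaryHereditary A] (K : AcyclicComplex A) :
    defect K.1 = AcyclicK0.cls K := by
  have h (i : ZMod 2) : IsZero (K.1.homology i) := (K.1.exactAt_iff_isZero_homology i).1 (K.2 i)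
  rw [defect, contractibleClass_of_isZero 0 (h 1), contractibleClass_of_isZero 1 (h 0), sub_zero,
    sub_zero]
  obtain ⟨K', h₁, h₂⟩ := exists_acyclic_resolution K.1 K.2
  have hK' : K'.Acyclic := h₁.acyclic (acyclic_contractible _ _) (acyclic_contractible _ _)
  have e₁ := AcyclicK0.cls_of_isExtension (K₁ := ⟨_, acyclic_contractible _ _⟩) (K₂ := ⟨_, hK'⟩)
    (K₃ := ⟨_, acyclic_contractible _ _⟩) h₁
  have e₂ := AcyclicK0.cls_of_isExtension (K₁ := ⟨_, acyclic_contractible _ _⟩) (K₂ := ⟨_, hK'⟩)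
    (K₃ := K) h₂
  have e₃ : IsExtension (K.1.cycles 0) (K.1.X 0) (K.1.cycles 1) := by
    have : Epi (K.1.toCycles 0 1) := toCycles_epi_of_acyclic K.2 0
    refine ⟨K.1.iCycles 0, K.1.toCycles 0 1, ?_, shortExact_of_kernel _ inferInstance this ?_⟩
    · rw [← cancel_mono (K.1.iCycles 1)]
      simp
    · intro T x hx
      exact ⟨K.1.liftCycles x 1 (ComplexShape.next_eq' _ rfl)
        (by rw [← K.1.toCycles_i 0 1, reassoc_of% hx, zero_comp]), by simp⟩
  have e₄ := contractibleClass_of_isExtension 0 e₃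
  rw [← contractibleClass, ← contractibleClass] at e₁
  rw [← contractibleClass] at e₂
  rw [e₂, e₄, add_assoc] at e₁
  exact (add_left_cancel e₁).symm

/-- The isomorphism classes of the homology objects. -/
def homologyClass (M : Z2Complex A) : IsoClass A × IsoClass A :=
  (IsoClass.mk (M.homology 1), IsoClass.mk (M.homology 0))

lemma homologyClass_congr {M N : Z2Complex A} (e : M ≅ N) : homologyClass M = homologyClass N :=
  Prod.ext (IsoClass.mk_eq_iff.2 ⟨homologyMapIso e 1⟩) (IsoClass.mk_eq_iff.2 ⟨homologyMapIso e 0⟩)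

variable {K L M : Z2Complex A}

lemma IsExtension.homologyIso_left (h : IsExtension K L M) (hK : K.Acyclic) (i : ZMod 2) :
    Nonempty (L.homology i ≅ M.homology i) := by
  obtain ⟨f, g, w, hS⟩ := h
  have := isIso_homologyMap_of_acyclic_left hS hK i
  exact ⟨asIso (homologyMap g i)⟩

lemma IsExtension.homologyIso_right (h : IsExtension M L K) (hK : K.Acyclic) (i : ZMod 2) :
    Nonempty (L.homology i ≅ M.homology i) := by
  obtain ⟨f, g, w, hS⟩ := h
  have := isIso_homologyMap_of_acyclic_right hS hK i
  exact ⟨(asIso (homologyMap f i)).symm⟩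

/-- `L` and `M` have the same homology, and the cycles form short exact sequences, so the defects
differ by that of `K`, which is its class. -/
lemma IsExtension.defect_left [FinitaryHereditary A] {K : AcyclicComplex A}
    (h : IsExtension K.1 L M) : defect L = AcyclicK0.cls K + defect M := by
  obtain ⟨e₁⟩ := h.homologyIso_left K.2 1
  obtain ⟨e₀⟩ := h.homologyIso_left K.2 0
  have hK (i : ZMod 2) : IsZero (K.1.homology i) := (K.1.exactAt_iff_isZero_homology i).1 (K.2 i)
  rw [← defect_of_acyclic, defect, defect, defect, contractibleClass_congr 0 e₁,
    contractibleClass_congr 1 e₀, contractibleClass_of_isZero 0 (hK 1),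
    contractibleClass_of_isZero 1 (hK 0),
    contractibleClass_of_isExtension 0 (h.cycles_of_acyclic_left K.2 1),
    contractibleClass_of_isExtension 1 (h.cycles_of_acyclic_left K.2 0)]
  abel

lemma IsExtension.defect_right [FinitaryHereditary A] {K : AcyclicComplex A}
    (h : IsExtension M L K.1) : defect L = AcyclicK0.cls K + defect M := by
  obtain ⟨e₁⟩ := h.homologyIso_right K.2 1
  obtain ⟨e₀⟩ := h.homologyIso_right K.2 0
  have hK (i : ZMod 2) : IsZero (K.1.homology i) := (K.1.exactAt_iff_isZero_homology i).1 (K.2 i)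
  rw [← defect_of_acyclic, defect, defect, defect, contractibleClass_congr 0 e₁,
    contractibleClass_congr 1 e₀, contractibleClass_of_isZero 0 (hK 1),
    contractibleClass_of_isZero 1 (hK 0),
    contractibleClass_of_isExtension 0 (h.cycles_of_acyclic_right K.2 1),
    contractibleClass_of_isExtension 1 (h.cycles_of_acyclic_right K.2 0)]
  abel

lemma IsExtension.homologyClass_left (h : IsExtension K L M) (hK : K.Acyclic) :
    homologyClass L = homologyClass M :=
  Prod.ext (IsoClass.mk_eq_iff.2 (h.homologyIso_left hK 1))
    (IsoClass.mk_eq_iff.2 (h.homologyIso_left hK 0))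

lemma IsExtension.homologyClass_right (h : IsExtension M L K) (hK : K.Acyclic) :
    homologyClass L = homologyClass M :=
  Prod.ext (IsoClass.mk_eq_iff.2 (h.homologyIso_right hK 1))
    (IsoClass.mk_eq_iff.2 (h.homologyIso_right hK 0))

lemma defect_of_d_eq_zero (h : ∀ i j, M.d i j = 0) : defect M = 0 := by
  have h' (i : ZMod 2) : Nonempty (M.cycles i ≅ M.homology i) :=
    have := M.isIso_homologyπ (i + 1) i (ComplexShape.prev_eq' _ (zmodTwo_rel' i)) (h _ _)
    ⟨asIso (M.homologyπ i)⟩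
  obtain ⟨e₁⟩ := h' 1
  obtain ⟨e₀⟩ := h' 0
  rw [defect, contractibleClass_congr 0 e₁, contractibleClass_congr 1 e₀, sub_self, sub_self,
    add_zero]

end K0

end

end ModifiedHall

namespace ModifiedHall

open Abelian HomologicalComplex

noncomputable section

variable {A : Type u} [Category.{v} A] [Abelian A]

/-! ### Stalk complexes as normal forms, and the derived category -/

section Stalk

variable {N : Z2Complex A}

/-- A complex with zero differentials is a sum of stalk complexes. -/
lemma nonempty_iso_stalk (h : ∀ i j, N.d i j = 0) :
    Nonempty (N ≅ stalkOne (N.X 1) ⊞ stalkZero (N.X 0)) := by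
  let p₁ : N ⟶ stalkOne (N.X 1) := mkHomToSingle (𝟙 _) (fun i _ => by rw [h, zero_comp])
  let p₀ : N ⟶ stalkZero (N.X 0) := mkHomToSingle (𝟙 _) (fun i _ => by rw [h, zero_comp])
  let i₁ : stalkOne (N.X 1) ⟶ N := mkHomFromSingle (𝟙 _) (fun i _ => by rw [h, comp_zero])
  let i₀ : stalkZero (N.X 0) ⟶ N := mkHomFromSingle (𝟙 _) (fun i _ => by rw [h, comp_zero])
  have h₁ : IsZero ((stalkOne (N.X 1)).X 0) := isZero_single_obj_X _ _ _ _ (by decide)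
  have h₀ : IsZero ((stalkZero (N.X 0)).X 1) := isZero_single_obj_X _ _ _ _ (by decide)
  have e₁₁ : i₁ ≫ p₁ = 𝟙 _ := from_single_hom_ext (by simp [i₁, p₁])
  have e₀₀ : i₀ ≫ p₀ = 𝟙 _ := from_single_hom_ext (by simp [i₀, p₀])
  have e₁₀ : i₁ ≫ p₀ = 0 := from_single_hom_ext (h₀.eq_of_tgt _ _)
  have e₀₁ : i₀ ≫ p₁ = 0 := from_single_hom_ext (h₁.eq_of_tgt _ _)
  have e : p₁ ≫ i₁ + p₀ ≫ i₀ = 𝟙 N := by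
    apply hom_ext_zmodTwo
    · rw [add_f_apply, comp_f, comp_f, h₁.eq_of_tgt (p₁.f 0) 0]
      simp [p₀, i₀]
    · rw [add_f_apply, comp_f, comp_f, h₀.eq_of_tgt (p₀.f 1) 0]
      simp [p₁, i₁]
  exact ⟨{ hom := biprod.lift p₁ p₀
           inv := biprod.desc i₁ i₀
           hom_inv_id := by rw [biprod.lift_desc, e]
           inv_hom_id := by
             apply biprod.hom_ext' <;> apply biprod.hom_ext <;> simp [e₁₁, e₀₀, e₁₀, e₀₁] }⟩

lemma nonempty_homology_iso_of_d_eq_zero (h : ∀ i j, N.d i j = 0) (i : ZMod 2) :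
    Nonempty (N.homology i ≅ N.X i) :=
  have := N.isIso_homologyπ (i + 1) i (ComplexShape.prev_eq' _ (zmodTwo_rel' i)) (h _ _)
  have := N.isIso_iCycles i (i + 1) (ComplexShape.next_eq' _ rfl) (h _ _)
  ⟨(asIso (N.homologyπ i)).symm ≪≫ asIso (N.iCycles i)⟩

lemma mkComplex_zero_d (X Y : A) (i j : ZMod 2) :
    (mkComplex X Y 0 0 comp_zero comp_zero).d i j = 0 := by
  revert i j
  exact zmodTwo_forall (zmodTwo_forall rfl rfl) (zmodTwo_forall rfl rfl)

lemma nonempty_iso_stalkClass_rep {X Y : A} {p : IsoClass A × IsoClass A} (h₁ : IsoClass.mk Y = p.1)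
    (h₀ : IsoClass.mk X = p.2) :
    Nonempty (mkComplex X Y 0 0 comp_zero comp_zero ≅ (stalkClass p).rep) := by
  obtain ⟨p₁, p₀⟩ := p
  subst h₁ h₀
  obtain ⟨e⟩ := nonempty_iso_stalk (mkComplex_zero_d X Y)
  obtain ⟨f₁⟩ := IsoClass.mk_eq_iff.1 (IsoClass.mk_rep (IsoClass.mk Y))
  obtain ⟨f₀⟩ := IsoClass.mk_eq_iff.1 (IsoClass.mk_rep (IsoClass.mk X))
  exact ⟨e ≪≫ biprod.mapIso ((single A _ 1).mapIso f₁.symm) ((single A _ 0).mapIso f₀.symm) ≪≫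
    (IsoClass.repIso _).symm⟩

lemma defect_stalk (p : IsoClass A × IsoClass A) : defect (stalkClass p).rep = 0 := by
  obtain ⟨e⟩ := nonempty_iso_stalkClass_rep (IsoClass.mk_rep p.1) (IsoClass.mk_rep p.2)
  rw [← defect_congr e, defect_of_d_eq_zero (mkComplex_zero_d _ _)]

lemma homologyClass_stalk (p : IsoClass A × IsoClass A) :
    homologyClass (stalkClass p).rep = p := by
  obtain ⟨e⟩ := nonempty_iso_stalkClass_rep (IsoClass.mk_rep p.1) (IsoClass.mk_rep p.2)
  rw [← homologyClass_congr e]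
  have h (i : ZMod 2) := nonempty_homology_iso_of_d_eq_zero (mkComplex_zero_d p.2.rep p.1.rep) i
  exact Prod.ext ((IsoClass.mk_eq_iff.2 (h 1)).trans (IsoClass.mk_rep _))
    ((IsoClass.mk_eq_iff.2 (h 0)).trans (IsoClass.mk_rep _))

/-- Every complex `M` is connected to a sum of stalk complexes by epimorphisms with acyclic
kernels. -/
theorem exists_stalk_roof [FinitaryHereditary A] (M : Z2Complex A) :
    ∃ (X : Z2Complex A) (R R' : AcyclicComplex A), IsExtension R.1 X M ∧
      IsExtension R'.1 X (stalkClass (homologyClass M)).rep := by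
  obtain ⟨X, R, R', hR, hR', h, f, g, w, hS⟩ := exists_roof M
  obtain ⟨e⟩ := nonempty_iso_stalkClass_rep (X := M.homology 0) (Y := M.homology 1)
    (p := homologyClass M) rfl rfl
  exact ⟨X, ⟨R, hR⟩, ⟨R', hR'⟩, h, f, g ≫ e.hom, _, shortExact_comp_iso hS e⟩

end Stalk

section Derived

lemma nonempty_derived_iso_of_isExtension {K L M : Z2Complex A} (h : IsExtension K L M)
    (hK : K.Acyclic) : Nonempty ((toZ2Derived A).obj L ≅ (toZ2Derived A).obj M) := by
  obtain ⟨f, g, w, hS⟩ := h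
  have hg : HomologicalComplex.quasiIso A _ g := by
    rw [mem_quasiIso_iff, quasiIso_iff]
    intro i
    rw [quasiIsoAt_iff_isIso_homologyMap]
    exact isIso_homologyMap_of_acyclic_left hS hK i
  have := Localization.inverts (toZ2Derived A) _ g hg
  exact ⟨asIso ((toZ2Derived A).map g)⟩

lemma nonempty_homology_iso_of_derived_iso {M N : Z2Complex A}
    (e : (toZ2Derived A).obj M ≅ (toZ2Derived A).obj N) (i : ZMod 2) :
    Nonempty (M.homology i ≅ N.homology i) := by
  have h : (HomologicalComplex.quasiIso A (ComplexShape.up (ZMod 2))).IsInvertedBy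
      (homologyFunctor A _ i) := fun X Y f hf => by
    rw [mem_quasiIso_iff] at hf
    exact (quasiIsoAt_iff_isIso_homologyMap f i).1 inferInstance
  let F := Localization.lift (homologyFunctor A _ i) h (toZ2Derived A)
  let φ := Localization.fac (homologyFunctor A _ i) h (toZ2Derived A)
  exact ⟨(φ.app M).symm ≪≫ F.mapIso e ≪≫ φ.app N⟩

/-- Homology factors through the localization and recovers `p`, hence injectivity. The legs of a
roof have acyclic kernels and become isomorphisms, hence surjectivity. -/
theorem bijective_stalkClass_derived [FinitaryHereditary A] : Function.Bijective
    (fun p : IsoClass A × IsoClass A => (stalkClass p).map (toZ2Derived A)) := by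
  have h (p : IsoClass A × IsoClass A) : (stalkClass p).map (toZ2Derived A) =
      IsoClass.mk ((toZ2Derived A).obj (stalkClass p).rep) := by
    conv_lhs => rw [← IsoClass.mk_rep (stalkClass p)]
    rfl
  refine ⟨fun p q hpq => ?_, fun x => ?_⟩
  · dsimp only at hpq
    rw [h, h, IsoClass.mk_eq_iff] at hpq
    obtain ⟨e⟩ := hpq
    rw [← homologyClass_stalk p, ← homologyClass_stalk q]
    exact Prod.ext (IsoClass.mk_eq_iff.2 (nonempty_homology_iso_of_derived_iso e 1))
      (IsoClass.mk_eq_iff.2 (nonempty_homology_iso_of_derived_iso e 0))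
  · have := Localization.essSurj (toZ2Derived A)
      (HomologicalComplex.quasiIso A (ComplexShape.up (ZMod 2)))
    let M := (toZ2Derived A).objPreimage x.rep
    have e : (toZ2Derived A).obj M ≅ x.rep := (toZ2Derived A).objObjPreimageIso x.rep
    obtain ⟨X, R, R', h₁, h₂⟩ := exists_stalk_roof M
    obtain ⟨e₁⟩ := nonempty_derived_iso_of_isExtension h₁ R.2
    obtain ⟨e₂⟩ := nonempty_derived_iso_of_isExtension h₂ R'.2
    refine ⟨homologyClass M, ?_⟩
    dsimp only
    rw [h, ← IsoClass.mk_rep x]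
    exact IsoClass.mk_eq_iff.2 ⟨e₂.symm ≪≫ e₁ ≪≫ e⟩

end Derived

end

end ModifiedHall

namespace ModifiedHall

open Abelian HomologicalComplex

noncomputable section

attribute [local instance] HasExt.standard

/-! ### The Euler form, and Hall products in extensions by acyclic complexes -/

section Card

lemma card_eq_card_range_mul_card_range {X Y Z : Type*} [AddGroup X] [AddGroup Y] [AddGroup Z]
    (f : X →+ Y) (g : Y →+ Z) (h : Function.Exact f g) :
    Nat.card Y = Nat.card f.range * Nat.card g.range := by
  have h' : f.range = g.ker := by
    ext y
    exact (h y).symm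
  rw [AddSubgroup.card_eq_card_quotient_mul_card_addSubgroup g.ker, h', mul_comm,
    Nat.card_congr (QuotientAddGroup.quotientKerEquivRange g).toEquiv]

/-- The order of each term is the product of the orders of the images of the incoming and outgoing
maps; these images telescope in the alternating product. -/
lemma card_six_term {X₁ X₂ X₃ Y₁ Y₂ Y₃ : Type*} [AddGroup X₁] [AddGroup X₂] [AddGroup X₃]
    [AddGroup Y₁] [AddGroup Y₂] [AddGroup Y₃] (a : X₁ →+ X₂) (b : X₂ →+ X₃) (d : X₃ →+ Y₁)
    (a' : Y₁ →+ Y₂) (b' : Y₂ →+ Y₃) (ha : Function.Injective a)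
    (hX₂ : Function.Exact a b) (hX₃ : Function.Exact b d) (hY₁ : Function.Exact d a')
    (hY₂ : Function.Exact a' b')
    (hb' : Function.Surjective b') :
    Nat.card X₂ * (Nat.card Y₁ * Nat.card Y₃) = Nat.card X₁ * Nat.card X₃ * Nat.card Y₂ := by
  have e₁ : Nat.card a.range = Nat.card X₁ :=
    Nat.card_congr (AddMonoidHom.ofInjective ha).symm.toEquiv
  have e₃ : Nat.card b'.range = Nat.card Y₃ := by
    rw [AddMonoidHom.range_eq_top.2 hb']
    exact AddSubgroup.card_top
  rw [card_eq_card_range_mul_card_range a b hX₂, card_eq_card_range_mul_card_range b d hX₃,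
    card_eq_card_range_mul_card_range d a' hY₁, card_eq_card_range_mul_card_range a' b' hY₂, e₁, e₃]
  ring

end Card

section EulerForm

variable {C : Type u} [Category.{v} C] [Abelian C]
  [hH : ∀ X Y : C, Finite (X ⟶ Y)] [hE : ∀ X Y : C, Finite (ExtGroup X Y 1)]

/-- The Euler form `|Hom(M, N)| / |Ext^1(M, N)|`. -/
def euler (M N : C) : ℚˣ :=
  Units.mk0 ((Nat.card (M ⟶ N) : ℚ) / (Nat.card (ExtGroup M N 1) : ℚ))
    (div_ne_zero (card_hom_ne_zero M N) (card_ext_ne_zero M N))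

lemma euler_val (M N : C) :
    (euler M N : ℚ) = (Nat.card (M ⟶ N) : ℚ) / (Nat.card (ExtGroup M N 1) : ℚ) := rfl

omit hH hE in
lemma card_ext_zero (M N : C) : Nat.card (ExtGroup M N 0) = Nat.card (M ⟶ N) :=
  Nat.card_congr Ext.homEquiv₀

variable {K L M : C}

omit hH hE in
-- The vanishing of Ext²(N, K) cuts the long exact sequence down to six terms.
lemma card_ext_postcomp {f : K ⟶ L} {g : L ⟶ M} {w : f ≫ g = 0}
    (hS : (ShortComplex.mk f g w).ShortExact) (N : C) (h2 : Subsingleton (ExtGroup N K 2)) :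
    Nat.card (N ⟶ L) * (Nat.card (ExtGroup N K 1) * Nat.card (ExtGroup N M 1)) =
      Nat.card (N ⟶ K) * Nat.card (N ⟶ M) * Nat.card (ExtGroup N L 1) := by
  have : Mono f := hS.mono_f
  rw [← card_ext_zero N K, ← card_ext_zero N L, ← card_ext_zero N M]
  exact card_six_term ((Ext.mk₀ f).postcomp N (add_zero 0))
    ((Ext.mk₀ g).postcomp N (add_zero 0))
    (hS.extClass.postcomp N (zero_add 1)) ((Ext.mk₀ f).postcomp N (add_zero 1))
    ((Ext.mk₀ g).postcomp N (add_zero 1)) (Ext.postcomp_mk₀_injective_of_mono N f)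
    ((ShortComplex.ab_exact_iff_function_exact _).1 (Ext.covariant_sequence_exact₂' N hS 0))
    ((ShortComplex.ab_exact_iff_function_exact _).1 (Ext.covariant_sequence_exact₃' N hS 0 1 rfl))
    ((ShortComplex.ab_exact_iff_function_exact _).1 (Ext.covariant_sequence_exact₁' N hS 0 1 rfl))
    ((ShortComplex.ab_exact_iff_function_exact _).1 (Ext.covariant_sequence_exact₂' N hS 1))
    (fun x => Ext.covariant_sequence_exact₃ N hS x rfl (Subsingleton.elim _ _))

omit hH hE in
lemma card_ext_precomp {f : K ⟶ L} {g : L ⟶ M} {w : f ≫ g = 0}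
    (hS : (ShortComplex.mk f g w).ShortExact) (N : C) (h2 : Subsingleton (ExtGroup M N 2)) :
    Nat.card (L ⟶ N) * (Nat.card (ExtGroup M N 1) * Nat.card (ExtGroup K N 1)) =
      Nat.card (M ⟶ N) * Nat.card (K ⟶ N) * Nat.card (ExtGroup L N 1) := by
  have : Epi g := hS.epi_g
  rw [← card_ext_zero K N, ← card_ext_zero L N, ← card_ext_zero M N]
  exact card_six_term ((Ext.mk₀ g).precomp N (zero_add 0))
    ((Ext.mk₀ f).precomp N (zero_add 0))
    (hS.extClass.precomp N (add_zero 1)) ((Ext.mk₀ g).precomp N (zero_add 1))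
    ((Ext.mk₀ f).precomp N (zero_add 1)) (Ext.precomp_mk₀_injective_of_epi N g)
    ((ShortComplex.ab_exact_iff_function_exact _).1 (Ext.contravariant_sequence_exact₂' hS N 0))
    ((ShortComplex.ab_exact_iff_function_exact _).1
      (Ext.contravariant_sequence_exact₁' hS N 0 1 rfl))
    ((ShortComplex.ab_exact_iff_function_exact _).1
      (Ext.contravariant_sequence_exact₃' hS N 0 1 rfl))
    ((ShortComplex.ab_exact_iff_function_exact _).1 (Ext.contravariant_sequence_exact₂' hS N 1))
    (fun x => Ext.contravariant_sequence_exact₁ hS N x rfl (Subsingleton.elim _ _))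

lemma IsExtension.euler_right (h : IsExtension K L M) (N : C) (h2 : Subsingleton (ExtGroup N K 2)) :
    euler N L = euler N K * euler N M := by
  obtain ⟨f, g, w, hS⟩ := h
  have e := card_ext_postcomp hS N h2
  ext
  rw [Units.val_mul, euler_val, euler_val, euler_val, div_mul_div_comm,
    div_eq_div_iff (card_ext_ne_zero _ _) (mul_ne_zero (card_ext_ne_zero _ _) (card_ext_ne_zero _ _))]
  exact_mod_cast e

lemma IsExtension.euler_left (h : IsExtension K L M) (N : C) (h2 : Subsingleton (ExtGroup M N 2)) :
    euler L N = euler K N * euler M N := by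
  obtain ⟨f, g, w, hS⟩ := h
  have e := card_ext_precomp hS N h2
  ext
  rw [mul_comm, Units.val_mul, euler_val, euler_val, euler_val, div_mul_div_comm,
    div_eq_div_iff (card_ext_ne_zero _ _) (mul_ne_zero (card_ext_ne_zero _ _) (card_ext_ne_zero _ _))]
  exact_mod_cast e

omit hH hE in
-- The snake lemma for a morphism of extensions that is the identity on the quotient: `b` is onto
-- because `g` is, and has the same kernel as `g`.
lemma isExtension_of_hom_left {X X' E E' N : C} {i : X ⟶ E} {p : E ⟶ N} {w : i ≫ p = 0}
    (hS : (ShortComplex.mk i p w).ShortExact) {i' : X' ⟶ E'} {p' : E' ⟶ N} {w' : i' ≫ p' = 0}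
    (hS' : (ShortComplex.mk i' p' w').ShortExact) {f : K ⟶ X} {g : X ⟶ X'} {w'' : f ≫ g = 0}
    (hT : (ShortComplex.mk f g w'').ShortExact) (b : E ⟶ E') (h₁ : i ≫ b = g ≫ i')
    (h₂ : b ≫ p' = p) : IsExtension K E E' := by
  have : Mono i := hS.mono_f
  have : Mono i' := hS'.mono_f
  have : Mono f := hT.mono_f
  have : Epi p := hS.epi_g
  have : Epi p' := hS'.epi_g
  have : Epi g := hT.epi_g
  refine ⟨f ≫ i, b, by rw [Category.assoc, h₁, reassoc_of% w'', zero_comp],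
    shortExact_of_kernel _ (mono_comp _ _) ?_ fun T x hx => ?_⟩
  · refine Preadditive.epi_of_cancel_zero _ fun {T} k hk => ?_
    obtain ⟨k', rfl⟩ := exists_desc_of_shortExact hS' k (by
      rw [← cancel_epi g, ← reassoc_of% h₁, hk, comp_zero, comp_zero])
    rw [reassoc_of% h₂] at hk
    rw [zero_of_epi_comp p hk, comp_zero]
  · obtain ⟨y, rfl⟩ := exists_lift_of_shortExact hS x (by rw [← h₂, reassoc_of% hx, zero_comp])
    obtain ⟨z, rfl⟩ := exists_lift_of_shortExact hT y (by
      rw [← cancel_mono i', Category.assoc, ← h₁, ← Category.assoc, hx, zero_comp])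
    exact ⟨z, (Category.assoc _ _ _).symm⟩

omit hH hE in
lemma isExtension_of_hom_right {X E E' N N' : C} {i : X ⟶ E} {p : E ⟶ N} {w : i ≫ p = 0}
    (hS : (ShortComplex.mk i p w).ShortExact) {i' : X ⟶ E'} {p' : E' ⟶ N'} {w' : i' ≫ p' = 0}
    (hS' : (ShortComplex.mk i' p' w').ShortExact) {f : N ⟶ N'} {g : N' ⟶ K} {w'' : f ≫ g = 0}
    (hT : (ShortComplex.mk f g w'').ShortExact) (b : E ⟶ E') (h₁ : i ≫ b = i')
    (h₂ : b ≫ p' = p ≫ f) : IsExtension E E' K := by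
  have : Mono i := hS.mono_f
  have : Mono i' := hS'.mono_f
  have : Mono f := hT.mono_f
  have : Epi p := hS.epi_g
  have : Epi p' := hS'.epi_g
  have : Epi g := hT.epi_g
  refine ⟨b, p' ≫ g, by rw [reassoc_of% h₂, w'', comp_zero],
    shortExact_of_cokernel _ ?_ (epi_comp _ _) fun T x hx => ?_⟩
  · refine Preadditive.mono_of_cancel_zero _ fun {T} k hk => ?_
    obtain ⟨k', rfl⟩ := exists_lift_of_shortExact hS k (by
      rw [← cancel_mono f, Category.assoc, ← h₂, reassoc_of% hk, zero_comp, zero_comp])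
    rw [Category.assoc, h₁] at hk
    rw [zero_of_comp_mono i' hk, zero_comp]
  · obtain ⟨y, rfl⟩ := exists_desc_of_shortExact hS' x (by rw [← h₁, Category.assoc, hx, comp_zero])
    obtain ⟨z, rfl⟩ := exists_desc_of_shortExact hT y (by
      rw [← cancel_epi p, ← reassoc_of% h₂, hx, comp_zero])
    exact ⟨z, Category.assoc _ _ _⟩

omit hH hE in
lemma sum_comp_of_surjective {X Y V : Type*} [AddGroup X] [AddGroup Y] [Fintype X] [Fintype Y]
    [AddCommGroup V] [Module ℚ V] (φ : X →+ Y) (hφ : Function.Surjective φ) (h : Y → V) :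
    ∑ x, h (φ x) = ((Nat.card X : ℚ) / (Nat.card Y : ℚ)) • ∑ y, h y := by
  classical
  have hc (y : Y) : (Finset.univ.filter fun x => φ x = y).card =
      (Finset.univ.filter fun x => φ x = 0).card :=
    AddMonoidHom.card_fiber_eq_of_mem_range φ (hφ y) (hφ 0)
  have hX : Nat.card X = Nat.card Y * (Finset.univ.filter fun x => φ x = 0).card := by
    rw [Nat.card_eq_fintype_card, Nat.card_eq_fintype_card, ← Finset.card_univ,
      Finset.card_eq_sum_card_fiberwise (f := φ) (t := Finset.univ) (fun _ _ => Finset.mem_coe.2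
        (Finset.mem_univ _)),
      Finset.sum_congr rfl fun y _ => hc y, Finset.sum_const, Finset.card_univ, smul_eq_mul]
  have hY : (Nat.card Y : ℚ) ≠ 0 := Nat.cast_ne_zero.2 Nat.card_pos.ne'
  rw [hX, Nat.cast_mul, mul_div_cancel_left₀ _ hY, Finset.smul_sum,
    ← Finset.sum_fiberwise Finset.univ φ]
  refine Finset.sum_congr rfl fun y _ => ?_
  rw [Finset.sum_congr rfl (g := fun _ => h y) fun x hx => by rw [(Finset.mem_filter.1 hx).2],
    Finset.sum_const, hc, Nat.cast_smul_eq_nsmul]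

section HallProduct

variable {V : Type*} [AddCommGroup V] [Module ℚ V] (Φ : HallAlgebra C →ₗ[ℚ] V) (τ : V →ₗ[ℚ] V)

/-- Compatibility of the Hall product on the right with an extension whose kernel acts by `τ`. -/
theorem IsExtension.map_cls_mul_cls_right (h : IsExtension K L M) (N : C)
    (h2 : Subsingleton (ExtGroup N K 2))
    (hτ : ∀ E E' : C, IsExtension K E E' → Φ (HallAlgebra.cls E) = τ (Φ (HallAlgebra.cls E'))) :
    Φ (HallAlgebra.cls N * HallAlgebra.cls L) =
      (((euler N K)⁻¹ : ℚˣ) : ℚ) • τ (Φ (HallAlgebra.cls N * HallAlgebra.cls M)) := by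
  have he := h.euler_right N h2
  obtain ⟨f, g, w, hS⟩ := h
  have := Fintype.ofFinite (ExtGroup N L 1)
  have := Fintype.ofFinite (ExtGroup N M 1)
  let φ : ExtGroup N L 1 →+ ExtGroup N M 1 := (Ext.mk₀ g).postcomp N (add_zero 1)
  -- The cokernel of pushing extension classes forward along `g` embeds in Ext²(N, K).
  have hφ : Function.Surjective φ := fun x =>
    Ext.covariant_sequence_exact₃ N hS x rfl (Subsingleton.elim _ _)
  -- The map `g` extends to the middle terms of `x` and of its image, with kernel `K`, so `hτ`
  -- relates their classes.
  have hmid (x : ExtGroup N L 1) : Φ (HallAlgebra.cls (midTerm x)) =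
      τ (Φ (HallAlgebra.cls (midTerm (φ x)))) := by
    obtain ⟨i, p, w₁, hS₁, hx⟩ := exists_midTerm x
    obtain ⟨i', p', w₂, hS₂, hx'⟩ := exists_midTerm (φ x)
    obtain ⟨b, hb, hb'⟩ := exists_hom_of_extClass hS₁ hS₂ g (𝟙 N) (by
      rw [hx, hx']
      exact (Ext.mk₀_id_comp _).symm)
    exact hτ _ _ (isExtension_of_hom_left hS₁ hS₂ hS b hb (by simpa using hb'))
  rw [cls_mul_cls, cls_mul_cls, map_smul, map_smul, map_smul, map_sum, map_sum, map_sum,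
    Finset.sum_congr rfl fun x _ => hmid x,
    sum_comp_of_surjective φ hφ fun y => τ (Φ (HallAlgebra.cls (midTerm y))), smul_smul, smul_smul]
  congr 1
  -- The fibres have size |Ext¹(N, L)| / |Ext¹(N, M)|; with the normalizations by |Hom| this is the
  -- Euler form of N and M over that of N and L.
  rw [show (euler N K)⁻¹ = (euler N L)⁻¹ * euler N M by rw [he]; simp]
  rw [Units.val_mul, Units.val_inv_eq_inv_val, euler_val, euler_val]
  have := card_hom_ne_zero N M
  have := card_hom_ne_zero N L
  have := card_ext_ne_zero N M
  have := card_ext_ne_zero N L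
  field_simp

/-- Compatibility of the Hall product on the left with an extension whose cokernel acts by `τ`. -/
theorem IsExtension.map_cls_mul_cls_left (h : IsExtension M L K) (N : C)
    (h2 : Subsingleton (ExtGroup K N 2))
    (hτ : ∀ E E' : C, IsExtension E' E K → Φ (HallAlgebra.cls E) = τ (Φ (HallAlgebra.cls E'))) :
    Φ (HallAlgebra.cls L * HallAlgebra.cls N) =
      (((euler K N)⁻¹ : ℚˣ) : ℚ) • τ (Φ (HallAlgebra.cls M * HallAlgebra.cls N)) := by
  have he := h.euler_left N h2
  obtain ⟨f, g, w, hS⟩ := h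
  have := Fintype.ofFinite (ExtGroup L N 1)
  have := Fintype.ofFinite (ExtGroup M N 1)
  let φ : ExtGroup L N 1 →+ ExtGroup M N 1 := (Ext.mk₀ f).precomp N (zero_add 1)
  have hφ : Function.Surjective φ := fun x =>
    Ext.contravariant_sequence_exact₁ hS N x rfl (Subsingleton.elim _ _)
  have hmid (x : ExtGroup L N 1) : Φ (HallAlgebra.cls (midTerm x)) =
      τ (Φ (HallAlgebra.cls (midTerm (φ x)))) := by
    obtain ⟨i, p, w₁, hS₁, hx⟩ := exists_midTerm x
    obtain ⟨i', p', w₂, hS₂, hx'⟩ := exists_midTerm (φ x)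
    obtain ⟨b, hb, hb'⟩ := exists_hom_of_extClass hS₂ hS₁ (𝟙 N) f (by
      rw [hx, hx']
      exact Ext.comp_mk₀_id _)
    exact hτ _ _ (isExtension_of_hom_right hS₂ hS₁ hS b (by simpa using hb) hb')
  rw [cls_mul_cls, cls_mul_cls, map_smul, map_smul, map_smul, map_sum, map_sum, map_sum,
    Finset.sum_congr rfl fun x _ => hmid x,
    sum_comp_of_surjective φ hφ fun y => τ (Φ (HallAlgebra.cls (midTerm y))), smul_smul, smul_smul]
  congr 1
  rw [show (euler K N)⁻¹ = (euler L N)⁻¹ * euler M N by rw [he]; simp]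
  rw [Units.val_mul, Units.val_inv_eq_inv_val, euler_val, euler_val]
  have := card_hom_ne_zero M N
  have := card_hom_ne_zero L N
  have := card_ext_ne_zero M N
  have := card_ext_ne_zero L N
  field_simp

end HallProduct

end EulerForm

end

end ModifiedHall

namespace ModifiedHall

open Abelian HomologicalComplex

noncomputable section

attribute [local instance] HasExt.standard

variable {A : Type u} [Category.{v} A] [Abelian A]

/-! ### The Euler form on the Grothendieck group -/

section EulerK0

/-- An additive invariant of acyclic complexes factors through the Grothendieck group. -/
def AcyclicK0.lift {H : Type*} [AddCommGroup H] (f : AcyclicComplex A → H)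
    (hf : ∀ K₁ K₂ K₃ : AcyclicComplex A, IsExtension K₁.1 K₂.1 K₃.1 → f K₂ = f K₁ + f K₃) :
    AcyclicK0 A →+ H :=
  QuotientAddGroup.lift _ (FreeAbelianGroup.lift f) (by
    rw [AddSubgroup.closure_le]
    rintro _ ⟨K₁, K₂, K₃, a, b, w, hS, rfl⟩
    change FreeAbelianGroup.lift f _ = 0
    rw [map_sub, map_sub, FreeAbelianGroup.lift_apply_of, FreeAbelianGroup.lift_apply_of,
      FreeAbelianGroup.lift_apply_of, hf _ _ _ ⟨a, b, w, hS⟩]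
    abel)

@[simp]
lemma AcyclicK0.lift_cls {H : Type*} [AddCommGroup H] (f : AcyclicComplex A → H)
    (hf : ∀ K₁ K₂ K₃ : AcyclicComplex A, IsExtension K₁.1 K₂.1 K₃.1 → f K₂ = f K₁ + f K₃)
    (K : AcyclicComplex A) : AcyclicK0.lift f hf (AcyclicK0.cls K) = f K :=
  FreeAbelianGroup.lift_apply_of f K

lemma AcyclicK0.hom_ext {H : Type*} [AddCommGroup H] {f g : AcyclicK0 A →+ H}
    (h : ∀ K : AcyclicComplex A, f (AcyclicK0.cls K) = g (AcyclicK0.cls K)) : f = g := by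
  refine DFunLike.ext _ _ fun x => ?_
  obtain ⟨K, L, rfl⟩ := AcyclicK0.exists_eq_sub x
  rw [map_sub, map_sub, h, h]

variable [FinitaryHereditary A]

/-- The homomorphism `[K] ↦ |Hom(N, K)| / |Ext^1(N, K)|`. -/
def eulerRight (N : Z2Complex A) : AcyclicK0 A →+ Additive ℚˣ :=
  AcyclicK0.lift (fun K => Additive.ofMul (euler N K.1)) fun K₁ _ _ h => by
    rw [h.euler_right N (subsingleton_ext_to_acyclic N K₁.2), ofMul_mul]

lemma eulerRight_cls (N : Z2Complex A) (K : AcyclicComplex A) :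
    eulerRight N (AcyclicK0.cls K) = Additive.ofMul (euler N K.1) :=
  AcyclicK0.lift_cls _ _ K

/-- The homomorphism `[K] ↦ |Hom(K, N)| / |Ext^1(K, N)|`. -/
def eulerLeft (N : Z2Complex A) : AcyclicK0 A →+ Additive ℚˣ :=
  AcyclicK0.lift (fun K => Additive.ofMul (euler K.1 N)) fun _ _ K₃ h => by
    rw [h.euler_left N (subsingleton_ext_from_acyclic N K₃.2), ofMul_mul]

lemma eulerLeft_cls (N : Z2Complex A) (K : AcyclicComplex A) :
    eulerLeft N (AcyclicK0.cls K) = Additive.ofMul (euler K.1 N) :=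
  AcyclicK0.lift_cls _ _ K

/-- None of the three complexes has to be acyclic, because the acyclic second argument already makes
Ext² vanish. This is used for the middle terms of arbitrary extensions. -/
lemma IsExtension.eulerRight {K L M : Z2Complex A} (h : IsExtension K L M) :
    eulerRight L = eulerRight K + eulerRight M :=
  AcyclicK0.hom_ext fun P => by
    rw [AddMonoidHom.add_apply, eulerRight_cls, eulerRight_cls, eulerRight_cls,
      h.euler_left P.1 (subsingleton_ext_to_acyclic M P.2), ofMul_mul]

lemma eulerRight_of_isZero {N : Z2Complex A} (h : IsZero N) : eulerRight N = 0 := by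
  have := (isExtension_of_isZero h (Iso.refl N)).eulerRight
  rwa [left_eq_add] at this

lemma eulerRight_congr {M N : Z2Complex A} (e : M ≅ N) : eulerRight M = eulerRight N := by
  rw [(isExtension_of_isZero (Limits.isZero_zero _) e).eulerRight,
    eulerRight_of_isZero (Limits.isZero_zero _), zero_add]

variable (A) in
/-- The Euler form on the Grothendieck group of acyclic complexes. -/
def eulerForm : AcyclicK0 A →+ AcyclicK0 A →+ Additive ℚˣ :=
  AcyclicK0.lift (fun K => eulerRight K.1) fun _ _ _ h => h.eulerRight

lemma eulerForm_cls (K : AcyclicComplex A) : eulerForm A (AcyclicK0.cls K) = eulerRight K.1 :=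
  AcyclicK0.lift_cls _ _ K

lemma isEulerForm_eulerForm : IsEulerForm (eulerForm A) := fun K L => by
  rw [eulerForm_cls, eulerRight_cls]
  exact euler_val K.1 L.1

end EulerK0

/-! ### The action of the Hall algebra on the torus space -/

section Representation

variable (A) in
/-- The vector space with basis the Grothendieck group times the isomorphism classes of pairs of
homology objects. -/
abbrev TorusSpace : Type (max u v) := (AcyclicK0 A × IsoClass A × IsoClass A) →₀ ℚ

/-- The translation by an element of the Grothendieck group. -/
def shift (g : AcyclicK0 A) : TorusSpace A →ₗ[ℚ] TorusSpace A :=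
  Finsupp.lmapDomain ℚ ℚ (fun p => (g + p.1, p.2))

lemma shift_single (g : AcyclicK0 A) (p : AcyclicK0 A × IsoClass A × IsoClass A) (c : ℚ) :
    shift g (Finsupp.single p c) = Finsupp.single (g + p.1, p.2) c :=
  Finsupp.mapDomain_single

lemma shift_shift (g h : AcyclicK0 A) (x : TorusSpace A) :
    shift g (shift h x) = shift (g + h) x := by
  induction x using Finsupp.induction_linear with
  | zero => simp
  | add x y hx hy => rw [map_add, map_add, map_add, hx, hy]
  | single p c => rw [shift_single, shift_single, shift_single, add_assoc]

lemma shift_zero (x : TorusSpace A) : shift 0 x = x := by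
  induction x using Finsupp.induction_linear with
  | zero => simp
  | add x y hx hy => rw [map_add, hx, hy]
  | single p c => rw [shift_single, zero_add]

lemma shift_injective (g : AcyclicK0 A) : Function.Injective (shift g) :=
  Function.LeftInverse.injective (g := shift (-g)) fun x => by
    rw [shift_shift, neg_add_cancel, shift_zero]

/-- The degree of a complex. -/
def degree (M : Z2Complex A) : AcyclicK0 A × IsoClass A × IsoClass A := (defect M, homologyClass M)

lemma degree_congr {M N : Z2Complex A} (e : M ≅ N) : degree M = degree N :=
  Prod.ext (defect_congr e) (homologyClass_congr e)

lemma degree_stalk (p : IsoClass A × IsoClass A) : degree (stalkClass p).rep = (0, p) :=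
  Prod.ext (defect_stalk p) (homologyClass_stalk p)

/-- The linear map sending a complex to its degree. -/
def toTorusSpace : HallAlgebra (Z2Complex A) →ₗ[ℚ] TorusSpace A :=
  Finsupp.lmapDomain ℚ ℚ (fun x : IsoClass (Z2Complex A) => degree x.rep) ∘ₗ
    HallAlgebra.toFinsupp.toLinearMap

lemma toTorusSpace_cls (M : Z2Complex A) :
    toTorusSpace (HallAlgebra.cls M) = Finsupp.single (degree M) 1 := by
  rw [← degree_congr (IsoClass.repIso M)]
  exact (congrArg _ (HallAlgebra.toFinsupp_cls M)).trans Finsupp.mapDomain_single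

lemma IsExtension.acyclic_right {K L M : Z2Complex A} (h : IsExtension K L M) (hK : K.Acyclic)
    (hL : L.Acyclic) : M.Acyclic := by
  intro i
  obtain ⟨e⟩ := h.homologyIso_left hK i
  rw [exactAt_iff_isZero_homology]
  exact ((L.exactAt_iff_isZero_homology i).1 (hL i)).of_iso e.symm

lemma acyclic_contractibleHull (M : Z2Complex A) : (contractibleHull M).Acyclic :=
  acyclic_biprod (acyclic_contractible _ _) (acyclic_contractible _ _)

/-- Sums of stalk complexes have defect zero, so their translates are exactly the basis vectors. -/
lemma ext_shift {f g : Module.End ℚ (TorusSpace A)}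
    (h : ∀ (a : AcyclicK0 A) (d : IsoClass A × IsoClass A),
      f (shift a (toTorusSpace (HallAlgebra.cls (stalkClass d).rep))) =
        g (shift a (toTorusSpace (HallAlgebra.cls (stalkClass d).rep)))) : f = g := by
  refine LinearMap.ext fun x => ?_
  induction x using Finsupp.induction_linear with
  | zero => rw [map_zero, map_zero]
  | add x y hx hy => rw [map_add, map_add, hx, hy]
  | single p c =>
    have := h p.1 p.2
    rw [toTorusSpace_cls, degree_stalk, shift_single, add_zero] at this
    rw [← mul_one c, ← smul_eq_mul, ← Finsupp.smul_single, map_smul, map_smul]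
    exact congrArg (c • ·) this

/-- An extension by an acyclic complex and the corresponding direct sum embed in the same complex
with the same acyclic cokernel. -/
lemma exists_common_embedding {K L M : Z2Complex A} (h : IsExtension K L M) (hK : K.Acyclic) :
    ∃ P Q : Z2Complex A, Q.Acyclic ∧ IsExtension L P Q ∧ IsExtension (K ⊞ M) P Q := by
  obtain ⟨f, g, w, hS⟩ := h
  have : Mono f := hS.mono_f
  have := mono_contractibleHullMap L
  let ι := contractibleHullMap L
  have hQ := isExtension_cokernel (f ≫ ι)
  let π := cokernel.π (f ≫ ι)
  have hπ : f ≫ ι ≫ π = 0 := by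
    rw [← Category.assoc]
    exact cokernel.condition _
  obtain ⟨m, hm⟩ := exists_desc_of_shortExact hS (ι ≫ π) hπ
  have hT : (ShortComplex.mk (f ≫ ι) π (cokernel.condition _)).ShortExact :=
    { exact := ShortComplex.exact_of_g_is_cokernel _ (cokernelIsCokernel _) }
  -- With ι the embedding of `L` in its hull, `L` embeds in M ⊞ hull by (g, ι), and K ⊞ M by `f ≫ ι`
  -- on K and the identity on M. Both cokernels are hull / K, which is acyclic since the hull and
  -- `K` are.
  refine ⟨M ⊞ contractibleHull L, cokernel (f ≫ ι), hQ.acyclic_right hK (acyclic_contractibleHull L),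
    ⟨biprod.lift g ι, biprod.desc (-m) π, by simp [hm], ?_⟩, ?_⟩
  · refine shortExact_of_cokernel _ ?_ ?_ fun T x hx => ?_
    · exact mono_of_mono_fac (biprod.lift_snd g ι)
    · exact epi_of_epi_fac (biprod.inr_desc (-m) π)
    · have h₁ : g ≫ biprod.inl ≫ x + ι ≫ biprod.inr ≫ x = 0 := by
        rw [← hx, biprod.lift_eq]
        simp
      obtain ⟨y, hy⟩ := exists_desc_of_shortExact hT (biprod.inr ≫ x) (by
        have := congrArg (f ≫ ·) h₁
        simpa [reassoc_of% w] using this)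
      refine ⟨y, ?_⟩
      have := hS.epi_g
      apply biprod.hom_ext'
      · rw [biprod.inl_desc_assoc, ← cancel_epi g]
        rw [Preadditive.neg_comp, Preadditive.comp_neg, reassoc_of% hm, hy]
        exact (eq_neg_of_add_eq_zero_left h₁).symm
      · rw [biprod.inr_desc_assoc, hy]
  · exact ⟨_, _, _, shortExact_iso_comp (shortExact_biprod_map M hT) (biprod.braiding K M)⟩

variable [FinitaryHereditary A]

lemma toTorusSpace_left (K : AcyclicComplex A) {L M : Z2Complex A} (h : IsExtension K.1 L M) :
    toTorusSpace (HallAlgebra.cls L) =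
      shift (AcyclicK0.cls K) (toTorusSpace (HallAlgebra.cls M)) := by
  rw [toTorusSpace_cls, toTorusSpace_cls, shift_single, degree, h.defect_left,
    h.homologyClass_left K.2]
  rfl

lemma toTorusSpace_right (K : AcyclicComplex A) {L M : Z2Complex A} (h : IsExtension M L K.1) :
    toTorusSpace (HallAlgebra.cls L) =
      shift (AcyclicK0.cls K) (toTorusSpace (HallAlgebra.cls M)) := by
  rw [toTorusSpace_cls, toTorusSpace_cls, shift_single, degree, h.defect_right,
    h.homologyClass_right K.2]
  rfl

/-- Hall multiplication from the left by a complex, in terms of degrees. -/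
def actObj (N : Z2Complex A) : TorusSpace A →ₗ[ℚ] TorusSpace A :=
  Finsupp.linearCombination ℚ fun p => (((-eulerRight N p.1).toMul : ℚˣ) : ℚ) •
    shift p.1 (toTorusSpace (HallAlgebra.cls N * HallAlgebra.cls (stalkClass p.2).rep))

lemma actObj_single (N : Z2Complex A) (g : AcyclicK0 A) (d : IsoClass A × IsoClass A) :
    actObj N (Finsupp.single (g, d) 1) = (((-eulerRight N g).toMul : ℚˣ) : ℚ) •
      shift g (toTorusSpace (HallAlgebra.cls N * HallAlgebra.cls (stalkClass d).rep)) := by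
  rw [actObj, Finsupp.linearCombination_single, one_smul]

lemma actObj_congr {M N : Z2Complex A} (e : M ≅ N) : actObj M = actObj N := by
  rw [actObj, actObj, eulerRight_congr e, HallAlgebra.cls_eq_of_iso e]

lemma actObj_shift (N : Z2Complex A) (g : AcyclicK0 A) (x : TorusSpace A) :
    actObj N (shift g x) = (((-eulerRight N g).toMul : ℚˣ) : ℚ) • shift g (actObj N x) := by
  induction x using Finsupp.induction_linear with
  | zero => simp
  | add x y hx hy => simp only [map_add, hx, hy, smul_add]
  | single p c =>
    obtain ⟨h, d⟩ := p
    rw [← mul_one c, ← smul_eq_mul, ← Finsupp.smul_single, map_smul, map_smul, map_smul, map_smul,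
      shift_single, actObj_single, actObj_single, map_smul, shift_shift, map_add, neg_add,
      toMul_add, Units.val_mul, smul_smul, smul_smul, smul_smul]
    congr 1
    ring

lemma mul_stalk (N X M : Z2Complex A) (R : AcyclicComplex A) (h : IsExtension R.1 X M) :
    toTorusSpace (HallAlgebra.cls N * HallAlgebra.cls X) =
      (((-eulerRight N (AcyclicK0.cls R)).toMul : ℚˣ) : ℚ) • shift (AcyclicK0.cls R)
        (toTorusSpace (HallAlgebra.cls N * HallAlgebra.cls M)) := by
  rw [h.map_cls_mul_cls_right toTorusSpace (shift (AcyclicK0.cls R)) N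
    (subsingleton_ext_to_acyclic N R.2) fun E E' hE => toTorusSpace_left R hE, eulerRight_cls]
  rfl

/-- The definition of `actObj` only fixes the values on stalk sums. Computing the product of N with
the top X of a roof through each of its two legs carries the formula from the stalk sum to `M`,
since translations and nonzero scalars can be cancelled. -/
theorem actObj_toTorusSpace (N : Z2Complex A) (x : HallAlgebra (Z2Complex A)) :
    actObj N (toTorusSpace x) = toTorusSpace (HallAlgebra.cls N * x) := by
  induction x using HallAlgebra.induction with
  | h0 => simp
  | hadd x y hx hy => rw [map_add, map_add, hx, hy, mul_add, map_add]
  | hcls c M =>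
    rw [map_smul, map_smul, hall_mul_smul, map_smul]
    congr 1
    obtain ⟨X, R, R', h, h'⟩ := exists_stalk_roof M
    have e₁ := mul_stalk N X M R h
    have e₂ := mul_stalk N X _ R' h'
    have e₃ : toTorusSpace (HallAlgebra.cls X) = _ := toTorusSpace_left R h
    have e₄ : toTorusSpace (HallAlgebra.cls X) = _ := toTorusSpace_left R' h'
    have e₅ : actObj N (toTorusSpace (HallAlgebra.cls (stalkClass (homologyClass M)).rep)) =
        toTorusSpace (HallAlgebra.cls N * HallAlgebra.cls (stalkClass (homologyClass M)).rep) := by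
      rw [toTorusSpace_cls, degree_stalk, actObj_single, map_zero, neg_zero, toMul_zero,
        Units.val_one, one_smul, shift_zero]
    have e₆ := congrArg (actObj N) (e₃.symm.trans e₄)
    rw [actObj_shift, actObj_shift, e₅, ← e₂, e₁] at e₆
    exact shift_injective _ (smul_right_injective _ (Units.ne_zero _) e₆)

/-- Hall multiplication from the left in terms of degrees. -/
def act : HallAlgebra (Z2Complex A) →ₗ[ℚ] Module.End ℚ (TorusSpace A) :=
  Finsupp.linearCombination ℚ (fun x : IsoClass (Z2Complex A) => actObj x.rep) ∘ₗ
    HallAlgebra.toFinsupp.toLinearMap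

lemma act_cls (M : Z2Complex A) : act (HallAlgebra.cls M) = actObj M := by
  rw [← actObj_congr (IsoClass.repIso M)]
  refine (congrArg _ (HallAlgebra.toFinsupp_cls M)).trans ?_
  exact (Finsupp.linearCombination_single _ _ _).trans (one_smul _ _)

theorem act_toTorusSpace (x y : HallAlgebra (Z2Complex A)) :
    act x (toTorusSpace y) = toTorusSpace (x * y) := by
  induction x using HallAlgebra.induction with
  | h0 => simp
  | hadd x x' hx hx' => rw [map_add, LinearMap.add_apply, hx, hx', add_mul, map_add]
  | hcls c M =>
    rw [map_smul, LinearMap.smul_apply, act_cls, actObj_toTorusSpace, hall_smul_mul, map_smul]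

/-- All middle terms in the product twist translations by the same scalar, since the Euler form is
additive on extensions. -/
lemma act_cls_mul_cls_shift (M N : Z2Complex A) (g : AcyclicK0 A) (x : TorusSpace A) :
    act (HallAlgebra.cls M * HallAlgebra.cls N) (shift g x) =
      (((-(eulerRight M + eulerRight N) g).toMul : ℚˣ) : ℚ) •
        shift g (act (HallAlgebra.cls M * HallAlgebra.cls N) x) := by
  have := Fintype.ofFinite (ExtGroup M N 1)
  simp only [cls_mul_cls, map_smul, map_sum, LinearMap.smul_apply, LinearMap.sum_apply, act_cls]
  simp only [Finset.smul_sum]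
  refine Finset.sum_congr rfl fun e _ => ?_
  rw [smul_comm]
  refine congrArg _ ?_
  obtain ⟨f, p, w, hS, -⟩ := exists_midTerm e
  have h : eulerRight (midTerm e) = eulerRight N + eulerRight M :=
    IsExtension.eulerRight ⟨f, p, w, hS⟩
  rw [actObj_shift, h, add_comm]

/-- For classes, both sides commute with translations up to the same scalar, so they only have to
agree on the images of stalk sums, where the action is Hall multiplication and associativity
applies. -/
theorem act_mul (x y : HallAlgebra (Z2Complex A)) : act (x * y) = act x * act y := by
  induction x using HallAlgebra.induction with
  | h0 => simp
  | hadd x x' hx hx' => rw [add_mul, map_add, hx, hx', map_add, add_mul]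
  | hcls c M =>
    induction y using HallAlgebra.induction with
    | h0 => simp
    | hadd y y' hy hy' => rw [mul_add, map_add, hy, hy', map_add, mul_add]
    | hcls c' N =>
      rw [hall_smul_mul, hall_mul_smul, map_smul, map_smul, map_smul, map_smul, smul_mul_assoc,
        mul_smul_comm]
      congr 2
      refine ext_shift fun a d => ?_
      rw [act_cls_mul_cls_shift, Module.End.mul_apply, act_cls N, actObj_shift, map_smul, act_cls,
        actObj_shift, ← act_cls, ← act_cls, act_toTorusSpace, act_toTorusSpace, act_toTorusSpace,
        hall_mul_assoc, smul_smul, AddMonoidHom.add_apply, neg_add, toMul_add, Units.val_mul,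
        mul_comm]

lemma act_one : act (HallAlgebra.cls (0 : Z2Complex A)) = 1 := by
  refine ext_shift fun a d => ?_
  rw [act_cls, actObj_shift, ← act_cls, act_toTorusSpace, hall_one_mul,
    eulerRight_of_isZero (Limits.isZero_zero _)]
  simp

/-- For the left factor of a product, the Ext² argument needs an acyclic quotient, not an acyclic
subobject. Embedding both complexes in one P with the same acyclic cokernel puts them in that
position. -/
theorem toTorusSpace_mul_of_isExtension {K L M : Z2Complex A} (h : IsExtension K L M)
    (hK : K.Acyclic) (N : Z2Complex A) :
    toTorusSpace (HallAlgebra.cls L * HallAlgebra.cls N) =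
      toTorusSpace (HallAlgebra.cls (K ⊞ M) * HallAlgebra.cls N) := by
  obtain ⟨P, Q, hQ, h₁, h₂⟩ := exists_common_embedding h hK
  have key {L : Z2Complex A} (h : IsExtension L P Q) :=
    h.map_cls_mul_cls_left toTorusSpace (shift (AcyclicK0.cls ⟨Q, hQ⟩)) N
      (subsingleton_ext_from_acyclic N hQ) fun E E' hE => toTorusSpace_right ⟨Q, hQ⟩ hE
  exact shift_injective _ (smul_right_injective _ (Units.ne_zero _) ((key h₁).symm.trans (key h₂)))

theorem act_of_isExtension {K L M : Z2Complex A} (h : IsExtension K L M) (hK : K.Acyclic) :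
    act (HallAlgebra.cls L) = act (HallAlgebra.cls (K ⊞ M)) := by
  refine ext_shift fun a d => ?_
  rw [act_cls, act_cls, actObj_shift, actObj_shift, ← act_cls, ← act_cls, act_toTorusSpace,
    act_toTorusSpace, toTorusSpace_mul_of_isExtension h hK, h.eulerRight,
    (isExtension_biprod K M).eulerRight]

/-- As `K` is an extension of itself by 0, its product with a stalk sum reduces to [0] times that
sum, up to translation and scalar. The operator is thus monomial, which makes it invertible. -/
lemma act_acyclic_single (K : AcyclicComplex A) (g : AcyclicK0 A) (d : IsoClass A × IsoClass A) :
    act (HallAlgebra.cls K.1) (Finsupp.single (g, d) 1) =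
      (((-(eulerRight K.1 g + eulerLeft (stalkClass d).rep (AcyclicK0.cls K))).toMul : ℚˣ) : ℚ) •
        Finsupp.single (g + AcyclicK0.cls K, d) 1 := by
  have h : IsExtension (0 : Z2Complex A) K.1 K.1 :=
    isExtension_of_isZero (Limits.isZero_zero _) (Iso.refl _)
  have e := h.map_cls_mul_cls_left toTorusSpace (shift (AcyclicK0.cls K)) (stalkClass d).rep
    (subsingleton_ext_from_acyclic _ K.2) fun E E' hE => toTorusSpace_right K hE
  rw [hall_one_mul, toTorusSpace_cls, degree_stalk] at e
  rw [act_cls, actObj_single, e, map_smul, shift_shift, shift_single, add_zero, smul_smul, neg_add,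
    toMul_add, Units.val_mul, eulerLeft_cls]
  rfl

end Representation

end

end ModifiedHall

namespace ModifiedHall

open Abelian HomologicalComplex

noncomputable section

attribute [local instance] HasExt.standard

/-! ### The kernel of the map to the torus space -/

section IsoClassMonoid

variable {C : Type u} [Category.{v} C] [Abelian C]

instance : Zero (IsoClass C) := ⟨IsoClass.mk 0⟩

instance : Add (IsoClass C) :=
  ⟨Quotient.map₂ (fun X Y => X ⊞ Y) fun _ _ h _ _ h' =>
    h.elim fun e => h'.elim fun e' => ⟨biprod.mapIso e e'⟩⟩

instance : AddCommMonoid (IsoClass C) where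
  add_assoc x y z := by
    induction x using Quotient.inductionOn
    induction y using Quotient.inductionOn
    induction z using Quotient.inductionOn
    exact Quotient.sound (s := isIsomorphicSetoid C) ⟨biprod.associator _ _ _⟩
  zero_add x := by
    induction x using Quotient.inductionOn
    exact Quotient.sound (s := isIsomorphicSetoid C)
      ⟨(isoZeroBiprod (Limits.isZero_zero C)).symm⟩
  add_zero x := by
    induction x using Quotient.inductionOn
    exact Quotient.sound (s := isIsomorphicSetoid C)
      ⟨(isoBiprodZero (Limits.isZero_zero C)).symm⟩
  add_comm x y := by
    induction x using Quotient.inductionOn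
    induction y using Quotient.inductionOn
    exact Quotient.sound (s := isIsomorphicSetoid C) ⟨biprod.braiding _ _⟩
  nsmul := nsmulRec

lemma IsoClass.mk_biprod (X Y : C) :
    IsoClass.mk (X ⊞ Y) = IsoClass.mk X + IsoClass.mk Y := rfl

lemma IsoClass.mk_zero : IsoClass.mk (0 : C) = 0 := rfl

lemma IsExtension.biprod {K L M : C} (h : IsExtension K L M) (N : C) :
    IsExtension K (L ⊞ N) (M ⊞ N) := by
  obtain ⟨f, g, w, hS⟩ := h
  have := hS.mono_f
  have := hS.epi_g
  refine ⟨f ≫ biprod.inl, biprod.map g (𝟙 N), by simp [reassoc_of% w],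
    shortExact_of_kernel _ (mono_comp _ _) inferInstance fun T x hx => ?_⟩
  have h₁ : (x ≫ biprod.fst) ≫ g = 0 := by simpa using hx =≫ biprod.fst
  have h₂ : x ≫ biprod.snd = 0 := by simpa using hx =≫ biprod.snd
  obtain ⟨y, hy⟩ := exists_lift_of_shortExact hS _ h₁
  exact ⟨y, by ext <;> simp [reassoc_of% hy, h₂]⟩

/-- The congruence on isomorphism classes that identifies the classes which take the same value
under `f` after the addition of an arbitrary class. -/
def stableCon {H : Type*} (f : IsoClass C → H) : AddCon (IsoClass C) where
  r x y := ∀ z, f (x + z) = f (y + z)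
  iseqv := ⟨fun _ _ => rfl, fun h z => (h z).symm, fun h h' z => (h z).trans (h' z)⟩
  add' {x y z w} h h' t := by
    rw [add_assoc, h, ← add_assoc, add_comm y, add_assoc, h', ← add_assoc, add_comm w]

end IsoClassMonoid

variable {A : Type u} [Category.{v} A] [Abelian A] [FinitaryHereditary A]

section Relations

variable (A) in
/-- The ideal `hallIdeal` as a subspace. -/
def hallRelations : Submodule ℚ (HallAlgebra (Z2Complex A)) where
  carrier := {x | x ∈ hallIdeal A}
  add_mem' := (hallIdeal A).add_mem
  zero_mem' := (hallIdeal A).zero_mem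
  smul_mem' c x hx := by
    -- Scaling by c is multiplication by c[0], so a two-sided ideal is a subspace.
    have := (hallIdeal A).mul_mem_left (c • HallAlgebra.cls 0) x hx
    rwa [hall_smul_mul, hall_one_mul] at this

lemma toHallQuotient_eq_iff {x y : HallAlgebra (Z2Complex A)} :
    toHallQuotient x = toHallQuotient y ↔ x - y ∈ hallRelations A :=
  (RingCon.eq _).trans (TwoSidedIdeal.rel_iff _ x y)

lemma sub_mem_hallRelations {K L M : Z2Complex A} (h : IsExtension K L M) (hK : K.Acyclic) :
    HallAlgebra.cls L - HallAlgebra.cls (K ⊞ M) ∈ hallRelations A := by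
  obtain ⟨f, g, w, hS⟩ := h
  exact TwoSidedIdeal.subset_span ⟨ShortComplex.mk f g w, hS, hK, rfl⟩

/-- Every middle term of an extension of `M` by `K` is identified with K ⊞ M by the ideal, so the
product is |Ext¹| / |Hom| times a single class. -/
lemma mul_cls_sub_mem_hallRelations (M : Z2Complex A) {K : Z2Complex A} (hK : K.Acyclic) :
    HallAlgebra.cls M * HallAlgebra.cls K -
      (((euler M K)⁻¹ : ℚˣ) : ℚ) • HallAlgebra.cls (K ⊞ M) ∈ hallRelations A := by
  have := Fintype.ofFinite (ExtGroup M K 1)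
  have e : (((euler M K)⁻¹ : ℚˣ) : ℚ) • HallAlgebra.cls (K ⊞ M) =
      (Nat.card (M ⟶ K) : ℚ)⁻¹ • ∑ e : ExtGroup M K 1, HallAlgebra.cls (K ⊞ M) := by
    rw [Finset.sum_const, ← Nat.cast_smul_eq_nsmul ℚ, smul_smul, Units.val_inv_eq_inv_val,
      euler_val, inv_div, div_eq_inv_mul, Finset.card_univ,
      Nat.card_eq_fintype_card (α := ExtGroup M K 1)]
  rw [e, cls_mul_cls, ← smul_sub, ← Finset.sum_sub_distrib]
  refine Submodule.smul_mem _ _ (Submodule.sum_mem _ fun e _ => ?_)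
  obtain ⟨f, p, w, hS, -⟩ := exists_midTerm e
  exact sub_mem_hallRelations ⟨f, p, w, hS⟩ hK

lemma mul_mem_hallRelations_left (x : HallAlgebra (Z2Complex A)) {y : HallAlgebra (Z2Complex A)}
    (h : y ∈ hallRelations A) : x * y ∈ hallRelations A := (hallIdeal A).mul_mem_left x y h

lemma mul_mem_hallRelations_right {x : HallAlgebra (Z2Complex A)} (h : x ∈ hallRelations A)
    (y : HallAlgebra (Z2Complex A)) : x * y ∈ hallRelations A := (hallIdeal A).mul_mem_right x y h

end Relations

section Stable

variable (A) in
/-- The commutative monoid of isomorphism classes up to the relations of the modified Hall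
algebra. -/
def StableMonoid : Type (max u v) :=
  (stableCon fun x : IsoClass (Z2Complex A) =>
    (hallRelations A).mkQ (HallAlgebra.cls x.rep)).Quotient

instance : AddCommMonoid (StableMonoid A) :=
  inferInstanceAs (AddCommMonoid (stableCon fun x : IsoClass (Z2Complex A) =>
    (hallRelations A).mkQ (HallAlgebra.cls x.rep)).Quotient)

/-- The class of a complex in the stable monoid. -/
def stableClass : IsoClass (Z2Complex A) →+ StableMonoid A := AddCon.mk' _

lemma sub_mem_of_stableClass_eq {M N : Z2Complex A}
    (h : stableClass (IsoClass.mk M) = stableClass (IsoClass.mk N)) :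
    HallAlgebra.cls M - HallAlgebra.cls N ∈ hallRelations A := by
  have : (hallRelations A).mkQ (HallAlgebra.cls (IsoClass.mk M + 0).rep) =
      (hallRelations A).mkQ (HallAlgebra.cls (IsoClass.mk N + 0).rep) := (AddCon.eq _).1 h 0
  rw [add_zero, add_zero, HallAlgebra.cls_eq_of_iso (IsoClass.repIso M),
    HallAlgebra.cls_eq_of_iso (IsoClass.repIso N)] at this
  exact (Submodule.Quotient.eq _).1 this

/-- Adding N to the two right-hand terms of the sequence leaves the acyclic subobject unchanged, so
the relation persists after any direct sum. -/
lemma IsExtension.stableClass {K L M : Z2Complex A} (h : IsExtension K L M) (hK : K.Acyclic) :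
    stableClass (IsoClass.mk L) = stableClass (IsoClass.mk K) + stableClass (IsoClass.mk M) := by
  rw [← map_add, ← IsoClass.mk_biprod]
  refine (AddCon.eq _).2 fun z => ?_
  obtain ⟨N, rfl⟩ : ∃ N, IsoClass.mk N = z := ⟨z.rep, IsoClass.mk_rep z⟩
  change (hallRelations A).mkQ (HallAlgebra.cls (IsoClass.mk (L ⊞ N)).rep) =
    (hallRelations A).mkQ (HallAlgebra.cls (IsoClass.mk ((K ⊞ M) ⊞ N)).rep)
  rw [HallAlgebra.cls_eq_of_iso (IsoClass.repIso (L ⊞ N)),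
    HallAlgebra.cls_eq_of_iso (IsoClass.repIso ((K ⊞ M) ⊞ N)),
    HallAlgebra.cls_eq_of_iso (biprod.associator K M N)]
  refine (Submodule.Quotient.eq _).2 (sub_mem_hallRelations (h.biprod N) hK)

variable (A) in
/-- The classes of the acyclic complexes in the stable monoid. -/
def acyclicStable : AddSubmonoid (StableMonoid A) where
  carrier := {x | ∃ K : AcyclicComplex A, stableClass (IsoClass.mk K.1) = x}
  add_mem' := by
    rintro _ _ ⟨K, rfl⟩ ⟨L, rfl⟩
    exact ⟨⟨K.1 ⊞ L.1, acyclic_biprod K.2 L.2⟩, by rw [IsoClass.mk_biprod, map_add]⟩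
  zero_mem' := ⟨⟨0, acyclic_of_isZero _ (Limits.isZero_zero _)⟩, by
    rw [IsoClass.mk_zero, map_zero]⟩

/-- The class of a complex after the classes of the acyclic complexes are inverted. -/
def localClass (M : Z2Complex A) : AddLocalization (acyclicStable A) :=
  AddLocalization.addMonoidOf (acyclicStable A) (stableClass (IsoClass.mk M))

lemma IsExtension.localClass {K L M : Z2Complex A} (h : IsExtension K L M) (hK : K.Acyclic) :
    localClass L = localClass K + localClass M := by
  rw [ModifiedHall.localClass, h.stableClass hK, map_add]
  rfl

/-- The class of an acyclic complex, as an invertible element. -/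
def acyclicUnit (K : AcyclicComplex A) : AddUnits (AddLocalization (acyclicStable A)) :=
  ((AddLocalization.addMonoidOf (acyclicStable A)).map_addUnits
    ⟨stableClass (IsoClass.mk K.1), K, rfl⟩).addUnit

variable (A) in
/-- The homomorphism from the Grothendieck group given by the classes of acyclic complexes. -/
def localUnit : AcyclicK0 A →+ AddUnits (AddLocalization (acyclicStable A)) :=
  AcyclicK0.lift (H := AddUnits (AddLocalization (acyclicStable A))) acyclicUnit fun K₁ _ _ h =>
    AddUnits.ext (h.localClass K₁.2)

lemma localUnit_cls (K : AcyclicComplex A) :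
    (localUnit A (AcyclicK0.cls K) : AddLocalization (acyclicStable A)) = localClass K.1 :=
  congrArg AddUnits.val (AcyclicK0.lift_cls _ _ K)

/-- A roof gives [R] + [M] = [R'] + [stalk sum] with [R] and [R'] invertible, and the defect of `M`
is [R'] - [R]. -/
lemma localClass_eq (M : Z2Complex A) :
    localClass M = localUnit A (defect M) + localClass (stalkClass (homologyClass M)).rep := by
  obtain ⟨X, R, R', h, h'⟩ := exists_stalk_roof M
  have e₁ := h.localClass R.2
  rw [h'.localClass R'.2] at e₁
  have e₂ := h.defect_left (K := R)
  rw [h'.defect_left (K := R'), defect_stalk, add_zero] at e₂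
  rw [← localUnit_cls, ← localUnit_cls, e₂, map_add, AddUnits.val_add, add_assoc] at e₁
  exact ((AddUnits.add_right_inj _).1 e₁).symm

lemma eulerRight_eq (M : Z2Complex A) :
    eulerRight M =
      eulerForm A (defect M) + eulerRight (stalkClass (homologyClass M)).rep := by
  obtain ⟨X, R, R', h, h'⟩ := exists_stalk_roof M
  have e₁ := h.eulerRight
  rw [h'.eulerRight] at e₁
  have e₂ := h.defect_left (K := R)
  rw [h'.defect_left (K := R'), defect_stalk, add_zero] at e₂
  rw [← eulerForm_cls, ← eulerForm_cls, e₂, map_add, add_assoc] at e₁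
  exact (add_left_cancel e₁).symm

/-- Complexes of the same degree become equal in the Hall quotient after multiplication by some
acyclic complex. -/
theorem exists_sub_mul_mem_of_degree_eq {M N : Z2Complex A} (h : degree M = degree N) :
    ∃ K : AcyclicComplex A,
      (HallAlgebra.cls M - HallAlgebra.cls N) * HallAlgebra.cls K.1 ∈ hallRelations A := by
  have h₁ : defect M = defect N := congrArg Prod.fst h
  have h₂ : homologyClass M = homologyClass N := congrArg Prod.snd h
  -- Two things depend only on the degree: the localized class, so that K ⊞ M and K ⊞ N agree in the
  -- quotient for some acyclic K, and the Euler form against K, so that the scalars in the products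
  -- with [K] agree too.
  have e : localClass M = localClass N := by rw [localClass_eq M, localClass_eq N, h₁, h₂]
  have e' : eulerRight M = eulerRight N := by rw [eulerRight_eq M, eulerRight_eq N, h₁, h₂]
  obtain ⟨⟨_, K, rfl⟩, hK⟩ := (AddLocalization.addMonoidOf (acyclicStable A)).eq_iff_exists.1 e
  refine ⟨K, ?_⟩
  have e'' : euler M K.1 = euler N K.1 := by
    have := eulerRight_cls M K
    rw [e', eulerRight_cls] at this
    exact (Additive.ofMul.injective this).symm
  have hM := mul_cls_sub_mem_hallRelations M K.2
  have hN := mul_cls_sub_mem_hallRelations N K.2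
  rw [← map_add, ← map_add, ← IsoClass.mk_biprod, ← IsoClass.mk_biprod] at hK
  have hMN := Submodule.smul_mem _ (((euler N K.1)⁻¹ : ℚˣ) : ℚ) (sub_mem_of_stableClass_eq hK)
  rw [e''] at hM
  have := Submodule.add_mem _ (Submodule.sub_mem _ hM hN) hMN
  rw [sub_mul]
  convert this using 1
  rw [smul_sub]
  abel

end Stable

section Kernel

variable (A) in
/-- The elements of the Hall algebra annihilated by an acyclic complex in the Hall quotient. -/
def acyclicTorsion : Submodule ℚ (HallAlgebra (Z2Complex A)) where
  carrier := {x | ∃ K : AcyclicComplex A, x * HallAlgebra.cls K.1 ∈ hallRelations A}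
  zero_mem' := ⟨⟨0, acyclic_of_isZero _ (Limits.isZero_zero _)⟩, by
    rw [zero_mul]; exact Submodule.zero_mem _⟩
  smul_mem' := by
    rintro c x ⟨K, hK⟩
    exact ⟨K, by rw [hall_smul_mul]; exact Submodule.smul_mem _ _ hK⟩
  add_mem' := by
    -- The product [K][L] is a nonzero multiple of [L ⊞ K] modulo the ideal, so an element killed by
    -- `K` is killed by L ⊞ K; this gives two elements a common annihilator.
    have key (x : HallAlgebra (Z2Complex A)) (K L : AcyclicComplex A)
        (hx : x * HallAlgebra.cls K.1 ∈ hallRelations A) :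
        x * HallAlgebra.cls (L.1 ⊞ K.1) ∈ hallRelations A := by
      have h := mul_mem_hallRelations_left x (mul_cls_sub_mem_hallRelations K.1 L.2)
      rw [mul_sub, ← hall_mul_assoc, Submodule.sub_mem_iff_right _
        (mul_mem_hallRelations_right hx _), hall_mul_smul] at h
      exact (Submodule.smul_mem_iff _ (Units.ne_zero _)).1 h
    rintro x y ⟨K, hK⟩ ⟨L, hL⟩
    refine ⟨⟨L.1 ⊞ K.1, acyclic_biprod L.2 K.2⟩, ?_⟩
    rw [add_mul]
    refine Submodule.add_mem _ (key x K L hK) ?_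
    rw [HallAlgebra.cls_eq_of_iso (biprod.braiding L.1 K.1)]
    exact key y L K hL

/-- The map to the torus space is injective up to torsion. -/
theorem mem_acyclicTorsion {x : HallAlgebra (Z2Complex A)} (hx : toTorusSpace x = 0) :
    x ∈ acyclicTorsion A := by
  classical
  -- Choose one complex for each degree that occurs. Modulo torsion, `x` is then recovered linearly
  -- from its image in the torus space.
  let σ : AcyclicK0 A × IsoClass A × IsoClass A → Z2Complex A := fun p =>
    if h : ∃ M, degree M = p then h.choose else 0
  have hσ (M : Z2Complex A) : degree (σ (degree M)) = degree M := by
    have h : ∃ N, degree N = degree M := ⟨M, rfl⟩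
    rw [show σ (degree M) = h.choose from dif_pos h]
    exact h.choose_spec
  let s : TorusSpace A →ₗ[ℚ] HallAlgebra (Z2Complex A) :=
    Finsupp.linearCombination ℚ fun p => HallAlgebra.cls (σ p)
  have key : x - s (toTorusSpace x) ∈ acyclicTorsion A := by
    clear hx
    induction x using HallAlgebra.induction with
    | h0 => simp
    | hadd x y hx hy =>
      rw [map_add, map_add, add_sub_add_comm]
      exact Submodule.add_mem _ hx hy
    | hcls c M =>
      rw [map_smul, map_smul, ← smul_sub, toTorusSpace_cls,
        show s (Finsupp.single (degree M) 1) = HallAlgebra.cls (σ (degree M)) from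
          (Finsupp.linearCombination_single _ _ _).trans (one_smul _ _)]
      exact Submodule.smul_mem _ _ (exists_sub_mul_mem_of_degree_eq (hσ M).symm)
  rwa [hx, map_zero, sub_zero] at key

end Kernel

end

end ModifiedHall

namespace ModifiedHall

open Abelian HomologicalComplex

noncomputable section

attribute [local instance] HasExt.standard

/-! ### The universal inverting ring and right fractions -/

namespace InvertingRing

variable {Q : Type*} [NonUnitalNonAssocRing Q] {e : Q} {S : Set Q} {R : Type*} [Ring R]

lemma of_one : of e S e = 1 :=
  (RingQuot.mkAlgHom_rel ℤ (InvertRel.one (e := e) (S := S))).trans (map_one _)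

/-- The adjoined inverse of an element of `S`. -/
def inv (s : S) : InvertingRing e S :=
  RingQuot.mkAlgHom ℤ (InvertRel e S) (FreeAlgebra.ι ℤ (Sum.inr s))

lemma of_mul_inv (s : S) : of e S s * inv s = 1 := by
  have := RingQuot.mkAlgHom_rel ℤ (InvertRel.mul_inv (e := e) s)
  rw [map_mul, map_one] at this
  exact this

lemma inv_mul_of (s : S) : inv s * of e S s = 1 := by
  have := RingQuot.mkAlgHom_rel ℤ (InvertRel.inv_mul (e := e) s)
  rw [map_mul, map_one] at this
  exact this

lemma isUnit_of {s : Q} (hs : s ∈ S) : IsUnit (of e S s) :=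
  ⟨⟨of e S s, inv ⟨s, hs⟩, of_mul_inv ⟨s, hs⟩, inv_mul_of ⟨s, hs⟩⟩, rfl⟩

/-- The ring is generated by the images of `Q` and the adjoined inverses, and `J` is stable under
left multiplication by these generators. -/
theorem mem_of_closed (J : AddSubgroup (InvertingRing e S)) (h1 : 1 ∈ J)
    (hof : ∀ a, ∀ j ∈ J, of e S a * j ∈ J) (hinv : ∀ s : S, ∀ j ∈ J, inv s * j ∈ J)
    (r : InvertingRing e S) : r ∈ J := by
  let π : FreeAlgebra ℤ (Q ⊕ S) →+* InvertingRing e S :=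
    (RingQuot.mkAlgHom ℤ (InvertRel e S)).toRingHom
  obtain ⟨x, rfl⟩ : ∃ x, π x = r := RingQuot.mkAlgHom_surjective ℤ (InvertRel e S) r
  suffices ∀ j ∈ J, π x * j ∈ J by simpa using this 1 h1
  induction x using FreeAlgebra.induction with
  | grade0 n =>
    intro j hj
    have : π (algebraMap ℤ _ n) = (n : InvertingRing e S) := by
      rw [eq_intCast (algebraMap ℤ (FreeAlgebra ℤ (Q ⊕ S))) n, map_intCast]
    rw [this, ← zsmul_eq_mul]
    exact J.zsmul_mem hj n
  | grade1 x =>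
    rcases x with a | s
    · exact hof a
    · exact hinv s
  | mul x y hx hy =>
    intro j hj
    rw [map_mul, mul_assoc]
    exact hx _ (hy j hj)
  | add x y hx hy =>
    intro j hj
    rw [map_add, add_mul]
    exact J.add_mem (hx j hj) (hy j hj)

/-- The universal property of the universal `S`-inverting ring. -/
def lift (f : Q →ₙ+* R) (h1 : f e = 1) (hS : ∀ s : S, IsUnit (f s)) : InvertingRing e S →+* R :=
  (RingQuot.liftAlgHom ℤ (s := InvertRel e S)
    ⟨FreeAlgebra.lift ℤ (Sum.elim f fun s => (((hS s).unit⁻¹ : Rˣ) : R)), by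
      intro x y h
      induction h with
      | add a b => simp
      | mul a b => simp
      | one => simp [h1]
      | mul_inv s => simp
      | inv_mul s => simp⟩).toRingHom

lemma lift_of (f : Q →ₙ+* R) (h1 : f e = 1) (hS : ∀ s : S, IsUnit (f s)) (a : Q) :
    lift f h1 hS (of e S a) = f a := by
  refine (RingQuot.liftAlgHom_mkAlgHom_apply ℤ _ _ _).trans ?_
  rw [FreeAlgebra.lift_ι_apply]
  rfl

/-- The right fractions contain 1 and are stable under addition and left multiplication by the
generators. The Ore condition is required only after localization, where it can be checked in the
torus space. -/
theorem exists_mul_of_eq_of (he : e ∈ S) (hmul : ∀ s ∈ S, ∀ t ∈ S, s * t ∈ S)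
    (hore : ∀ a, ∀ s ∈ S, ∃ b, of e S a * of e S s = of e S s * of e S b)
    (r : InvertingRing e S) : ∃ a, ∃ s ∈ S, r * of e S s = of e S a := by
  let J : AddSubgroup (InvertingRing e S) :=
    { carrier := {r | ∃ a, ∃ s ∈ S, r * of e S s = of e S a}
      zero_mem' := ⟨0, e, he, by rw [zero_mul, map_zero]⟩
      neg_mem' := by
        rintro r ⟨a, s, hs, h⟩
        exact ⟨-a, s, hs, by rw [neg_mul, h, map_neg]⟩
      add_mem' := by
        rintro r r' ⟨a, s, hs, h⟩ ⟨a', s', hs', h'⟩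
        -- From s's = sy in the localized ring, s's is a common denominator: rs = a and r's' = a'
        -- give (r + r')s's = ay + a's.
        obtain ⟨y, hy⟩ := hore s' s hs
        refine ⟨a * y + a' * s, s' * s, hmul _ hs' _ hs, ?_⟩
        rw [map_add, map_mul, map_mul, map_mul, add_mul]
        congr 1
        · rw [hy, ← mul_assoc, h]
        · rw [← mul_assoc, h'] }
  refine mem_of_closed J ⟨e, e, he, by rw [one_mul]⟩ ?_ ?_ r
  · rintro b j ⟨a, s, hs, h⟩
    exact ⟨b * a, s, hs, by rw [mul_assoc, h, map_mul]⟩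
  · rintro t j ⟨a, s, hs, h⟩
    obtain ⟨y, hy⟩ := hore a t t.2
    refine ⟨y, s * t, hmul _ hs _ t.2, ?_⟩
    rw [map_mul, mul_assoc, ← mul_assoc j, h, hy, ← mul_assoc, inv_mul_of, one_mul]

end InvertingRing

lemma isExtension_right_of_isZero {C : Type*} [Category* C] [Abelian C] {X Y Z : C} (h : IsZero Z)
    (e : X ≅ Y) : IsExtension X Y Z :=
  ⟨e.hom, 0, comp_zero, shortExact_of_kernel _ inferInstance ⟨fun _ _ _ => h.eq_of_src _ _⟩
    fun _ x _ => ⟨x ≫ e.inv, by simp⟩⟩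

lemma isUnit_of_monomial {ι : Type*} {f : Module.End ℚ (ι →₀ ℚ)} (σ : ι ≃ ι) (c : ι → ℚˣ)
    (h : ∀ i, f (Finsupp.single i 1) = (c i : ℚ) • Finsupp.single (σ i) 1) : IsUnit f := by
  let g : Module.End ℚ (ι →₀ ℚ) := Finsupp.linearCombination ℚ fun i =>
    (((c (σ.symm i))⁻¹ : ℚˣ) : ℚ) • Finsupp.single (σ.symm i) 1
  have hg (i : ι) : g (Finsupp.single i 1) =
      (((c (σ.symm i))⁻¹ : ℚˣ) : ℚ) • Finsupp.single (σ.symm i) 1 :=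
    (Finsupp.linearCombination_single _ _ _).trans (one_smul _ _)
  have ext {a b : Module.End ℚ (ι →₀ ℚ)} (h : ∀ i, a (Finsupp.single i 1) = b (Finsupp.single i 1)) :
      a = b := Finsupp.basisSingleOne.ext fun i => by simpa using h i
  refine ⟨⟨f, g, ext fun i => ?_, ext fun i => ?_⟩, rfl⟩
  · rw [Module.End.mul_apply, hg, map_smul, h, smul_smul, Units.inv_mul, Equiv.apply_symm_apply,
      one_smul, Module.End.one_apply]
  · rw [Module.End.mul_apply, h, map_smul, hg, smul_smul, Equiv.symm_apply_apply, Units.mul_inv,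
      one_smul, Module.End.one_apply]

variable {A : Type u} [Category.{v} A] [Abelian A]

/-- The canonical map from the Hall algebra to the modified Hall algebra. -/
def toModified : HallAlgebra (Z2Complex A) →ₙ+* ModifiedHallAlgebra A where
  toFun x := toModifiedHall A (toHallQuotient x)
  map_zero' := map_zero (toModifiedHall A)
  map_add' x y := map_add (toModifiedHall A) (toHallQuotient x) (toHallQuotient y)
  map_mul' x y := map_mul (toModifiedHall A) (toHallQuotient x) (toHallQuotient y)

lemma toModified_cls (M : Z2Complex A) : toModified (HallAlgebra.cls M) = mhClass M := rfl

lemma isUnit_toModified {q : ℚ} (hq : q ≠ 0) (K : AcyclicComplex A) :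
    IsUnit (toModified (q • HallAlgebra.cls K.1)) :=
  InvertingRing.isUnit_of ⟨q, K.1, hq, K.2, rfl⟩

lemma isUnit_mhClass (K : AcyclicComplex A) : IsUnit (mhClass K.1) := by
  have := isUnit_toModified one_ne_zero K
  rwa [one_smul] at this

lemma toHallQuotient_surjective :
    Function.Surjective (toHallQuotient : HallAlgebra (Z2Complex A) → HallQuotient A) :=
  Quotient.mk''_surjective

lemma hallOne_mem_acyclicSet : hallOne A ∈ acyclicSet A :=
  ⟨1, 0, one_ne_zero, acyclic_of_isZero _ (Limits.isZero_zero _), by rw [one_smul]; rfl⟩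

variable [FinitaryHereditary A]

/-! ### The action of the modified Hall algebra -/

section Action

lemma isUnit_act {q : ℚ} (hq : q ≠ 0) (K : AcyclicComplex A) :
    IsUnit (act (q • HallAlgebra.cls K.1)) := by
  refine isUnit_of_monomial ((Equiv.addRight (AcyclicK0.cls K)).prodCongr (Equiv.refl _))
    (fun p => Units.mk0 q hq *
      (-(eulerRight K.1 p.1 + eulerLeft (stalkClass p.2).rep (AcyclicK0.cls K))).toMul) fun p => ?_
  rw [map_smul, LinearMap.smul_apply, act_acyclic_single, smul_smul, Units.val_mul]
  rfl

variable (A) in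
/-- The action of the Hall algebra on the torus space as a ring homomorphism. -/
def actHom : HallAlgebra (Z2Complex A) →ₙ+* Module.End ℚ (TorusSpace A) where
  toFun := act
  map_zero' := map_zero act
  map_add' := map_add act
  map_mul' := act_mul

lemma hallIdeal_le_ker : hallIdeal A ≤ TwoSidedIdeal.ker (actHom A) := by
  refine TwoSidedIdeal.span_le.2 ?_
  rintro _ ⟨T, hT, hK, rfl⟩
  refine (TwoSidedIdeal.mem_ker _).2 ?_
  rw [map_sub, sub_eq_zero]
  exact act_of_isExtension ⟨T.f, T.g, T.zero, hT⟩ hK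

variable (A) in
/-- The action of the Hall quotient on the torus space. -/
def actQuotient : HallQuotient A →ₙ+* Module.End ℚ (TorusSpace A) where
  toFun := Quotient.lift (s := (hallIdeal A).ringCon.toSetoid) act fun x y h => by
    have h' := (TwoSidedIdeal.mem_ker _).1
      (hallIdeal_le_ker ((TwoSidedIdeal.rel_iff (hallIdeal A) x y).1 h))
    rwa [map_sub, sub_eq_zero] at h'
  map_zero' := map_zero act
  map_add' x y := by
    induction x using Quotient.inductionOn'
    induction y using Quotient.inductionOn'
    exact map_add act _ _
  map_mul' x y := by
    induction x using Quotient.inductionOn'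
    induction y using Quotient.inductionOn'
    exact act_mul _ _

variable (A) in
/-- The action of the modified Hall algebra on the torus space. -/
def actModified : ModifiedHallAlgebra A →+* Module.End ℚ (TorusSpace A) :=
  InvertingRing.lift (actQuotient A) act_one (by
    rintro ⟨_, q, K, hq, hK, rfl⟩
    exact isUnit_act hq ⟨K, hK⟩)

lemma actModified_toModified (x : HallAlgebra (Z2Complex A)) :
    actModified A (toModified x) = act x :=
  InvertingRing.lift_of _ _ _ _

variable (A) in
/-- The action on the class of the zero complex. -/
def evalVacuum : ModifiedHallAlgebra A →+ TorusSpace A where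
  toFun r := actModified A r (toTorusSpace (HallAlgebra.cls 0))
  map_zero' := by rw [map_zero, LinearMap.zero_apply]
  map_add' r s := by rw [map_add, LinearMap.add_apply]

lemma evalVacuum_apply (r : ModifiedHallAlgebra A) :
    evalVacuum A r = actModified A r (toTorusSpace (HallAlgebra.cls 0)) := rfl

lemma evalVacuum_toModified (x : HallAlgebra (Z2Complex A)) :
    evalVacuum A (toModified x) = toTorusSpace x := by
  rw [evalVacuum_apply, actModified_toModified, act_toTorusSpace, hall_mul_one]

lemma evalVacuum_mul (r s : ModifiedHallAlgebra A) :
    evalVacuum A (r * s) = actModified A r (evalVacuum A s) := by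
  rw [evalVacuum_apply, map_mul]
  rfl

end Action

/-! ### Ore condition, right localization and faithfulness -/

section Localization

lemma exists_toHallQuotient_mul_eq {x y : HallAlgebra (Z2Complex A)}
    (h : toTorusSpace x = toTorusSpace y) : ∃ t ∈ acyclicSet A,
      toHallQuotient x * t = toHallQuotient y * t := by
  obtain ⟨K, hK⟩ := mem_acyclicTorsion (x := x - y) (by rw [map_sub, h, sub_self])
  rw [sub_mul] at hK
  exact ⟨_, ⟨1, K.1, one_ne_zero, K.2, by rw [one_smul]⟩, toHallQuotient_eq_iff.2 hK⟩

/-- Acting on the class of the zero complex recovers the image in the torus space; conversely,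
elements with equal images agree after multiplication by a denominator, which becomes a unit. -/
lemma toModified_eq_iff {x y : HallAlgebra (Z2Complex A)} :
    toModified x = toModified y ↔ toTorusSpace x = toTorusSpace y := by
  constructor
  · intro h
    rw [← evalVacuum_toModified, h, evalVacuum_toModified]
  · intro h
    obtain ⟨t, ht, h⟩ := exists_toHallQuotient_mul_eq h
    have := congrArg (toModifiedHall A) h
    rw [map_mul, map_mul] at this
    exact (InvertingRing.isUnit_of ht).mul_right_cancel this

lemma toTorusSpace_mul_acyclic (M : Z2Complex A) (K : AcyclicComplex A) :
    toTorusSpace (HallAlgebra.cls M * HallAlgebra.cls K.1) =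
      (((euler M K.1)⁻¹ : ℚˣ) : ℚ) •
        shift (AcyclicK0.cls K) (toTorusSpace (HallAlgebra.cls M)) := by
  have h : IsExtension K.1 K.1 (0 : Z2Complex A) :=
    isExtension_right_of_isZero (Limits.isZero_zero _) (Iso.refl _)
  rw [h.map_cls_mul_cls_right toTorusSpace (shift (AcyclicK0.cls K)) M
    (subsingleton_ext_to_acyclic _ K.2) fun E E' hE => toTorusSpace_left K hE, hall_mul_one]

lemma toTorusSpace_acyclic_mul (K : AcyclicComplex A) (M : Z2Complex A) :
    toTorusSpace (HallAlgebra.cls K.1 * HallAlgebra.cls M) =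
      (((euler K.1 M)⁻¹ : ℚˣ) : ℚ) •
        shift (AcyclicK0.cls K) (toTorusSpace (HallAlgebra.cls M)) := by
  have h : IsExtension (0 : Z2Complex A) K.1 K.1 :=
    isExtension_of_isZero (Limits.isZero_zero _) (Iso.refl _)
  rw [h.map_cls_mul_cls_left toTorusSpace (shift (AcyclicK0.cls K)) M
    (subsingleton_ext_from_acyclic _ K.2) fun E E' hE => toTorusSpace_right K hE, hall_one_mul]

/-- The Ore condition: in the torus space [M][K] and [K][M] are both nonzero multiples of the class
of `M` translated by [K], so they differ by a scalar. -/
lemma exists_toTorusSpace_mul_eq (x : HallAlgebra (Z2Complex A)) (K : AcyclicComplex A) :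
    ∃ y, toTorusSpace (x * HallAlgebra.cls K.1) = toTorusSpace (HallAlgebra.cls K.1 * y) := by
  induction x using HallAlgebra.induction with
  | h0 => exact ⟨0, by rw [zero_mul, mul_zero]⟩
  | hadd x x' hx hx' =>
    obtain ⟨y, hy⟩ := hx
    obtain ⟨y', hy'⟩ := hx'
    exact ⟨y + y', by rw [add_mul, mul_add, map_add, map_add, hy, hy']⟩
  | hcls c M =>
    refine ⟨(c * (((euler M K.1)⁻¹ * euler K.1 M : ℚˣ) : ℚ)) • HallAlgebra.cls M, ?_⟩
    rw [hall_smul_mul, hall_mul_smul, map_smul, map_smul, toTorusSpace_mul_acyclic,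
      toTorusSpace_acyclic_mul, smul_smul, smul_smul, mul_assoc, ← Units.val_mul,
      mul_inv_cancel_right]

lemma exists_toTorusSpace_mul_eq' (x : HallAlgebra (Z2Complex A)) (K : AcyclicComplex A) :
    ∃ y, toTorusSpace (HallAlgebra.cls K.1 * x) = toTorusSpace (y * HallAlgebra.cls K.1) := by
  induction x using HallAlgebra.induction with
  | h0 => exact ⟨0, by rw [zero_mul, mul_zero]⟩
  | hadd x x' hx hx' =>
    obtain ⟨y, hy⟩ := hx
    obtain ⟨y', hy'⟩ := hx'
    exact ⟨y + y', by rw [add_mul, mul_add, map_add, map_add, hy, hy']⟩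
  | hcls c M =>
    refine ⟨(c * (((euler K.1 M)⁻¹ * euler M K.1 : ℚˣ) : ℚ)) • HallAlgebra.cls M, ?_⟩
    rw [hall_smul_mul, hall_mul_smul, map_smul, map_smul, toTorusSpace_mul_acyclic,
      toTorusSpace_acyclic_mul, smul_smul, smul_smul, mul_assoc, ← Units.val_mul,
      mul_inv_cancel_right]

lemma mul_mem_acyclicSet {s t : HallQuotient A} (hs : s ∈ acyclicSet A) (ht : t ∈ acyclicSet A) :
    s * t ∈ acyclicSet A := by
  obtain ⟨q, K, hq, hK, rfl⟩ := hs
  obtain ⟨q', K', hq', hK', rfl⟩ := ht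
  refine ⟨q * q' * (((euler K K')⁻¹ : ℚˣ) : ℚ), K' ⊞ K, mul_ne_zero (mul_ne_zero hq hq')
    (Units.ne_zero _), acyclic_biprod hK' hK, ?_⟩
  refine (toHallQuotient_eq_iff (x := (q • HallAlgebra.cls K) * (q' • HallAlgebra.cls K'))).2 ?_
  rw [hall_smul_mul, hall_mul_smul, smul_smul, mul_smul (q * q'), ← smul_sub]
  exact Submodule.smul_mem _ _ (mul_cls_sub_mem_hallRelations K hK')

theorem isRightLocalization_toModifiedHall :
    IsRightLocalization (hallOne A) (acyclicSet A) (toModifiedHall A) where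
  map_one := InvertingRing.of_one
  isUnit _ := InvertingRing.isUnit_of
  surj := by
    refine InvertingRing.exists_mul_of_eq_of hallOne_mem_acyclicSet
      (fun s hs t ht => mul_mem_acyclicSet hs ht) ?_
    rintro a _ ⟨q, K, hq, hK, rfl⟩
    obtain ⟨x, rfl⟩ := toHallQuotient_surjective a
    obtain ⟨y, hy⟩ := exists_toTorusSpace_mul_eq x ⟨K, hK⟩
    refine ⟨toHallQuotient y, ?_⟩
    change toModified _ * toModified _ = toModified _ * toModified _
    rw [← map_mul, ← map_mul, toModified_eq_iff, hall_mul_smul, hall_smul_mul, map_smul, map_smul,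
      hy]
  eq_iff a b := by
    obtain ⟨x, rfl⟩ := toHallQuotient_surjective a
    obtain ⟨y, rfl⟩ := toHallQuotient_surjective b
    refine ⟨fun h => exists_toHallQuotient_mul_eq (toModified_eq_iff.1 h), ?_⟩
    rintro ⟨t, ht, h⟩
    have := congrArg (toModifiedHall A) h
    rw [map_mul, map_mul] at this
    exact (InvertingRing.isUnit_of ht).mul_right_cancel this

lemma exists_mul_toModified (r : ModifiedHallAlgebra A) : ∃ (q : ℚ) (K : AcyclicComplex A)
    (x : HallAlgebra (Z2Complex A)), q ≠ 0 ∧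
      r * toModified (q • HallAlgebra.cls K.1) = toModified x := by
  obtain ⟨a, _, ⟨q, K, hq, hK, rfl⟩, h⟩ := isRightLocalization_toModifiedHall.surj r
  obtain ⟨x, rfl⟩ := toHallQuotient_surjective a
  exact ⟨q, ⟨K, hK⟩, x, hq, h⟩

/-- Evaluation respects left multiplication only, whereas the denominator of r stands on its right.
Since acyclic classes commute with others up to scalars, the denominator s can be moved to the left:
sr = y comes from the Hall algebra, evaluation shows y = 0, and s is a unit. -/
theorem evalVacuum_injective : Function.Injective (evalVacuum A) := by
  refine (injective_iff_map_eq_zero _).2 fun r hr => ?_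
  obtain ⟨q, K, x, hq, h⟩ := exists_mul_toModified r
  obtain ⟨y, hy⟩ := exists_toTorusSpace_mul_eq' x K
  have hu := isUnit_toModified hq K
  have h' : toModified (q • HallAlgebra.cls K.1) * r = toModified y := by
    refine hu.mul_right_cancel ?_
    rw [mul_assoc, h, ← map_mul, ← map_mul, toModified_eq_iff, hall_mul_smul, hall_smul_mul,
      map_smul, map_smul, hy]
  have hy₀ : toTorusSpace y = toTorusSpace 0 := by
    rw [← evalVacuum_toModified, ← h', evalVacuum_mul, hr, map_zero, map_zero]
  have e := toModified_eq_iff.2 hy₀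
  rw [map_zero, ← h'] at e
  exact hu.mul_left_cancel (e.trans (mul_zero _).symm)

theorem actModified_injective : Function.Injective (actModified A) :=
  fun _ _ h => evalVacuum_injective (LinearMap.congr_fun h _)

end Localization

end

end ModifiedHall

/-! ### The quantum torus and the bases over it -/

namespace ModifiedHall

open Abelian HomologicalComplex

noncomputable section

attribute [local instance] HasExt.standard

/-- A family is a basis when, in suitable coordinates, the multiples of its members by scalars are
the nonzero multiples of the coordinate vectors. -/
theorem exists_basis_of_coordinates {T R G ι : Type*} [Ring T] [AddCommGroup R] [Module T R]
    (w : T ≃+ (G →₀ ℚ)) (ev : R →+ (G × ι →₀ ℚ)) (hev : Function.Injective ev) (b : ι → R)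
    (c : G × ι → ℚˣ)
    (h : ∀ q a d, ev (w.symm (Finsupp.single a q) • b d) = Finsupp.single (a, d) (q * c (a, d))) :
    ∃ B : Module.Basis ι T R, ⇑B = b := by
  classical
  -- In the coordinates `w` and `ev`, linear combination is diagonal with nonzero entries `c`. Its
  -- bijectivity and the injectivity of `ev` give a basis; surjectivity of `ev` need not be shown
  -- separately.
  let D : (ι →₀ T) →+ (G × ι →₀ ℚ) := ev.comp (Finsupp.linearCombination T b).toAddMonoidHom
  have hD (d : ι) (t : T) : D (Finsupp.single d t) = ev (t • b d) :=
    congrArg ev (Finsupp.linearCombination_single T t d)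
  have hDs (a : G) (d : ι) (q : ℚ) : D (Finsupp.single d (w.symm (Finsupp.single a q))) =
      Finsupp.single (a, d) (q * c (a, d)) := by rw [hD, h]
  have key (x : ι →₀ T) (p : G × ι) : D x p = w (x p.2) p.1 * c p := by
    induction x using Finsupp.induction_linear with
    | zero => simp
    | add x y hx hy => simp [hx, hy, add_mul]
    | single d t =>
      obtain ⟨y, rfl⟩ := w.symm.surjective t
      induction y using Finsupp.induction_linear with
      | zero => simp
      | add y z hy hz =>
        rw [map_add, Finsupp.single_add, map_add, Finsupp.add_apply, hy, hz, ← add_mul,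
          Finsupp.add_apply, map_add, Finsupp.add_apply]
      | single a q =>
        obtain ⟨a', d'⟩ := p
        rw [hDs]
        by_cases hd : d = d'
        · subst hd
          by_cases ha : a = a'
          · subst ha
            simp
          · simp [ha]
        · simp [hd]
  have hinj : Function.Injective D := by
    refine (injective_iff_map_eq_zero D).2 fun x hx => ?_
    ext d
    refine w.injective (Finsupp.ext fun a => ?_)
    have := key x (a, d)
    rw [hx, Finsupp.zero_apply, zero_eq_mul, or_iff_left (Units.ne_zero _)] at this
    rw [this, Finsupp.zero_apply, map_zero, Finsupp.zero_apply]
  have hsurj : Function.Surjective D := by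
    rw [← AddMonoidHom.range_eq_top, eq_top_iff]
    rintro y -
    induction y using Finsupp.induction_linear with
    | zero => exact zero_mem _
    | add y z hy hz => exact add_mem hy hz
    | single p q =>
      refine ⟨Finsupp.single p.2 (w.symm (Finsupp.single p.1 (q * ((c p)⁻¹ : ℚˣ)))), ?_⟩
      rw [hDs, Units.inv_mul_cancel_right]
  have hbij : Function.Bijective (Finsupp.linearCombination T b) := by
    refine ⟨fun x y hxy => hinj (congrArg ev hxy), fun r => ?_⟩
    obtain ⟨x, hx⟩ := hsurj (ev r)
    exact ⟨x, hev hx⟩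
  refine ⟨Module.Basis.ofRepr (LinearEquiv.ofBijective _ hbij).symm, funext fun d => ?_⟩
  rw [Module.Basis.coe_ofRepr, LinearEquiv.symm_symm]
  exact (Finsupp.linearCombination_single T 1 d).trans (one_smul T _)

namespace TwistedGroupAlgebra

variable {G : Type*} [AddCommGroup G] (χ : G →+ G →+ Additive ℚˣ)

/-- The coordinates of an element of the twisted group algebra. -/
def toFinsupp : TwistedGroupAlgebra χ ≃ₗ[ℚ] (G →₀ ℚ) := LinearEquiv.refl ℚ (G →₀ ℚ)

lemma toFinsupp_symm_single (a : G) (q : ℚ) :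
    (toFinsupp χ).symm (Finsupp.single a q) = q • of χ a := by
  rw [← mul_one q, ← smul_eq_mul, ← Finsupp.smul_single, map_smul, smul_eq_mul, mul_one]
  rfl

lemma of_mul_of (a b : G) : of χ a * of χ b = (((χ a b).toMul⁻¹ : ℚˣ) : ℚ) • of χ (a + b) :=
  mulMap_of χ a b

lemma smul_mul (q : ℚ) (x y : TwistedGroupAlgebra χ) : (q • x) * y = q • (x * y) := by
  change mulMap χ (q • x) y = q • mulMap χ x y
  rw [map_smul, LinearMap.smul_apply]

lemma mul_smul (q : ℚ) (x y : TwistedGroupAlgebra χ) : x * (q • y) = q • (x * y) :=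
  map_smul (mulMap χ x) q y

end TwistedGroupAlgebra

variable {A : Type u} [Category.{v} A] [Abelian A]

lemma TorusSpace.hom_ext {f g : Module.End ℚ (TorusSpace A)}
    (h : ∀ a d, f (Finsupp.single (a, d) 1) = g (Finsupp.single (a, d) 1)) : f = g :=
  Finsupp.basisSingleOne.ext fun p => by simpa using h p.1 p.2

variable [FinitaryHereditary A]

section Torus

/-- The action of a basis element of the quantum torus on the torus space. -/
def torusActOf (g : AcyclicK0 A) : Module.End ℚ (TorusSpace A) :=
  Finsupp.linearCombination ℚ fun p =>
    (((-(eulerForm A g p.1 + eulerLeft (stalkClass p.2).rep g)).toMul : ℚˣ) : ℚ) •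
      Finsupp.single (g + p.1, p.2) 1

lemma torusActOf_single (g h : AcyclicK0 A) (d : IsoClass A × IsoClass A) :
    torusActOf g (Finsupp.single (h, d) 1) =
      (((-(eulerForm A g h + eulerLeft (stalkClass d).rep g)).toMul : ℚˣ) : ℚ) •
        Finsupp.single (g + h, d) 1 :=
  (Finsupp.linearCombination_single _ _ _).trans (one_smul _ _)

lemma torusActOf_zero : torusActOf (0 : AcyclicK0 A) = 1 :=
  TorusSpace.hom_ext fun a d => by simp [torusActOf_single]

lemma torusActOf_mul (g h : AcyclicK0 A) : torusActOf g * torusActOf h =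
    (((eulerForm A g h).toMul⁻¹ : ℚˣ) : ℚ) • torusActOf (g + h) :=
  TorusSpace.hom_ext fun a d => by
    rw [Module.End.mul_apply, torusActOf_single, map_smul, torusActOf_single, LinearMap.smul_apply,
      torusActOf_single, smul_smul, smul_smul, ← add_assoc, ← Units.val_mul, ← Units.val_mul]
    rw [← toMul_neg, ← toMul_add, ← toMul_add]
    congr 3
    simp only [map_add, AddMonoidHom.add_apply]
    abel

lemma torusActOf_cls (K : AcyclicComplex A) :
    torusActOf (AcyclicK0.cls K) = actModified A (mhClass K.1) :=
  TorusSpace.hom_ext fun a d => by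
    rw [← toModified_cls, actModified_toModified, act_acyclic_single, torusActOf_single,
      eulerForm_cls, add_comm a]

variable (A) in
/-- The action of the quantum torus on the torus space. -/
def torusAct : QuantumTorus (eulerForm A) →+* Module.End ℚ (TorusSpace A) :=
  let f : QuantumTorus (eulerForm A) →ₗ[ℚ] Module.End ℚ (TorusSpace A) :=
    Finsupp.linearCombination ℚ torusActOf ∘ₗ
      (TwistedGroupAlgebra.toFinsupp (eulerForm A)).toLinearMap
  have hf (g : AcyclicK0 A) : f (TwistedGroupAlgebra.of _ g) = torusActOf g :=
    (Finsupp.linearCombination_single _ _ _).trans (one_smul _ _)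
  { toFun := f
    map_zero' := map_zero f
    map_add' := map_add f
    map_one' := (hf 0).trans torusActOf_zero
    map_mul' := fun x y => by
      induction x using TwistedGroupAlgebra.induction with
      | h0 => simp
      | hadd x x' hx hx' => rw [add_mul, map_add, hx, hx', map_add, add_mul]
      | hof c g =>
        induction y using TwistedGroupAlgebra.induction with
        | h0 => simp
        | hadd y y' hy hy' => rw [mul_add, map_add, hy, hy', map_add, mul_add]
        | hof c' h =>
          rw [TwistedGroupAlgebra.smul_mul, TwistedGroupAlgebra.mul_smul,
            TwistedGroupAlgebra.of_mul_of, map_smul, map_smul, map_smul, map_smul, map_smul, hf, hf,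
            hf, smul_mul_assoc, mul_smul_comm, torusActOf_mul] }

lemma torusAct_smul_of (q : ℚ) (g : AcyclicK0 A) :
    torusAct A (q • TwistedGroupAlgebra.of _ g) = q • torusActOf g := by
  rw [← TwistedGroupAlgebra.toFinsupp_symm_single]
  exact Finsupp.linearCombination_single _ _ _

lemma torusAct_of (g : AcyclicK0 A) :
    torusAct A (TwistedGroupAlgebra.of _ g) = torusActOf g := by
  rw [← one_smul ℚ (TwistedGroupAlgebra.of _ g), torusAct_smul_of, one_smul]

lemma smul_mem_range (q : ℚ) {f : Module.End ℚ (TorusSpace A)} (hf : f ∈ (actModified A).range) :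
    q • f ∈ (actModified A).range := by
  obtain ⟨r, rfl⟩ := hf
  refine ⟨toModified (q • HallAlgebra.cls 0) * r, ?_⟩
  rw [map_mul, actModified_toModified, map_smul, act_one, smul_mul_assoc, one_mul]

/-- Every g is [K] - [L], and the operators of g and [L] compose to a multiple of that of [K]. As
[L] is invertible in the modified algebra, the operator of g is that of a multiple of [K][L]⁻¹. -/
lemma torusActOf_mem_range (g : AcyclicK0 A) : torusActOf g ∈ (actModified A).range := by
  obtain ⟨K, L, rfl⟩ := AcyclicK0.exists_eq_sub g
  set g := AcyclicK0.cls K - AcyclicK0.cls L with hg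
  obtain ⟨u, hu⟩ := isUnit_mhClass L
  have h := torusActOf_mul g (AcyclicK0.cls L)
  rw [show g + AcyclicK0.cls L = AcyclicK0.cls K by rw [hg, sub_add_cancel], torusActOf_cls K,
    torusActOf_cls L, ← hu] at h
  have h' : torusActOf g = (((eulerForm A g (AcyclicK0.cls L)).toMul⁻¹ : ℚˣ) : ℚ) •
      actModified A (mhClass K.1 * (u⁻¹ : (ModifiedHallAlgebra A)ˣ)) := by
    rw [map_mul, ← smul_mul_assoc, ← h, mul_assoc, ← map_mul, Units.mul_inv, map_one, mul_one]
  rw [h']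
  exact smul_mem_range _ ⟨_, rfl⟩

lemma torusAct_mem_range (t : QuantumTorus (eulerForm A)) :
    torusAct A t ∈ (actModified A).range := by
  induction t using TwistedGroupAlgebra.induction with
  | h0 => rw [map_zero]; exact zero_mem _
  | hadd x y hx hy => rw [map_add]; exact add_mem hx hy
  | hof c g => rw [torusAct_smul_of]; exact smul_mem_range c (torusActOf_mem_range g)

variable (A) in
/-- The modified Hall algebra is isomorphic to its image in the endomorphisms of the torus space. -/
def modifiedEquivRange : ModifiedHallAlgebra A ≃+* (actModified A).range :=
  RingEquiv.ofBijective (actModified A).rangeRestrict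
    ⟨fun _ _ h => actModified_injective (congrArg Subtype.val h),
      (actModified A).rangeRestrict_surjective⟩

variable (A) in
/-- The homomorphism from the quantum torus to the modified Hall algebra. -/
def torusToModified : QuantumTorus (eulerForm A) →+* ModifiedHallAlgebra A :=
  (modifiedEquivRange A).symm.toRingHom.comp
    ((torusAct A).codRestrict (actModified A).range torusAct_mem_range)

lemma actModified_torusToModified (t : QuantumTorus (eulerForm A)) :
    actModified A (torusToModified A t) = torusAct A t :=
  congrArg Subtype.val ((modifiedEquivRange A).apply_symm_apply ((torusAct A).codRestrict _ torusAct_mem_range t))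

lemma torusToModified_cls (K : AcyclicComplex A) :
    torusToModified A (TwistedGroupAlgebra.of _ (AcyclicK0.cls K)) = mhClass K.1 :=
  actModified_injective (by rw [actModified_torusToModified, torusAct_of, torusActOf_cls])

lemma evalVacuum_stalk (d : IsoClass A × IsoClass A) :
    evalVacuum A (mhClass (stalkClass d).rep) = Finsupp.single (0, d) 1 := by
  rw [← toModified_cls, evalVacuum_toModified, toTorusSpace_cls, degree_stalk]

theorem isLeftBasis_torusToModified : IsLeftBasis (torusToModified A)
    (fun p : IsoClass A × IsoClass A => mhClass (stalkClass p).rep) := by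
  let _ : Module (QuantumTorus (eulerForm A)) (ModifiedHallAlgebra A) :=
    Module.compHom _ (torusToModified A)
  -- The scalar is the one by which e_a moves the basis vector (0, d) to (a, d). Its factor with
  -- second argument 0 is trivial and is kept to match `torusActOf_single`.
  refine exists_basis_of_coordinates (TwistedGroupAlgebra.toFinsupp (eulerForm A)).toAddEquiv
    (evalVacuum A) evalVacuum_injective _
    (fun p => (-(eulerForm A p.1 0 + eulerLeft (stalkClass p.2).rep p.1)).toMul) fun q a d => ?_
  change evalVacuum A (torusToModified A 
    ((TwistedGroupAlgebra.toFinsupp _).symm (Finsupp.single a q)) * _) = _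
  rw [TwistedGroupAlgebra.toFinsupp_symm_single, evalVacuum_mul, actModified_torusToModified,
    torusAct_smul_of, evalVacuum_stalk, LinearMap.smul_apply, torusActOf_single, smul_smul,
    Finsupp.smul_single, add_zero, smul_eq_mul, mul_one]

theorem isRightBasis_torusToModified : IsRightBasis (torusToModified A)
    (fun p : IsoClass A × IsoClass A => mhClass (stalkClass p).rep) := by
  let _ : Module (QuantumTorus (eulerForm A))ᵐᵒᵖ (ModifiedHallAlgebra A) :=
    Module.compHom _ (RingHom.op (torusToModified A))
  have h0 : degree (0 : Z2Complex A) = (0, homologyClass (0 : Z2Complex A)) := by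
    rw [degree, defect_of_acyclic ⟨0, acyclic_of_isZero _ (Limits.isZero_zero _)⟩,
      AcyclicK0.cls_of_isZero (Limits.isZero_zero _)]
  -- Here e_a acts first on the vector of the zero complex and translates it by a, which gives the
  -- first scalar. The second is the Euler twist that arises when the stalk sum is moved past this
  -- translation.
  refine exists_basis_of_coordinates
    (MulOpposite.opAddEquiv.symm.trans (TwistedGroupAlgebra.toFinsupp (eulerForm A)).toAddEquiv)
    (evalVacuum A) evalVacuum_injective _
    (fun p => (-(eulerForm A p.1 0 +
      eulerLeft (stalkClass (homologyClass (0 : Z2Complex A))).rep p.1)).toMul *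
        (-eulerRight (stalkClass p.2).rep p.1).toMul) fun q a d => ?_
  change evalVacuum A (_ * torusToModified A 
    ((TwistedGroupAlgebra.toFinsupp _).symm (Finsupp.single a q))) = _
  rw [TwistedGroupAlgebra.toFinsupp_symm_single, evalVacuum_mul, evalVacuum_apply,
    actModified_torusToModified, torusAct_smul_of, LinearMap.smul_apply, toTorusSpace_cls, h0,
    torusActOf_single, map_smul, map_smul, ← toModified_cls, actModified_toModified, act_cls,
    ← shift_single a (0, homologyClass (0 : Z2Complex A)), ← h0, ← toTorusSpace_cls, actObj_shift, actObj_toTorusSpace, hall_mul_one,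
    toTorusSpace_cls, degree_stalk, shift_single, add_zero, smul_smul, smul_smul,
    Finsupp.smul_single, smul_eq_mul, mul_one, Units.val_mul, mul_assoc]

end Torus

end

end ModifiedHall

theorem corollary3p15 {k : Type w} [Field k] [Finite k]
    {A : Type u} [Category.{v} A] [Abelian A] [Linear k A]
    (hHom : ∀ X Y : A, Module.Finite k (X ⟶ Y))
    (hExt : ∀ (X Y : A) (n : ℕ), Module.Finite k (ExtGroup X Y n))
    (hHereditary : ∀ (X Y : A) (n : ℕ), 2 ≤ n → Subsingleton (ExtGroup X Y n)) :
    -- the Hall product is associative and unital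
    (∀ x y z : HallAlgebra (Z2Complex A), x * y * z = x * (y * z)) ∧
    (∀ x : HallAlgebra (Z2Complex A),
      HallAlgebra.cls (0 : Z2Complex A) * x = x ∧ x * HallAlgebra.cls (0 : Z2Complex A) = x) ∧
    -- the modified Ringel-Hall algebra is a right localization
    IsRightLocalization (hallOne A) (acyclicSet A) (toModifiedHall A) ∧
    -- the Euler form descends to the Grothendieck group of acyclic complexes, the quantum torus
    -- maps to the modified Ringel-Hall algebra, and the classes of `C_A ⊕ C_B^*` form a basis
    (∃ χ : AcyclicK0 A →+ AcyclicK0 A →+ Additive ℚˣ, IsEulerForm χ ∧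
      ∃ φ : QuantumTorus χ →+* ModifiedHallAlgebra A,
        (∀ K : AcyclicComplex A,
          φ (TwistedGroupAlgebra.of χ (AcyclicK0.cls K)) = mhClass K.1) ∧
        IsLeftBasis φ (fun p : IsoClass A × IsoClass A => mhClass (stalkClass p).rep) ∧
        IsRightBasis φ (fun p : IsoClass A × IsoClass A => mhClass (stalkClass p).rep)) ∧
    -- these classes are exactly the isomorphism classes of the derived category
    Function.Bijective
      (fun p : IsoClass A × IsoClass A => (stalkClass p).map (toZ2Derived A)) := by
  have : FinitaryHereditary A :=
    { finite_hom := fun X Y =>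
        have := hHom X Y
        Module.finite_of_finite k
      finite_ext := fun X Y =>
        have := hExt X Y 1
        Module.finite_of_finite k
      subsingleton_ext := hHereditary }
  exact ⟨hall_mul_assoc, fun x => ⟨hall_one_mul x, hall_mul_one x⟩,
    isRightLocalization_toModifiedHall,
    ⟨eulerForm A, isEulerForm_eulerForm, torusToModified A, torusToModified_cls,
      isLeftBasis_torusToModified, isRightBasis_torusToModified⟩,
    bijective_stalkClass_derived⟩
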